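/- **Setting.** On a probability space $(\Omega,\mathcal F,P)$ let $L,R$ be non-negative random variables with $P\{L>0\}+P\{R>0\}>1$. For $s>0$ put $\mathcal S(s)=\mathbb E[L^s+R^s]-1\in[-1,+\infty]$ and $\mu(s)=\mathcal S(s)/s$. Let $(L_n,R_n)_{n\ge1}$ be i.i.d. copies of $(L,R)$, and let $(I_n)_{n\ge1}$ be independent random variables, $I_n$ uniform on $\{1,\dots,n\}$, with $(L_n,R_n)_{n\geq 1}$ and $(I_n)_{n\geq 1}$ independent. Define $\beta_{1,1}=1$ and, for $n\ge1$, $$(\beta_{1,n+1},\dots,\beta_{n+1,n+1})=(\beta_{1,n},\dots,\beta_{I_n-1,n},\,L_n\beta_{I_n,n},\,R_n\beta_{I_n,n},\,\beta_{I_n+1,n},\dots,\beta_{n,n}).$$ Let $(\nu_t)_{t\ge0}$ be a Yule process (the pure birth process with $\nu_0=1$ and jump rate $k$ from $k$ to $k+1$), independent of the array $(\beta_{j,n})_{1\le j\le n}$. Let $\alpha>0$ with $\mathcal S(\alpha)<\infty$ and put $$M_n(\alpha)=\sum_{j=1}^n\beta_{j,n}^\alpha,\quad m_n(\alpha)=\frac{\Gamma(n+\mathcal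 S(\alpha))}{\Gamma(n)\Gamma(\mathcal S(\alpha)+1)},\quad \tilde M_n(\alpha)=\frac{M_n(\alpha)}{m_n(\alpha)},\quad \beta_{(n)}=\max_{1\le j\le n}\beta_{j,n},\quad \tilde\beta_{(n)}=\frac{\beta_{(n)}}{m_n(\alpha)^{1/\alpha}},$$ and $Y_t=m_{\nu_t}(\alpha)e^{-\mathcal S(\alpha)t}$. **Proposition.** Assume that $\mu(\delta)<\mu(\alpha)<+\infty$ for some $\delta>\alpha$. Then $\tilde M_n(\alpha)$ converges almost surely as $n\to\infty$; denote its limit by $\tilde M_\infty(\alpha)$. There exists a random variable $E$ with exponential distribution of parameter $1$, independent of $\tilde M_\infty(\alpha)$, such that, as $t\to+\infty$, $$Y_t\to\frac{E^{\mathcal S(\alpha)}}{\Gamma(\mathcal S(\alpha)+1)}\ \text{ a.s.},\qquad e^{-\mathcal S(\alpha)t}M_{\nu_t}(\alpha)\to Z_\infty(\alpha):=\frac{E^{\mathcal S(\alpha)}\tilde M_\infty(\alpha)}{\Gamma(\mathcal S(\alpha)+1)}\ \text{ a.s. and in }L^1 .$$ Moreover, $\mathbb E[e^{-\mathcal S(\alpha)t}M_{\nu_t}(\alpha)]=\mathbb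 E[Z_\infty(\alpha)]=1$ for every $t\ge0$; the law of $Z_\infty(\alpha)$ solves the fixed point equation $$Z\stackrel{\mathcal L}{=}\Theta^{\mathcal S(\alpha)}\,(L^\alpha Z_1+R^\alpha Z_2),$$ where $Z,Z_1,Z_2$ are non-negative random variables with the same law, $\Theta$ is uniform on $(0,1)$, and $Z_1$, $Z_2$, $\Theta$, $(L,R)$ are independent; and $\mathbb E[Z_\infty(\alpha)^{\delta/\alpha}]<+\infty$. Finally, $$\tilde\beta_{(\nu_t)}\to0\quad\text{and}\quad \beta_{(\nu_t)}e^{-\mu(\alpha)t}\to0\qquad\text{in probability as } t\to+\infty.$$ -/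

import Mathlib

open MeasureTheory ProbabilityTheory Filter Topology
open scoped NNReal ENNReal

noncomputable section

/-- `𝒮(s) = 𝔼[L ^ s + R ^ s] - 1 ∈ [-1, ∞]`, used for `s > 0` only. -/
def collisionS {Ω : Type*} [MeasurableSpace Ω] (P : Measure Ω) (L R : Ω → ℝ) (s : ℝ) : EReal :=
  ((∫⁻ ω, ENNReal.ofReal (L ω ^ s + R ω ^ s) ∂P : ℝ≥0∞) : EReal) - 1

/-- The spectral function `μ(s) = 𝒮(s) / s`, for `s > 0`. -/
def spectralFn {Ω : Type*} [MeasurableSpace Ω] (P : Measure Ω) (L R : Ω → ℝ) (s : ℝ) : EReal :=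
  collisionS P L R s / (s : EReal)

/-- `((Lₙ, Rₙ))ₙ≥₁` is an i.i.d. sequence of copies of `(L, R)`, `(Iₙ)ₙ≥₁` is a sequence of
independent random variables, `Iₙ` being uniform on `{1, …, n}`, and the two sequences are
independent. The entries with index `0` play no role. -/
structure IsCollisionSequence {Ω : Type*} [MeasurableSpace Ω] (P : Measure Ω) (L R : Ω → ℝ)
    (Ls Rs : ℕ → Ω → ℝ) (I : ℕ → Ω → ℕ) : Prop where
  measurable_left : ∀ n, 1 ≤ n → Measurable (Ls n)
  measurable_right : ∀ n, 1 ≤ n → Measurable (Rs n)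
  measurable_index : ∀ n, 1 ≤ n → Measurable (I n)
  identDistrib : ∀ n, 1 ≤ n →
    IdentDistrib (fun ω => (Ls n ω, Rs n ω)) (fun ω => (L ω, R ω)) P P
  indep_coeff : iIndepFun (fun (n : ℕ) (ω : Ω) => (Ls (n + 1) ω, Rs (n + 1) ω)) P
  index_uniform : ∀ n, 1 ≤ n → ∀ j ∈ Finset.Icc 1 n, P {ω | I n ω = j} = (n : ℝ≥0∞)⁻¹
  indep_index : iIndepFun (fun (n : ℕ) (ω : Ω) => I (n + 1) ω) P
  indep_coeff_index : IndepFun (fun (ω : Ω) (n : ℕ) => (Ls (n + 1) ω, Rs (n + 1) ω))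
    (fun (ω : Ω) (n : ℕ) => I (n + 1) ω) P

/-- The array of weights: `splitWeight Ls Rs I n j` is `β_{j,n}`, for `1 ≤ j ≤ n`. One starts from
`β_{1,1} = 1`, and the weights of generation `n + 1` are obtained from those of generation `n` by
replacing the entry with index `Iₙ` by the two consecutive entries `Lₙ β_{Iₙ,n}`, `Rₙ β_{Iₙ,n}`.
Since `I₁ = 1`, this gives `(β_{1,2}, β_{2,2}) = (L₁, R₁)`. -/
def splitWeight {Ω : Type*} (Ls Rs : ℕ → Ω → ℝ) (I : ℕ → Ω → ℕ) : ℕ → ℕ → Ω → ℝ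
  | 0, _, _ => 0
  | 1, j, _ => if j = 1 then 1 else 0
  | n + 2, j, ω =>
      if j < I (n + 1) ω then splitWeight Ls Rs I (n + 1) j ω
      else if j = I (n + 1) ω then Ls (n + 1) ω * splitWeight Ls Rs I (n + 1) (I (n + 1) ω) ω
      else if j = I (n + 1) ω + 1 then Rs (n + 1) ω * splitWeight Ls Rs I (n + 1) (I (n + 1) ω) ω
      else splitWeight Ls Rs I (n + 1) (j - 1) ω

/-- A Yule process: the pure birth process started from `1` that jumps from `k` to `k + 1` at
rate `k`. The holding times `τ 0, τ 1, …` in the states `1, 2, …` are independent, the one in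
state `k` being exponential of parameter `k`, and the process is in state `n + 1` exactly during
`[τ 0 + ⋯ + τ (n - 1), τ 0 + ⋯ + τ n)`. -/
structure IsYuleProcess {Ω : Type*} [MeasurableSpace Ω] (P : Measure Ω) (ν : ℝ≥0 → Ω → ℕ) :
    Prop where
  measurable : ∀ t, Measurable (ν t)
  exists_holding : ∃ τ : ℕ → Ω → ℝ,
    (∀ k, HasLaw (τ k) (expMeasure ((k : ℝ) + 1)) P) ∧ iIndepFun τ P ∧
    ∀ᵐ ω ∂P, ∀ (t : ℝ≥0) (n : ℕ), ν t ω = n + 1 ↔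
      ∑ k ∈ Finset.range n, τ k ω ≤ (t : ℝ) ∧ (t : ℝ) < ∑ k ∈ Finset.range (n + 1), τ k ω

/-- `M_n(α) = ∑_{j=1}^n β_{j,n} ^ α`. -/
def weightSum {Ω : Type*} (β : ℕ → ℕ → Ω → ℝ) (α : ℝ) (n : ℕ) (ω : Ω) : ℝ :=
  ∑ j ∈ Finset.Icc 1 n, β n j ω ^ α

/-- `m_n = Γ(n + S) / (Γ(n) Γ(S + 1))`, where `S` stands for `𝒮(α)`. -/
def gammaRatio (S : ℝ) (n : ℕ) : ℝ :=
  Real.Gamma (n + S) / (Real.Gamma n * Real.Gamma (S + 1))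

/-- `β_{(n)} = max_{1 ≤ j ≤ n} β_{j,n}`, for `n ≥ 1`. -/
def maxWeight {Ω : Type*} (β : ℕ → ℕ → Ω → ℝ) (n : ℕ) (ω : Ω) : ℝ :=
  sSup ((fun j => β n j ω) '' Set.Icc 1 n)

/-- `M̃_∞(α) = lim_n M_n(α) / m_n(α)`. -/
def normalizedLimit {Ω : Type*} (β : ℕ → ℕ → Ω → ℝ) (α S : ℝ) (ω : Ω) : ℝ :=
  limUnder atTop (fun n : ℕ => weightSum β α n ω / gammaRatio S n)

/-- The probability law `ζ` on `[0, ∞)` solves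
`Z =ᵈ Θ ^ S (L ^ α Z₁ + R ^ α Z₂)`, where `Z₁, Z₂` have law `ζ`, `Θ` is uniform on `(0, 1)`,
`(L, R)` has law `κ`, and `Θ`, `(L, R)`, `Z₁`, `Z₂` are independent. -/
def SolvesFixedPoint (κ : Measure (ℝ × ℝ)) (α S : ℝ) (ζ : Measure ℝ) : Prop :=
  IsProbabilityMeasure ζ ∧ ζ (Set.Iio 0) = 0 ∧
    ζ = Measure.map
      (fun x : ℝ × (ℝ × ℝ) × (ℝ × ℝ) => x.1 ^ S * (x.2.1.1 ^ α * x.2.2.1 + x.2.1.2 ^ α * x.2.2.2))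
      ((volume.restrict (Set.Ioo (0 : ℝ) 1)).prod (κ.prod (ζ.prod ζ)))

end

/-! ### Elementary inequalities -/

lemma Real.one_add_rpow_le_quadratic {p y : ℝ} (hp : 0 ≤ p) (hy : |y| ≤ 1) :
    (1 + y) ^ p ≤ 1 + p * y + p ^ 2 * Real.exp p * y ^ 2 := by
  obtain ⟨hy1, hy2⟩ := abs_le.1 hy
  have h1 : (1 + y) ^ p ≤ Real.exp (p * y) := by
    calc (1 + y) ^ p ≤ (Real.exp y) ^ p :=
          Real.rpow_le_rpow (by linarith) (by linarith [Real.add_one_le_exp y]) hp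
      _ = Real.exp (p * y) := by rw [← Real.exp_mul, mul_comm]
  have h2 : |Real.exp (p * y) - (1 + p * y)| ≤ |p * y| ^ 2 * Real.exp |p * y| := by
    have := Complex.norm_exp_sub_sum_le_norm_mul_exp ((p * y : ℝ) : ℂ) 2
    simp only [Finset.sum_range_succ, Finset.sum_range_zero, zero_add, pow_zero, pow_one,
      Nat.factorial, Nat.cast_one, div_one, mul_one] at this
    rwa [← Complex.ofReal_exp, ← Complex.ofReal_one, ← Complex.ofReal_add, ← Complex.ofReal_sub,
      Complex.norm_real, Complex.norm_real, Real.norm_eq_abs, Real.norm_eq_abs] at this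
  have h3 : |p * y| ≤ p := by
    rw [abs_mul, abs_of_nonneg hp]; exact mul_le_of_le_one_right hp hy
  have h4 : |p * y| ^ 2 * Real.exp |p * y| ≤ p ^ 2 * y ^ 2 * Real.exp p := by
    rw [sq_abs, mul_pow]; gcongr
  have := (abs_le.1 h2).2
  linarith

lemma Real.rpow_le_mul_add_rpow_neg_mul {p q x η : ℝ} (hq : 1 < q) (hqp : q ≤ p) (hx : 0 ≤ x)
    (hx1 : x ≤ 1) (hη : 0 < η) :
    x ^ q ≤ η * x + η ^ (-((p - 1) / (q - 1))) * x ^ p := by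
  rcases hx.eq_or_lt with rfl | hx0
  · rw [Real.zero_rpow (by linarith), Real.zero_rpow (by linarith)]; simp
  have hsplit : ∀ r : ℝ, x ^ r = x * x ^ (r - 1) := fun r => by
    rw [Real.rpow_sub_one hx0.ne']; field_simp
  rcases le_total (x ^ (q - 1)) η with h | h
  · have : x ^ q ≤ η * x := by rw [hsplit q, mul_comm]; gcongr
    have h2 : 0 ≤ η ^ (-((p - 1) / (q - 1))) * x ^ p := by positivity
    linarith
  · have h1 : x ^ q ≤ x := by
      simpa using Real.rpow_le_rpow_of_exponent_ge hx0 hx1 hq.le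
    have h2 : η ^ ((p - 1) / (q - 1)) ≤ x ^ (p - 1) := by
      calc η ^ ((p - 1) / (q - 1)) ≤ (x ^ (q - 1)) ^ ((p - 1) / (q - 1)) :=
            Real.rpow_le_rpow hη.le h (div_nonneg (by linarith) (by linarith))
        _ = x ^ (p - 1) := by
            rw [← Real.rpow_mul hx, mul_div_cancel₀]; linarith
    have h3 : 1 ≤ η ^ (-((p - 1) / (q - 1))) * x ^ (p - 1) := by
      rw [Real.rpow_neg hη.le, inv_mul_eq_div, one_le_div (by positivity)]; exact h2
    rw [hsplit p]
    have : x * 1 ≤ x * (η ^ (-((p - 1) / (q - 1))) * x ^ (p - 1)) := by gcongr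
    have : 0 ≤ η * x := by positivity
    nlinarith

lemma Real.exists_one_add_mul_rpow_le {p : ℝ} (hp : 1 < p) :
    ∀ x c : ℝ, 0 ≤ x → x ≤ 1 → -1 ≤ c →
      (1 + x * c) ^ p ≤ 1 + p * (x * c) +
        (p ^ 2 * Real.exp p + 2 ^ p) * (1 + |c| ^ p) * x ^ (min p 2) := by
  intro x c hx hx1 hc
  have hxc : -1 ≤ x * c := by nlinarith
  set q := min p 2 with hq
  have hxq : 0 ≤ x ^ q := Real.rpow_nonneg hx _
  have hcp : 0 ≤ |c| ^ p := Real.rpow_nonneg (abs_nonneg _) _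
  rcases le_or_gt (x * c) 1 with h | h
  · have habs : |x * c| ≤ 1 := abs_le.2 ⟨hxc, h⟩
    have key : (x * c) ^ 2 ≤ (1 + |c| ^ p) * x ^ q := by
      rcases le_total p 2 with h2 | h2
      · rw [hq, min_eq_left h2]
        have : (x * c) ^ 2 ≤ |x * c| ^ p := by
          rcases (abs_nonneg (x * c)).eq_or_lt with h0 | h0
          · rw [← sq_abs, ← h0, Real.zero_rpow (by linarith)]; norm_num
          · rw [← sq_abs, ← Real.rpow_natCast]
            exact Real.rpow_le_rpow_of_exponent_ge h0 habs (by exact_mod_cast h2)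
        rw [abs_mul, abs_of_nonneg hx, Real.mul_rpow hx (abs_nonneg _)] at this
        have h3 : 0 ≤ x ^ p := Real.rpow_nonneg hx _
        linarith
      · rw [hq, min_eq_right h2]
        have h3 : c ^ 2 ≤ 1 + |c| ^ p := by
          rcases le_total |c| 1 with h4 | h4
          · have : c ^ 2 ≤ 1 := (sq_le_one_iff_abs_le_one c).2 h4
            linarith
          · have : |c| ^ (2 : ℝ) ≤ |c| ^ p := Real.rpow_le_rpow_of_exponent_le h4 h2
            rw [Real.rpow_two, sq_abs] at this
            linarith
        rw [Real.rpow_two, mul_pow, mul_comm]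
        gcongr
    have h1 := Real.one_add_rpow_le_quadratic (by linarith : (0 : ℝ) ≤ p) habs
    have h2 : p ^ 2 * Real.exp p * (x * c) ^ 2 ≤ p ^ 2 * Real.exp p * ((1 + |c| ^ p) * x ^ q) := by
      gcongr
    have h3 : 0 ≤ (2 : ℝ) ^ p * ((1 + |c| ^ p) * x ^ q) := by positivity
    nlinarith
  · have hc0 : 0 < c := by
      by_contra h'
      push Not at h'
      nlinarith
    have h1 : (1 + x * c) ^ p ≤ (2 * (x * c)) ^ p :=
      Real.rpow_le_rpow (by linarith) (by linarith) (by linarith)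
    have hx0 : 0 < x := by
      rcases hx.eq_or_lt with rfl | h0
      · simp at h; linarith
      · exact h0
    rw [Real.mul_rpow (by norm_num) (by linarith), Real.mul_rpow hx hc0.le] at h1
    have h2 : x ^ p ≤ x ^ q := Real.rpow_le_rpow_of_exponent_ge hx0 hx1 (min_le_left _ _)
    rw [abs_of_pos hc0] at *
    have h3 : (2 : ℝ) ^ p * (x ^ p * c ^ p) ≤ 2 ^ p * (x ^ q * c ^ p) := by gcongr
    have h4 : 0 ≤ p ^ 2 * Real.exp p * ((1 + c ^ p) * x ^ q) := by positivity
    have h5 : 0 ≤ (2 : ℝ) ^ p * x ^ q := by positivity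
    nlinarith

/-- The second order expansion of `(M + b c) ^ p`, with an error that is split between a small
multiple of `M ^ (p - 1) b` and a large multiple of `b ^ p`. -/
lemma Real.exists_add_mul_rpow_le {p : ℝ} (hp : 1 < p) : ∃ C K : ℝ, 0 ≤ C ∧ 0 ≤ K ∧
    ∀ M b c η : ℝ, 0 ≤ b → b ≤ M → -1 ≤ c → 0 < η →
      (M + b * c) ^ p ≤ M ^ p + p * (M ^ (p - 1) * b) * c +
        C * (1 + |c| ^ p) * (η * (M ^ (p - 1) * b) + η ^ (-K) * b ^ p) := by
  have hq : 1 < min p 2 := lt_min hp one_lt_two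
  refine ⟨p ^ 2 * Real.exp p + 2 ^ p, (p - 1) / (min p 2 - 1), by positivity,
    div_nonneg (by linarith) (by linarith), fun M b c η hb hbM hc hη => ?_⟩
  rcases (hb.trans hbM).eq_or_lt with rfl | hM
  · obtain rfl : b = 0 := le_antisymm hbM hb
    simp [Real.zero_rpow (by linarith : p ≠ 0)]
  have hx0 : 0 ≤ b / M := by positivity
  have hx1 : b / M ≤ 1 := (div_le_one hM).2 hbM
  have h1 := Real.exists_one_add_mul_rpow_le hp (b / M) c hx0 hx1 hc
  have h2 := Real.rpow_le_mul_add_rpow_neg_mul hq (min_le_left p 2) hx0 hx1 hη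
  have hC : 0 ≤ (p ^ 2 * Real.exp p + 2 ^ p) * (1 + |c| ^ p) := by positivity
  have h3 := h1.trans (add_le_add_right (mul_le_mul_of_nonneg_left h2 hC) _)
  have h4 := mul_le_mul_of_nonneg_left h3 (Real.rpow_nonneg hM.le p)
  have hbc : 0 ≤ 1 + b / M * c := by nlinarith
  have h5 : M ^ p * (1 + b / M * c) ^ p = (M + b * c) ^ p := by
    rw [← Real.mul_rpow hM.le hbc]; congr 1; field_simp
  have h6 : M ^ p * (b / M) ^ p = b ^ p := by
    rw [← Real.mul_rpow hM.le hx0]; congr 1; field_simp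
  have h7 : M ^ (p - 1) * b = M ^ p * (b / M) := by
    rw [Real.rpow_sub_one hM.ne']; ring
  rw [h5] at h4
  rw [h7, ← h6]
  linarith

/-- A discrete Grönwall inequality. -/
lemma ENNReal.exists_bound_of_le_mul_one_add {a : ℕ → ℝ≥0∞} {u v : ℕ → ℝ} (ha : a 0 ≠ ∞)
    (hu : Summable u) (hv : Summable v) (hu0 : ∀ k, 0 ≤ u k) (hv0 : ∀ k, 0 ≤ v k)
    (h : ∀ k, a (k + 1) ≤ a k * ENNReal.ofReal (1 + u k) + ENNReal.ofReal (v k)) :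
    ∃ C : ℝ≥0, ∀ k, a k ≤ C := by
  have key : ∀ k, a k ≤ ENNReal.ofReal (Real.exp (∑ i ∈ Finset.range k, u i) *
      ((a 0).toReal + ∑ i ∈ Finset.range k, v i)) := by
    intro k
    induction k with
    | zero => simp [ENNReal.ofReal_toReal ha]
    | succ k ih =>
      refine (h k).trans ?_
      have hsv : 0 ≤ ∑ i ∈ Finset.range k, v i := Finset.sum_nonneg fun i _ => hv0 i
      have hsu : 0 ≤ ∑ i ∈ Finset.range (k + 1), u i := Finset.sum_nonneg fun i _ => hu0 i
      have ha0 : 0 ≤ (a 0).toReal := ENNReal.toReal_nonneg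
      have hu1 := hu0 k
      calc a k * ENNReal.ofReal (1 + u k) + ENNReal.ofReal (v k)
          ≤ ENNReal.ofReal (Real.exp (∑ i ∈ Finset.range k, u i) *
              ((a 0).toReal + ∑ i ∈ Finset.range k, v i)) * ENNReal.ofReal (1 + u k)
              + ENNReal.ofReal (v k) := by gcongr
        _ = ENNReal.ofReal (Real.exp (∑ i ∈ Finset.range k, u i) *
              ((a 0).toReal + ∑ i ∈ Finset.range k, v i) * (1 + u k) + v k) := by
            rw [← ENNReal.ofReal_mul (by positivity), ← ENNReal.ofReal_add (by positivity) (hv0 k)]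
        _ ≤ _ := by
            apply ENNReal.ofReal_le_ofReal
            rw [Finset.sum_range_succ v, ← add_assoc, mul_add (Real.exp _) _ (v k)]
            apply add_le_add
            · rw [Finset.sum_range_succ, Real.exp_add, mul_right_comm]
              have := Real.add_one_le_exp (u k)
              gcongr
              linarith
            · exact le_mul_of_one_le_left (hv0 k) (Real.one_le_exp hsu)
  refine ⟨(Real.exp (∑' i, u i) * ((a 0).toReal + ∑' i, v i)).toNNReal, fun k => ?_⟩
  refine (key k).trans (ENNReal.ofReal_le_ofReal ?_)
  have ha0 : 0 ≤ (a 0).toReal := ENNReal.toReal_nonneg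
  have hsv : 0 ≤ ∑ i ∈ Finset.range k, v i := Finset.sum_nonneg fun i _ => hv0 i
  gcongr
  · exact hu.sum_le_tsum _ fun i _ => hu0 i
  · exact hv.sum_le_tsum _ fun i _ => hv0 i

/-! ### Uniqueness of Laplace transforms -/

/-- A finite measure on `ℝ≥0` is determined by its Laplace transform at the natural numbers. -/
lemma MeasureTheory.Measure.ext_of_laplace_nnreal {μ ν : Measure ℝ≥0} [IsFiniteMeasure μ]
    [IsFiniteMeasure ν]
    (h : ∀ n : ℕ, ∫ x : ℝ≥0, Real.exp (-(n * x)) ∂μ = ∫ x : ℝ≥0, Real.exp (-(n * x)) ∂ν) :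
    μ = ν := by
  let e : BoundedContinuousFunction ℝ≥0 ℝ := BoundedContinuousFunction.ofNormedAddCommGroup
    (fun x : ℝ≥0 => Real.exp (-x)) (by fun_prop) 1 (fun x => by
      rw [Real.norm_eq_abs, abs_of_pos (Real.exp_pos _)]; simp)
  have he : ∀ x, e x = Real.exp (-x) := fun _ => rfl
  let A : StarSubalgebra ℝ (BoundedContinuousFunction ℝ≥0 ℝ) :=
    { (Polynomial.aeval (R := ℝ) e).range with
      star_mem' := fun {a} ha => by
        have : star a = a := by ext x; simp
        rwa [this] }
  have hA : ∀ g, g ∈ A ↔ ∃ Q : Polynomial ℝ, Polynomial.aeval e Q = g := fun g => Iff.rfl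
  refine ext_of_forall_mem_subalgebra_integral_eq_of_pseudoEMetric_complete_countable
    (𝕜 := ℝ) (A := A) ?_ ?_
  · intro x y hxy
    refine ⟨_, ⟨_, ⟨e, (hA e).2 ⟨Polynomial.X, by simp⟩, rfl⟩, rfl⟩, ?_⟩
    change Real.exp (-x) ≠ Real.exp (-y)
    intro h'
    exact hxy (NNReal.coe_injective (neg_injective (Real.exp_injective h')))
  · intro g hg
    obtain ⟨Q, rfl⟩ := (hA g).1 hg
    induction Q using Polynomial.induction_on' with
    | add p q hp hq =>
      have : ∀ ρ : Measure ℝ≥0, [IsFiniteMeasure ρ] → ∀ f : BoundedContinuousFunction ℝ≥0 ℝ,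
        Integrable f ρ := fun ρ _ f => f.integrable ρ
      simp only [map_add, BoundedContinuousFunction.coe_add, Pi.add_apply]
      rw [integral_add (this _ _) (this _ _), integral_add (this _ _) (this _ _),
        hp ((hA _).2 ⟨p, rfl⟩), hq ((hA _).2 ⟨q, rfl⟩)]
    | monomial n a =>
      have : ∀ x : ℝ≥0, (Polynomial.aeval e (Polynomial.monomial n a)) x
          = a * Real.exp (-(n * x)) := by
        intro x
        rw [Polynomial.aeval_monomial]
        simp only [BoundedContinuousFunction.coe_mul, Pi.mul_apply,
          BoundedContinuousFunction.coe_pow, Pi.pow_apply, he]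
        rw [← Real.exp_nat_mul]
        congr 1
        · simp
      simp only [this]
      rw [integral_const_mul, integral_const_mul, h n]

/-- Two probability measures on `[0, ∞)` with the same Laplace transform coincide. -/
lemma MeasureTheory.Measure.ext_of_laplace {μ ν : Measure ℝ} [IsProbabilityMeasure μ]
    [IsProbabilityMeasure ν] (hμ : ∀ᵐ x ∂μ, 0 ≤ x) (hν : ∀ᵐ x ∂ν, 0 ≤ x)
    (h : ∀ l : ℝ, 0 ≤ l → ∫⁻ x, ENNReal.ofReal (Real.exp (-(l * x))) ∂μ =
      ∫⁻ x, ENNReal.ofReal (Real.exp (-(l * x))) ∂ν) : μ = ν := by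
  have hback : ∀ ρ : Measure ℝ, (∀ᵐ x ∂ρ, 0 ≤ x) →
      (ρ.map Real.toNNReal).map (fun x : ℝ≥0 => (x : ℝ)) = ρ := by
    intro ρ hρ
    rw [Measure.map_map (by fun_prop) (by fun_prop)]
    conv_rhs => rw [← Measure.map_id (μ := ρ)]
    refine Measure.map_congr ?_
    filter_upwards [hρ] with x hx
    simp [hx]
  have hint : ∀ (ρ : Measure ℝ) [IsProbabilityMeasure ρ], (∀ᵐ x ∂ρ, 0 ≤ x) → ∀ n : ℕ,
      ∫ x : ℝ≥0, Real.exp (-(n * x)) ∂(ρ.map Real.toNNReal) =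
        (∫⁻ x, ENNReal.ofReal (Real.exp (-(n * x))) ∂ρ).toReal := by
    intro ρ _ hρ n
    rw [integral_map (by fun_prop) (by fun_prop), integral_eq_lintegral_of_nonneg_ae
      (Eventually.of_forall fun _ => (Real.exp_pos _).le) (by fun_prop)]
    congr 1
    refine lintegral_congr_ae ?_
    filter_upwards [hρ] with x hx
    simp [hx]
  rw [← hback μ hμ, ← hback ν hν]
  have := Measure.isProbabilityMeasure_map (μ := μ) (f := Real.toNNReal) (by fun_prop)
  have := Measure.isProbabilityMeasure_map (μ := ν) (f := Real.toNNReal) (by fun_prop)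
  congr 1
  refine Measure.ext_of_laplace_nnreal fun n => ?_
  rw [hint μ hμ, hint ν hν, h n n.cast_nonneg]

/-! ### Ratios of Gamma functions -/

lemma gammaRatio_pos {S : ℝ} (hS : -1 < S) {n : ℕ} (hn : 1 ≤ n) : 0 < gammaRatio S n := by
  have : (1 : ℝ) ≤ n := by exact_mod_cast hn
  unfold gammaRatio
  have h1 := Real.Gamma_pos_of_pos (s := n + S) (by linarith)
  have h2 := Real.Gamma_pos_of_pos (s := n) (by linarith)
  have h3 := Real.Gamma_pos_of_pos (s := S + 1) (by linarith)
  positivity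

lemma gammaRatio_one {S : ℝ} (hS : -1 < S) : gammaRatio S 1 = 1 := by
  have h3 := Real.Gamma_pos_of_pos (s := S + 1) (by linarith)
  unfold gammaRatio
  rw [Nat.cast_one, Real.Gamma_one, one_mul, add_comm, div_self h3.ne']

lemma gammaRatio_succ {S : ℝ} (hS : -1 < S) {n : ℕ} (hn : 1 ≤ n) :
    gammaRatio S (n + 1) = gammaRatio S n * (1 + S / n) := by
  have hn' : (1 : ℝ) ≤ n := by exact_mod_cast hn
  have h3 := Real.Gamma_pos_of_pos (s := S + 1) (by linarith)
  have h2 := Real.Gamma_pos_of_pos (s := n) (by linarith)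
  unfold gammaRatio
  push_cast
  rw [show (n : ℝ) + 1 + S = (n + S) + 1 by ring, Real.Gamma_add_one (by linarith),
    Real.Gamma_add_one (by linarith)]
  field_simp

lemma gammaRatio_eq_prod {S : ℝ} (hS : -1 < S) (n : ℕ) :
    gammaRatio S (n + 1) = (∏ j ∈ Finset.range n, (S + 1 + j)) / n.factorial := by
  induction n with
  | zero => simp [gammaRatio_one hS]
  | succ n ih =>
    rw [gammaRatio_succ hS (by omega), ih, Finset.prod_range_succ, Nat.factorial_succ]
    push_cast
    field_simp
    ring

lemma tendsto_gammaRatio_div_rpow {S : ℝ} (hS : -1 < S) :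
    Tendsto (fun n : ℕ => gammaRatio S n / (n : ℝ) ^ S) atTop (𝓝 (1 / Real.Gamma (S + 1))) := by
  rw [← tendsto_add_atTop_iff_nat 2]
  have h3 := Real.Gamma_pos_of_pos (s := S + 1) (by linarith)
  have h1 : Tendsto (fun n : ℕ => ((n : ℝ) / (n + 2)) ^ S * ((n : ℝ) / (n + 1))
      / Real.GammaSeq (S + 1) n) atTop (𝓝 (1 ^ S * 1 / Real.Gamma (S + 1))) := by
    refine ((Tendsto.rpow_const ?_ (Or.inl one_ne_zero)).mul ?_).div
      (Real.GammaSeq_tendsto_Gamma _) h3.ne'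
    · exact tendsto_natCast_div_add_atTop (2 : ℝ)
    · exact tendsto_natCast_div_add_atTop (1 : ℝ)
  rw [Real.one_rpow, one_mul] at h1
  refine h1.congr' ?_
  filter_upwards [eventually_gt_atTop 0] with n hn
  have hn' : (0 : ℝ) < n := by exact_mod_cast hn
  have hp : 0 < ∏ j ∈ Finset.range (n + 1), (S + 1 + (j : ℝ)) :=
    Finset.prod_pos fun j _ => by have := j.cast_nonneg (α := ℝ); linarith
  rw [show n + 2 = (n + 1) + 1 by ring, gammaRatio_eq_prod hS, Real.GammaSeq, Nat.factorial_succ,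
    Real.div_rpow hn'.le (by positivity), Real.rpow_add_one hn'.ne']
  push_cast
  rw [show (n : ℝ) + 1 + 1 = n + 2 by ring]
  have : (0 : ℝ) < ((n : ℝ) + 2) ^ S := by positivity
  field_simp

lemma exists_gammaRatio_bounds {S : ℝ} (hS : -1 < S) : ∃ c C : ℝ, 0 < c ∧ 0 < C ∧
    ∀ n : ℕ, 1 ≤ n → c * (n : ℝ) ^ S ≤ gammaRatio S n ∧ gammaRatio S n ≤ C * (n : ℝ) ^ S := by
  have h3 := Real.Gamma_pos_of_pos (s := S + 1) (by linarith)
  have hlim := tendsto_gammaRatio_div_rpow hS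
  have hpos : ∀ n : ℕ, 1 ≤ n → 0 < gammaRatio S n / (n : ℝ) ^ S := fun n hn => by
    have : (0 : ℝ) < n := by exact_mod_cast hn
    exact div_pos (gammaRatio_pos hS hn) (by positivity)
  obtain ⟨C, hC⟩ := hlim.bddAbove_range
  have hinv : Tendsto (fun n : ℕ => (gammaRatio S n / (n : ℝ) ^ S)⁻¹) atTop
      (𝓝 (1 / Real.Gamma (S + 1))⁻¹) := hlim.inv₀ (by positivity)
  obtain ⟨D, hD⟩ := hinv.bddAbove_range
  have hC0 : 0 < C := (hpos 1 le_rfl).trans_le (hC ⟨1, rfl⟩)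
  have hD0 : 0 < D := (inv_pos.2 (hpos 1 le_rfl)).trans_le (hD ⟨1, rfl⟩)
  refine ⟨D⁻¹, C, inv_pos.2 hD0, hC0, fun n hn => ?_⟩
  have hn0 : (0 : ℝ) < n := by exact_mod_cast hn
  have hnS : 0 < (n : ℝ) ^ S := by positivity
  constructor
  · rw [← le_div_iff₀ hnS]
    exact inv_le_of_inv_le₀ (hpos n hn) (hD ⟨n, rfl⟩)
  · rw [← div_le_iff₀ hnS]
    exact hC ⟨n, rfl⟩

lemma lintegral_rpow_mul_exp_neg_mul {a r : ℝ} (ha : 0 < a) (hr : 0 < r) :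
    ∫⁻ x in Set.Ioi (0 : ℝ), ENNReal.ofReal (x ^ (a - 1) * Real.exp (-(r * x))) =
      ENNReal.ofReal ((1 / r) ^ a * Real.Gamma a) := by
  rw [← Real.integral_rpow_mul_exp_neg_mul_Ioi ha hr, ofReal_integral_eq_lintegral_ofReal]
  · by_contra h
    have h0 := integral_undef h
    rw [Real.integral_rpow_mul_exp_neg_mul_Ioi ha hr] at h0
    have := Real.Gamma_pos_of_pos ha
    have : 0 < (1 / r) ^ a := by positivity
    nlinarith
  · filter_upwards [self_mem_ae_restrict measurableSet_Ioi] with x hx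
    have : (0 : ℝ) < x := hx
    positivity

/-- The negative binomial series. -/
lemma tsum_geometric_mul_gammaRatio {S y : ℝ} (hS : -1 < S) (hy : 0 < y) (hy1 : y ≤ 1) :
    ∑' n : ℕ, ENNReal.ofReal (y * (1 - y) ^ n) * ENNReal.ofReal (gammaRatio S (n + 1)) =
      ENNReal.ofReal (y ^ (-S)) := by
  have h3 := Real.Gamma_pos_of_pos (s := S + 1) (by linarith)
  have hy0 : 0 ≤ 1 - y := by linarith
  have hterm : ∀ n : ℕ,
      ENNReal.ofReal (y * (1 - y) ^ n) * ENNReal.ofReal (gammaRatio S (n + 1)) =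
      ∫⁻ x in Set.Ioi (0 : ℝ), ENNReal.ofReal (y / Real.Gamma (S + 1) * (x ^ S * Real.exp (-x)) *
        (((1 - y) * x) ^ n / n.factorial)) := by
    intro n
    have hG := lintegral_rpow_mul_exp_neg_mul (a := n + 1 + S) (r := 1)
      (by have := n.cast_nonneg (α := ℝ); linarith) one_pos
    rw [div_one, Real.one_rpow, one_mul] at hG
    rw [← ENNReal.ofReal_mul (by positivity)]
    have : y * (1 - y) ^ n * gammaRatio S (n + 1) =
        y * (1 - y) ^ n / (n.factorial * Real.Gamma (S + 1)) * Real.Gamma (n + 1 + S) := by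
      unfold gammaRatio
      push_cast
      rw [Real.Gamma_nat_eq_factorial]
      ring
    rw [this, ENNReal.ofReal_mul (by positivity), ← hG,
      ← lintegral_const_mul _ (by fun_prop)]
    refine setLIntegral_congr_fun measurableSet_Ioi fun x hx => ?_
    have hx' : (0 : ℝ) < x := hx
    rw [← ENNReal.ofReal_mul (by positivity)]
    congr 1
    rw [show (n : ℝ) + 1 + S - 1 = S + n by ring, Real.rpow_add hx', Real.rpow_natCast, mul_pow,
      one_mul]
    field_simp
  simp_rw [hterm]
  rw [← lintegral_tsum (fun n => by fun_prop)]
  have hG := lintegral_rpow_mul_exp_neg_mul (a := S + 1) (r := y) (by linarith) hy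
  have : ∀ x ∈ Set.Ioi (0 : ℝ), ∑' n : ℕ, ENNReal.ofReal (y / Real.Gamma (S + 1) *
      (x ^ S * Real.exp (-x)) * (((1 - y) * x) ^ n / n.factorial)) =
      ENNReal.ofReal (y / Real.Gamma (S + 1)) *
        ENNReal.ofReal (x ^ (S + 1 - 1) * Real.exp (-(y * x))) := by
    intro x hx
    have hx' : (0 : ℝ) < x := hx
    have hs : HasSum (fun n : ℕ => ((1 - y) * x) ^ n / (n.factorial : ℝ))
        (Real.exp ((1 - y) * x)) := by
      rw [Real.exp_eq_exp_ℝ]; exact NormedSpace.expSeries_div_hasSum_exp _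
    have hs' := hs.mul_left (y / Real.Gamma (S + 1) * (x ^ S * Real.exp (-x)))
    rw [← ENNReal.ofReal_tsum_of_nonneg (fun n => by positivity) hs'.summable, hs'.tsum_eq,
      ← ENNReal.ofReal_mul (by positivity), add_sub_cancel_right, mul_assoc, mul_assoc,
      ← Real.exp_add]
    congr 4
    ring
  rw [setLIntegral_congr_fun measurableSet_Ioi this, lintegral_const_mul _ (by fun_prop), hG,
    ← ENNReal.ofReal_mul (by positivity)]
  congr 1
  rw [one_div, Real.inv_rpow hy.le, Real.rpow_add_one hy.ne', Real.rpow_neg hy.le]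
  field_simp

lemma lintegral_Ioo_geometric {y : ℝ} (hy : 0 < y) (hy1 : y ≤ 1) (n : ℕ) :
    ∫⁻ θ in Set.Ioo y 1, ENNReal.ofReal ((y / θ) ^ 2 * ((n + 1) * (1 - y / θ) ^ n)) =
      ENNReal.ofReal (y * (1 - y) ^ (n + 1)) := by
  have hcont : ContinuousOn (fun θ : ℝ => (y / θ) ^ 2 * ((n + 1) * (1 - y / θ) ^ n))
      (Set.Icc y 1) := by
    have : ContinuousOn (fun θ : ℝ => y / θ) (Set.Icc y 1) :=
      continuousOn_const.div continuousOn_id fun θ hθ => (hy.trans_le hθ.1).ne'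
    fun_prop
  have hint : IntegrableOn (fun θ : ℝ => (y / θ) ^ 2 * ((n + 1) * (1 - y / θ) ^ n))
      (Set.Ioo y 1) := (hcont.integrableOn_Icc).mono_set Set.Ioo_subset_Icc_self
  rw [← ofReal_integral_eq_lintegral_ofReal hint, ← integral_Ioc_eq_integral_Ioo,
    ← intervalIntegral.integral_of_le hy1,
    intervalIntegral.integral_eq_sub_of_hasDerivAt (f := fun θ => y * (1 - y / θ) ^ (n + 1))]
  · congr 1
    simp [div_self hy.ne']
  · intro θ hθ
    rw [Set.uIcc_of_le hy1] at hθ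
    have hθ0 : θ ≠ 0 := (hy.trans_le hθ.1).ne'
    have h1 : HasDerivAt (fun θ : ℝ => 1 - y / θ) (y / θ ^ 2) θ := by
      have := ((hasDerivAt_inv hθ0).const_mul y).const_sub 1
      refine (this.congr_deriv ?_).congr_of_eventuallyEq (Eventually.of_forall fun x => ?_)
      · field_simp
      · simp [div_eq_mul_inv]
    have := (h1.fun_pow (n + 1)).const_mul y
    refine this.congr_deriv ?_
    push_cast
    field_simp
  · rw [intervalIntegrable_iff_integrableOn_Icc_of_le hy1]
    exact hcont.integrableOn_Icc
  · filter_upwards [self_mem_ae_restrict measurableSet_Ioo] with θ hθ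
    have : 0 < θ := hy.trans hθ.1
    have : y / θ ≤ 1 := (div_le_one this).2 hθ.1.le
    have : 0 ≤ 1 - y / θ := by linarith
    simp only [Pi.zero_apply]
    positivity

/-! ### Sums of independent exponential variables -/

lemma lintegral_expMeasure (r : ℝ) {f : ℝ → ℝ≥0∞} (hf : Measurable f) :
    ∫⁻ x, f x ∂(expMeasure r) =
      ∫⁻ x in Set.Ici 0, ENNReal.ofReal (r * Real.exp (-(r * x))) * f x := by
  have hm : Measurable (exponentialPDF r) := (measurable_exponentialPDFReal r).ennreal_ofReal
  have h1 : expMeasure r = volume.withDensity (exponentialPDF r) := rfl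
  rw [h1, lintegral_withDensity_eq_lintegral_mul _ hm hf, ← lintegral_indicator measurableSet_Ici]
  refine lintegral_congr fun x => ?_
  by_cases hx : 0 ≤ x
  · rw [Set.indicator_of_mem (by exact hx), Pi.mul_apply, exponentialPDF_of_nonneg hx]
  · rw [Set.indicator_of_notMem (by exact hx), Pi.mul_apply,
      exponentialPDF_of_neg (not_le.1 hx), zero_mul]

lemma lintegral_Icc_exp_convolution (n : ℕ) {t : ℝ} (ht : 0 ≤ t) :
    ∫⁻ s in Set.Icc 0 t, ENNReal.ofReal ((n + 1) * Real.exp (-((n + 1) * s)) *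
      (1 - Real.exp (-(t - s))) ^ n) = ENNReal.ofReal ((1 - Real.exp (-t)) ^ (n + 1)) := by
  have hcont : Continuous (fun s : ℝ => ((n : ℝ) + 1) * Real.exp (-((n + 1) * s)) *
      (1 - Real.exp (-(t - s))) ^ n) := by fun_prop
  have hint := hcont.integrableOn_Icc (a := 0) (b := t) (μ := volume)
  rw [← ofReal_integral_eq_lintegral_ofReal hint, integral_Icc_eq_integral_Ioc,
    ← intervalIntegral.integral_of_le ht,
    intervalIntegral.integral_eq_sub_of_hasDerivAt
      (f := fun s => -(Real.exp (-s) - Real.exp (-t)) ^ (n + 1))]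
  · simp
  · intro s _
    have h1 : HasDerivAt (fun s : ℝ => Real.exp (-s) - Real.exp (-t)) (Real.exp (-s) * -1) s :=
      ((hasDerivAt_neg s).exp).sub_const _
    refine ((h1.fun_pow (n + 1)).neg).congr_deriv ?_
    have h2 : Real.exp (-s) - Real.exp (-t) = Real.exp (-s) * (1 - Real.exp (-(t - s))) := by
      rw [mul_sub, mul_one, ← Real.exp_add]; congr 2; ring
    have h3 : Real.exp (-((n + 1) * s)) = Real.exp (-s) ^ n * Real.exp (-s) := by
      rw [← pow_succ, ← Real.exp_nat_mul]; congr 1; push_cast; ring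
    rw [h2, h3, Nat.add_sub_cancel, mul_pow]
    push_cast
    ring
  · exact hcont.intervalIntegrable _ _
  · filter_upwards [self_mem_ae_restrict measurableSet_Icc] with s hs
    have : 0 ≤ 1 - Real.exp (-(t - s)) := by
      rw [sub_nonneg, Real.exp_le_one_iff]; linarith [hs.2]
    simp only [Pi.zero_apply]
    positivity

/-- The sum of independent exponential variables of parameters `1, …, n` is distributed as the
maximum of `n` independent standard exponential variables. -/
lemma measure_sum_exponential_le {Ω : Type*} [MeasurableSpace Ω] {P : Measure Ω}
    [IsProbabilityMeasure P] {τ : ℕ → Ω → ℝ}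
    (hτ : ∀ k : ℕ, HasLaw (τ k) (expMeasure ((k : ℝ) + 1)) P) (hi : iIndepFun τ P)
    (n : ℕ) (t : ℝ) :
    P {ω | ∑ k ∈ Finset.range n, τ k ω ≤ t} =
      ENNReal.ofReal (if 0 ≤ t then (1 - Real.exp (-t)) ^ n else 0) := by
  induction n generalizing t with
  | zero =>
    by_cases ht : 0 ≤ t
    · simp [ht]
    · simp [ht]
  | succ n ih =>
    have hm : ∀ k, AEMeasurable (τ k) P := fun k => (hτ k).aemeasurable
    have hsm : AEMeasurable (fun ω => ∑ k ∈ Finset.range n, τ k ω) P :=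
      Finset.aemeasurable_fun_sum _ fun k _ => hm k
    have hind : IndepFun (fun ω => ∑ k ∈ Finset.range n, τ k ω) (τ n) P := by
      have := hi.indepFun_sum_range_succ₀ hm n
      convert this using 1
      ext ω; simp
    have hmap := (indepFun_iff_map_prod_eq_prod_map_map hsm (hm n)).1 hind
    have hset : MeasurableSet {x : ℝ × ℝ | x.1 + x.2 ≤ t} :=
      measurableSet_le (by fun_prop) (by fun_prop)
    have h1 : P {ω | ∑ k ∈ Finset.range (n + 1), τ k ω ≤ t} =
        (P.map (fun ω => (∑ k ∈ Finset.range n, τ k ω, τ n ω))) {x : ℝ × ℝ | x.1 + x.2 ≤ t} := by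
      rw [Measure.map_apply_of_aemeasurable (hsm.prodMk (hm n)) hset]
      simp [Finset.sum_range_succ]
    have hF : Measurable (fun s : ℝ => ENNReal.ofReal
        (if 0 ≤ t - s then (1 - Real.exp (-(t - s))) ^ n else 0)) :=
      (Measurable.ite (measurableSet_le (by fun_prop) (by fun_prop)) (by fun_prop)
        (by fun_prop)).ennreal_ofReal
    have h2 : ∀ s : ℝ, (P.map (fun ω => ∑ k ∈ Finset.range n, τ k ω))
        ((fun x => (x, s)) ⁻¹' {x : ℝ × ℝ | x.1 + x.2 ≤ t}) = ENNReal.ofReal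
          (if 0 ≤ t - s then (1 - Real.exp (-(t - s))) ^ n else 0) := by
      intro s
      rw [Measure.map_apply_of_aemeasurable hsm (by measurability), ← ih]
      congr 1
      ext ω
      simp [le_sub_iff_add_le]
    have := Measure.isProbabilityMeasure_map (μ := P) hsm
    have hexp := isProbabilityMeasure_expMeasure (r := (n : ℝ) + 1) (by positivity)
    rw [h1, hmap, (hτ n).map_eq, Measure.prod_apply_symm hset]
    simp_rw [h2]
    rw [lintegral_expMeasure _ hF]
    by_cases ht : 0 ≤ t
    · rw [if_pos ht, ← lintegral_Icc_exp_convolution n ht, ← lintegral_indicator measurableSet_Ici,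
        ← lintegral_indicator measurableSet_Icc]
      refine lintegral_congr fun s => ?_
      by_cases hs : 0 ≤ s
      · rw [Set.indicator_of_mem (by exact hs)]
        by_cases hst : s ≤ t
        · rw [Set.indicator_of_mem (by exact ⟨hs, hst⟩), if_pos (by linarith),
            ← ENNReal.ofReal_mul (by positivity)]
        · rw [Set.indicator_of_notMem (by simp [hst]), if_neg (by linarith)]
          simp
      · rw [Set.indicator_of_notMem (by exact hs), Set.indicator_of_notMem (by simp [hs])]
    · rw [if_neg ht, ENNReal.ofReal_zero]
      refine setLIntegral_eq_zero measurableSet_Ici fun s hs => ?_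
      have : (0 : ℝ) ≤ s := hs
      rw [if_neg (by linarith)]
      simp

lemma integral_exp_neg_expMeasure {r : ℝ} (hr : 0 < r) :
    ∫ x, Real.exp (-x) ∂(expMeasure r) = r / (r + 1) := by
  rw [integral_eq_lintegral_of_nonneg_ae (Eventually.of_forall fun _ => (Real.exp_pos _).le)
    (by fun_prop), lintegral_expMeasure _ (by fun_prop)]
  have h := isProbabilityMeasure_expMeasure (r := r + 1) (by linarith)
  have h1 := lintegral_expMeasure (r + 1) (f := fun _ => ENNReal.ofReal (r / (r + 1)))
    measurable_const
  rw [lintegral_const, measure_univ, mul_one] at h1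
  rw [← ENNReal.toReal_ofReal (by positivity : 0 ≤ r / (r + 1)), h1]
  congr 1
  refine lintegral_congr fun x => ?_
  rw [← ENNReal.ofReal_mul (by positivity), ← ENNReal.ofReal_mul (by positivity)]
  congr 1
  rw [mul_assoc, ← Real.exp_add, show -(r * x) + -x = -((r + 1) * x) by ring]
  field_simp

/-- Products of independent non-negative variables of mean `1` converge almost surely. -/
lemma ProbabilityTheory.iIndepFun.ae_exists_tendsto_prod {Ω : Type*} [MeasurableSpace Ω]
    {P : Measure Ω} [IsProbabilityMeasure P] {X : ℕ → Ω → ℝ} (hX : iIndepFun X P)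
    (hm : ∀ k, StronglyMeasurable (X k)) (h0 : ∀ k ω, 0 ≤ X k ω) (hint : ∀ k, Integrable (X k) P)
    (h1 : ∀ k, ∫ ω, X k ω ∂P = 1) :
    ∀ᵐ ω ∂P, ∃ c, Tendsto (fun n => ∏ k ∈ Finset.range (n + 1), X k ω) atTop (𝓝 c) := by
  set N : ℕ → Ω → ℝ := fun n => ∏ k ∈ Finset.range (n + 1), X k with hN
  have hNs : ∀ n, N (n + 1) = N n * X (n + 1) := fun n => Finset.prod_range_succ _ _
  have hind : ∀ n, IndepFun (N n) (X (n + 1)) P := fun n =>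
    hX.indepFun_prod_range_succ (fun k => (hm k).measurable) (n + 1)
  have hNi : ∀ n, Integrable (N n) P := by
    intro n
    induction n with
    | zero => simpa [hN] using hint 0
    | succ n ih => rw [hNs]; exact (hind n).integrable_mul ih (hint _)
  have hN1 : ∀ n, ∫ ω, N n ω ∂P = 1 := by
    intro n
    induction n with
    | zero => simpa [hN] using h1 0
    | succ n ih =>
      rw [hNs, (hind n).integral_mul_eq_mul_integral (hNi n).1 (hint _).1, ih, h1, one_mul]
  have hN0 : ∀ n ω, 0 ≤ N n ω := fun n ω => by
    simp only [hN, Finset.prod_apply]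
    exact Finset.prod_nonneg fun k _ => h0 k ω
  have hadp : StronglyAdapted (Filtration.natural X hm) N := by
    intro n
    refine Finset.stronglyMeasurable_prod _ fun k hk => ?_
    exact (Filtration.stronglyAdapted_natural hm k).mono
      ((Filtration.natural X hm).mono (by simpa [Nat.lt_succ_iff] using hk))
  have hmart : Martingale N (Filtration.natural X hm) P := by
    refine martingale_nat hadp hNi fun n => ?_
    have h2 := condExp_mul_of_stronglyMeasurable_left (μ := P) (hadp n) (g := X (n + 1))
      (by rw [← hNs]; exact hNi (n + 1)) (hint _)
    have h3 := hX.condExp_natural_ae_eq_of_lt hm (Nat.lt_succ_self n)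
    rw [hNs]
    filter_upwards [h2, h3] with ω h2 h3
    rw [h2, Pi.mul_apply, Nat.succ_eq_add_one] at *
    rw [h3, h1, mul_one]
  have hb : ∀ n, eLpNorm (N n) 1 P ≤ ((1 : ℝ≥0) : ℝ≥0∞) := by
    intro n
    rw [eLpNorm_one_eq_lintegral_enorm, ← ofReal_integral_norm_eq_lintegral_enorm (hNi n)]
    simp_rw [Real.norm_eq_abs, abs_of_nonneg (hN0 n _)]
    rw [hN1]
    simp
  filter_upwards [hmart.submartingale.exists_ae_tendsto_of_bdd hb] with ω ⟨c, hc⟩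
  refine ⟨c, ?_⟩
  simpa [hN, Finset.prod_apply] using hc

/-! ### The Yule process -/

lemma MeasureTheory.measure_le_of_eventually {Ω : Type*} [MeasurableSpace Ω] {P : Measure Ω}
    {A : Set Ω} {B : ℕ → Set Ω} {c : ℝ≥0∞} (h : ∀ᵐ ω ∂P, ω ∈ A → ∀ᶠ n in atTop, ω ∈ B n)
    (hc : Tendsto (fun n => P (B n)) atTop (𝓝 c)) : P A ≤ c := by
  have h1 : P A ≤ P (⋃ N, ⋂ n ≥ N, B n) := by
    refine measure_mono_ae ?_
    filter_upwards [h] with ω hω hA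
    obtain ⟨N, hN⟩ := eventually_atTop.1 (hω hA)
    exact Set.mem_iUnion.2 ⟨N, Set.mem_iInter₂.2 hN⟩
  refine h1.trans ?_
  rw [Monotone.measure_iUnion]
  · refine iSup_le fun N => ge_of_tendsto hc ?_
    filter_upwards [eventually_ge_atTop N] with n hn
    exact measure_mono (Set.biInter_subset_of_mem hn)
  · intro N M hNM
    exact Set.biInter_subset_biInter_left fun n hn => le_trans hNM hn

section Yule

variable {Ω : Type*} [MeasurableSpace Ω] {P : Measure Ω} [IsProbabilityMeasure P]
  {τ : ℕ → Ω → ℝ}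

lemma ae_exists_tendsto_mul_exp_neg_sum
    (hτ : ∀ k : ℕ, HasLaw (τ k) (expMeasure ((k : ℝ) + 1)) P) (hi : iIndepFun τ P) :
    ∀ᵐ ω ∂P, ∃ c, Tendsto (fun n : ℕ =>
      ((n : ℝ) + 1) * Real.exp (-∑ k ∈ Finset.range n, τ k ω)) atTop (𝓝 c) := by
  have hm : ∀ k, AEMeasurable (τ k) P := fun k => (hτ k).aemeasurable
  let τ' : ℕ → Ω → ℝ := fun k => (hm k).mk
  have hτ' : ∀ k, τ k =ᵐ[P] τ' k := fun k => (hm k).ae_eq_mk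
  have hm' : ∀ k, Measurable (τ' k) := fun k => (hm k).measurable_mk
  have hi' : iIndepFun τ' P := hi.congr hτ'
  let X : ℕ → Ω → ℝ := fun k ω => ((k : ℝ) + 2) / (k + 1) * Real.exp (-τ' k ω)
  have hX : iIndepFun X P := hi'.comp (fun k x => ((k : ℝ) + 2) / (k + 1) * Real.exp (-x))
    fun k => by fun_prop
  have hlaw : ∀ k : ℕ, HasLaw (τ' k) (expMeasure ((k : ℝ) + 1)) P :=
    fun k => (hτ k).congr (hτ' k).symm
  have hprod : ∀ (n : ℕ) ω, ∏ k ∈ Finset.range n, X k ω =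
      ((n : ℝ) + 1) * Real.exp (-∑ k ∈ Finset.range n, τ' k ω) := by
    intro n ω
    induction n with
    | zero => simp
    | succ n ih =>
      rw [Finset.prod_range_succ, ih, Finset.sum_range_succ, neg_add, Real.exp_add]
      simp only [X]
      push_cast
      field_simp
      ring
  have hone : ∀ k, ∫ ω, X k ω ∂P = 1 := by
    intro k
    have h1 := (hlaw k).integral_comp (f := fun x => Real.exp (-x)) (by fun_prop)
    simp only [Function.comp_def] at h1
    simp only [X]
    rw [integral_const_mul, h1, integral_exp_neg_expMeasure (by positivity)]
    field_simp
    ring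
  have hlim := hX.ae_exists_tendsto_prod (fun k => by
      have := hm' k
      exact Measurable.stronglyMeasurable (by fun_prop)) (fun k ω => by simp only [X]; positivity)
    (fun k => by
      by_contra h
      have := integral_undef h
      rw [hone] at this
      exact one_ne_zero this) hone
  filter_upwards [hlim, ae_all_iff.2 hτ'] with ω ⟨c, hc⟩ heq
  refine ⟨c, (tendsto_add_atTop_iff_nat 1).1 ?_⟩
  simp_rw [heq]
  refine hc.congr fun n => ?_
  rw [hprod]

lemma tendsto_sum_of_tendsto_mul_exp_neg {T : ℕ → ℝ} {c : ℝ}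
    (h : Tendsto (fun n : ℕ => ((n : ℝ) + 1) * Real.exp (-T n)) atTop (𝓝 c)) :
    Tendsto T atTop atTop := by
  have h1 : Tendsto (fun n : ℕ => 1 / ((n : ℝ) + 1)) atTop (𝓝 0) :=
    tendsto_one_div_add_atTop_nhds_zero_nat
  have h2 : Tendsto (fun n : ℕ => Real.exp (-T n)) atTop (𝓝 0) := by
    have := h1.mul h
    rw [zero_mul] at this
    refine this.congr fun n => ?_
    field_simp
  have h3 := Real.tendsto_exp_comp_nhds_zero.1 h2
  simpa using tendsto_neg_atBot_iff.1 h3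

lemma measure_mul_exp_neg_sum_tendsto
    (hτ : ∀ k : ℕ, HasLaw (τ k) (expMeasure ((k : ℝ) + 1)) P) (hi : iIndepFun τ P) {x : ℝ}
    (hx : 0 < x) :
    Tendsto (fun n : ℕ => P {ω | x ≤ ((n : ℝ) + 1) * Real.exp (-∑ k ∈ Finset.range n, τ k ω)})
      atTop (𝓝 (ENNReal.ofReal (Real.exp (-x)))) := by
  have h1 : Tendsto (fun n : ℕ => (1 + -x / ((n + 1 : ℕ) : ℝ)) ^ (n + 1) /
      (1 + -x / ((n + 1 : ℕ) : ℝ))) atTop (𝓝 (Real.exp (-x) / (1 + 0))) := by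
    refine ((Real.tendsto_one_add_div_pow_exp (-x)).comp (tendsto_add_atTop_nat 1)).div
      (tendsto_const_nhds.add ?_) (by norm_num)
    exact (tendsto_const_div_atTop_nhds_zero_nat (-x)).comp (tendsto_add_atTop_nat 1)
  rw [add_zero, div_one] at h1
  refine (ENNReal.tendsto_ofReal h1).congr' ?_
  have hlarge : ∀ᶠ n : ℕ in atTop, x < (n : ℝ) :=
    tendsto_natCast_atTop_atTop.eventually_gt_atTop x
  filter_upwards [hlarge] with n hn
  have hn1 : (0 : ℝ) < n + 1 := by positivity
  have hset : {ω | x ≤ ((n : ℝ) + 1) * Real.exp (-∑ k ∈ Finset.range n, τ k ω)} =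
      {ω | ∑ k ∈ Finset.range n, τ k ω ≤ -Real.log (x / (n + 1))} := by
    ext ω
    simp only [Set.mem_ofPred_eq]
    rw [le_neg, Real.log_le_iff_le_exp (by positivity), div_le_iff₀ hn1, mul_comm]
  have hlog : 0 ≤ -Real.log (x / (n + 1)) := by
    rw [neg_nonneg]
    exact Real.log_nonpos (by positivity) ((div_le_one hn1).2 (by linarith))
  rw [hset, measure_sum_exponential_le hτ hi, if_pos hlog, neg_neg, Real.exp_log (by positivity)]
  congr 1
  have hne : 1 + -x / ((n : ℝ) + 1) ≠ 0 := by
    have : x / ((n : ℝ) + 1) < 1 := (div_lt_one hn1).2 (by linarith)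
    rw [neg_div]
    linarith
  push_cast
  rw [pow_succ, mul_div_assoc, div_self hne, mul_one, neg_div, sub_eq_add_neg]

/-- The almost sure limit of `(n + 1) exp (-(τ 0 + ⋯ + τ (n - 1)))` is standard exponential. -/
lemma hasLaw_exp_of_tendsto_mul_exp_neg_sum
    (hτ : ∀ k : ℕ, HasLaw (τ k) (expMeasure ((k : ℝ) + 1)) P) (hi : iIndepFun τ P)
    {E : Ω → ℝ} (hE : Measurable E) (hlim : ∀ᵐ ω ∂P, Tendsto (fun n : ℕ =>
      ((n : ℝ) + 1) * Real.exp (-∑ k ∈ Finset.range n, τ k ω)) atTop (𝓝 (E ω))) :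
    HasLaw E (expMeasure 1) P := by
  have hexp := isProbabilityMeasure_expMeasure (r := 1) one_pos
  have hmE := Measure.isProbabilityMeasure_map (μ := P) hE.aemeasurable
  refine ⟨hE.aemeasurable, Measure.ext_of_Iic _ _ fun x => ?_⟩
  have hgt : ∀ x : ℝ, 0 < x → P {ω | x < E ω} ≤ ENNReal.ofReal (Real.exp (-x)) := by
    intro x hx
    refine measure_le_of_eventually ?_ (measure_mul_exp_neg_sum_tendsto hτ hi hx)
    filter_upwards [hlim] with ω hω hA
    exact (hω.eventually_const_lt hA).mono fun n hn => le_of_lt hn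
  have hlt : ∀ x : ℝ, 0 < x → P {ω | E ω < x} ≤ ENNReal.ofReal (1 - Real.exp (-x)) := by
    intro x hx
    have h1 := measure_mul_exp_neg_sum_tendsto hτ hi hx
    refine measure_le_of_eventually (B := fun n => {ω | x ≤ ((n : ℝ) + 1) *
      Real.exp (-∑ k ∈ Finset.range n, τ k ω)}ᶜ) ?_ ?_
    · filter_upwards [hlim] with ω hω hA
      exact (hω.eventually_lt_const hA).mono fun n hn => not_le.2 hn
    · rw [ENNReal.ofReal_sub _ (Real.exp_pos _).le, ENNReal.ofReal_one]
      refine (ENNReal.Tendsto.sub tendsto_const_nhds h1 (Or.inl ENNReal.one_ne_top)).congr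
        fun n => ?_
      rw [prob_compl_eq_one_sub₀]
      have hm : ∀ k, AEMeasurable (τ k) P := fun k => (hτ k).aemeasurable
      have : AEMeasurable (fun ω => ((n : ℝ) + 1) * Real.exp (-∑ k ∈ Finset.range n, τ k ω)) P := by
        have := Finset.aemeasurable_fun_sum (Finset.range n) fun k _ => hm k
        fun_prop
      exact nullMeasurableSet_le aemeasurable_const this
  have hright : ∀ x : ℝ, 0 ≤ x → P {ω | E ω ≤ x} ≤ ENNReal.ofReal (1 - Real.exp (-x)) := by
    intro x hx
    have hcont : Tendsto (fun y : ℝ => ENNReal.ofReal (1 - Real.exp (-y))) (𝓝[>] x)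
        (𝓝 (ENNReal.ofReal (1 - Real.exp (-x)))) :=
      ((ENNReal.continuous_ofReal.comp (by fun_prop : Continuous fun y : ℝ =>
        1 - Real.exp (-y))).tendsto x).mono_left nhdsWithin_le_nhds
    refine ge_of_tendsto hcont ?_
    filter_upwards [self_mem_nhdsWithin] with y hy
    exact (measure_mono fun ω (hω : E ω ≤ x) => lt_of_le_of_lt hω hy).trans
      (hlt y (lt_of_le_of_lt hx hy))
  rw [Measure.map_apply hE measurableSet_Iic, ← ofReal_cdf, cdf_expMeasure_eq one_pos, one_mul]
  change P {ω | E ω ≤ x} = _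
  split_ifs with hx
  · refine le_antisymm (hright x hx) ?_
    rcases hx.eq_or_lt with rfl | hx
    · simp
    · have h1 : P {ω | E ω ≤ x} = 1 - P {ω | x < E ω} := by
        rw [← prob_compl_eq_one_sub (measurableSet_lt measurable_const hE)]
        congr 1
        ext ω
        simp
      rw [h1, ENNReal.ofReal_sub _ (Real.exp_pos _).le, ENNReal.ofReal_one]
      exact tsub_le_tsub_left (hgt x hx) _
  · rw [ENNReal.ofReal_zero]
    have h0 := hright 0 le_rfl
    rw [neg_zero, Real.exp_zero, sub_self, ENNReal.ofReal_zero] at h0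
    exact measure_mono_null (fun ω (hω : E ω ≤ x) => hω.trans (not_le.1 hx).le)
      (le_antisymm h0 bot_le)

variable {ν : ℝ≥0 → Ω → ℕ}

/-- The deterministic content of the relation between a Yule process and its jump times. -/
lemma tendsto_of_jump_times {T : ℕ → ℝ} {n : ℝ≥0 → ℕ} {c : ℝ} (hT0 : T 0 = 0)
    (hT : Tendsto (fun k : ℕ => ((k : ℝ) + 1) * Real.exp (-T k)) atTop (𝓝 c))
    (hn : ∀ (t : ℝ≥0) (k : ℕ), n t = k + 1 ↔ T k ≤ t ∧ (t : ℝ) < T (k + 1)) :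
    (∀ t, 1 ≤ n t) ∧ Tendsto n atTop atTop ∧
      Tendsto (fun t : ℝ≥0 => Real.exp (-t) * n t) atTop (𝓝 c) := by
  have hTtop := tendsto_sum_of_tendsto_mul_exp_neg hT
  have hex : ∀ t : ℝ≥0, ∃ k, n t = k + 1 := by
    intro t
    have : ∃ k, (t : ℝ) < T (k + 1) :=
      ((hTtop.comp (tendsto_add_atTop_nat 1)).eventually_gt_atTop (t : ℝ)).exists
    classical
    refine ⟨Nat.find this, (hn t _).2 ⟨?_, Nat.find_spec this⟩⟩
    rcases hk : Nat.find this with _ | k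
    · rw [hT0]; exact t.2
    · exact not_lt.1 (Nat.find_min this (by omega : k < Nat.find this))
  choose k hk using hex
  have hk' : ∀ t, T (k t) ≤ t ∧ (t : ℝ) < T (k t + 1) := fun t => (hn t _).1 (hk t)
  have hktop : Tendsto k atTop atTop := by
    refine tendsto_atTop.2 fun N => ?_
    have h1 : ∀ᶠ t : ℝ≥0 in atTop, ∀ j ∈ Finset.range (N + 1), T j ≤ t :=
      (Finset.eventually_all _).2 fun j _ =>
        (NNReal.tendsto_coe_atTop.2 tendsto_id).eventually_ge_atTop (T j)
    filter_upwards [h1] with t ht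
    by_contra hlt
    exact absurd (hk' t).2 (not_lt.2 (ht (k t + 1) (Finset.mem_range.2 (by omega))))
  refine ⟨fun t => by rw [hk]; omega, ?_, ?_⟩
  · exact ((tendsto_add_atTop_nat 1).comp hktop).congr fun t => (hk t).symm
  · have hupper := hT.comp hktop
    have hlower : Tendsto (fun m : ℕ => ((m : ℝ) + 1) / ((m : ℝ) + 2) *
        ((((m + 1 : ℕ) : ℝ) + 1) * Real.exp (-T (m + 1)))) atTop (𝓝 (1 * c)) := by
      refine Tendsto.mul ?_ (hT.comp (tendsto_add_atTop_nat 1))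
      have := (tendsto_natCast_div_add_atTop (1 : ℝ)).comp (tendsto_add_atTop_nat 1)
      refine this.congr fun m => ?_
      simp only [Function.comp_apply]
      push_cast
      ring
    rw [one_mul] at hlower
    refine tendsto_of_tendsto_of_tendsto_of_le_of_le (hlower.comp hktop) hupper
      (fun t => ?_) (fun t => ?_)
    · simp only [Function.comp_apply, hk]
      push_cast
      have : Real.exp (-T (k t + 1)) ≤ Real.exp (-t) :=
        Real.exp_le_exp.2 (neg_le_neg (hk' t).2.le)
      have h2 : ((k t : ℝ) + 1) / (k t + 2) * ((k t + 1 + 1) * Real.exp (-T (k t + 1))) =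
        Real.exp (-T (k t + 1)) * (k t + 1) := by field_simp; ring
      rw [h2]
      gcongr
    · simp only [Function.comp_apply, hk]
      push_cast
      rw [mul_comm]
      have := (hk' t).1
      gcongr

lemma IsYuleProcess.ae_exists_tendsto (hν : IsYuleProcess P ν) :
    ∀ᵐ ω ∂P, (∀ t, 1 ≤ ν t ω) ∧ Tendsto (fun t => ν t ω) atTop atTop ∧
      ∃ c, Tendsto (fun t : ℝ≥0 => Real.exp (-t) * ν t ω) atTop (𝓝 c) := by
  obtain ⟨τ, hτ, hi, hτν⟩ := hν.exists_holding
  filter_upwards [ae_exists_tendsto_mul_exp_neg_sum hτ hi, hτν] with ω ⟨c, hc⟩ h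
  obtain ⟨h1, h2, h3⟩ := tendsto_of_jump_times (by simp) hc h
  exact ⟨h1, h2, c, h3⟩

/-- The population size of a Yule process at time `t` is geometric of parameter `exp (-t)`. -/
lemma IsYuleProcess.measure_eq (hν : IsYuleProcess P ν) (t : ℝ≥0) (n : ℕ) :
    P {ω | ν t ω = n + 1} =
      ENNReal.ofReal (Real.exp (-t) * (1 - Real.exp (-t)) ^ n) := by
  obtain ⟨τ, hτ, hi, hτν⟩ := hν.exists_holding
  have hm : ∀ k, AEMeasurable (τ k) P := fun k => (hτ k).aemeasurable
  have hsm : ∀ n, NullMeasurableSet {ω | ∑ k ∈ Finset.range n, τ k ω ≤ (t : ℝ)} P := fun n =>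
    nullMeasurableSet_le (Finset.aemeasurable_fun_sum _ fun k _ => hm k) aemeasurable_const
  have hpos : ∀ k, ∀ᵐ ω ∂P, 0 ≤ τ k ω := by
    intro k
    have h1 := measure_sum_exponential_le hτ hi
    refine (ae_map_iff (hm k) (measurableSet_Ici (a := (0 : ℝ)))).1 ?_
    rw [(hτ k).map_eq, ae_iff]
    simp only [not_le]
    have : expMeasure ((k : ℝ) + 1) = volume.withDensity (exponentialPDF ((k : ℝ) + 1)) := rfl
    change expMeasure ((k : ℝ) + 1) (Set.Iio 0) = 0
    rw [this, withDensity_apply _ measurableSet_Iio]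
    exact lintegral_exponentialPDF_of_nonpos le_rfl
  have hset : {ω | ν t ω = n + 1} =ᵐ[P] ({ω | ∑ k ∈ Finset.range n, τ k ω ≤ (t : ℝ)} \
      {ω | ∑ k ∈ Finset.range (n + 1), τ k ω ≤ (t : ℝ)} : Set Ω) := by
    filter_upwards [hτν] with ω hω
    refine propext ?_
    change ν t ω = n + 1 ↔ _
    rw [hω t n, ← not_le]
    rfl
  have hsub : {ω | ∑ k ∈ Finset.range (n + 1), τ k ω ≤ (t : ℝ)} ≤ᵐ[P]
      {ω | ∑ k ∈ Finset.range n, τ k ω ≤ (t : ℝ)} := by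
    filter_upwards [hpos n] with ω hω h
    change ∑ k ∈ Finset.range (n + 1), τ k ω ≤ (t : ℝ) at h
    change ∑ k ∈ Finset.range n, τ k ω ≤ (t : ℝ)
    rw [Finset.sum_range_succ] at h
    linarith
  have he : Real.exp (-(t : ℝ)) ≤ 1 := Real.exp_le_one_iff.2 (by simp)
  have he0 : 0 ≤ 1 - Real.exp (-(t : ℝ)) := by linarith
  rw [measure_congr hset, measure_sdiff' _ (hsm _) (measure_ne_top _ _),
    measure_congr (union_ae_eq_left_iff_ae_subset.2 hsub), measure_sum_exponential_le hτ hi,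
    measure_sum_exponential_le hτ hi, if_pos t.coe_nonneg, if_pos t.coe_nonneg, ← ENNReal.ofReal_sub _ (by positivity)]
  congr 1
  ring

/-- The limit of `exp (-t) ν t` is a standard exponential variable, which is a measurable function
of the process. -/
lemma IsYuleProcess.exists_limit (hν : IsYuleProcess P ν) :
    ∃ f : (ℝ≥0 → ℕ) → ℝ, Measurable f ∧ HasLaw (fun ω => f fun t => ν t ω) (expMeasure 1) P ∧
      ∀ᵐ ω ∂P, Tendsto (fun t : ℝ≥0 => Real.exp (-t) * ν t ω) atTop
        (𝓝 (f fun t => ν t ω)) := by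
  let f : (ℝ≥0 → ℕ) → ℝ := fun x =>
    limUnder atTop (fun n : ℕ => Real.exp (-((n : ℝ≥0) : ℝ)) * (x n : ℝ))
  have hf : Measurable f := by
    refine (StronglyMeasurable.limUnder fun n => Measurable.stronglyMeasurable ?_).measurable
    exact (measurable_from_top.comp (measurable_pi_apply (n : ℝ≥0))).const_mul _
  have hfν : ∀ ω c, Tendsto (fun t : ℝ≥0 => Real.exp (-t) * ν t ω) atTop (𝓝 c) →
      f (fun t => ν t ω) = c := fun ω c hc => by
    have hcast : Tendsto (fun n : ℕ => (n : ℝ≥0)) atTop atTop := tendsto_natCast_atTop_atTop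
    have h := Tendsto.comp hc hcast
    exact h.limUnder_eq
  have hνm : Measurable (fun ω t => ν t ω) := measurable_pi_lambda _ hν.measurable
  clear_value f
  have hE : Measurable (fun ω => f fun t => ν t ω) := hf.comp hνm
  refine ⟨f, hf, ?_, ?_⟩
  · obtain ⟨τ, hτ, hi, hτν⟩ := hν.exists_holding
    refine hasLaw_exp_of_tendsto_mul_exp_neg_sum hτ hi hE ?_
    filter_upwards [ae_exists_tendsto_mul_exp_neg_sum hτ hi, hτν] with ω ⟨c, hc⟩ h
    rwa [hfν ω c (tendsto_of_jump_times (by simp) hc h).2.2]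
  · filter_upwards [hν.ae_exists_tendsto] with ω ⟨_, _, c, hc⟩
    rwa [hfν ω c hc]

end Yule

/-! ### One step of the splitting procedure -/

/-- Replace the entry `b i` by the two consecutive entries `z.1 * b i`, `z.2 * b i`. -/
def splitStep (b : ℕ → ℝ) (i : ℕ) (z : ℝ × ℝ) (j : ℕ) : ℝ :=
  if j < i then b j else if j = i then z.1 * b i else if j = i + 1 then z.2 * b i else b (j - 1)

lemma splitWeight_succ_succ {Ω : Type*} (Ls Rs : ℕ → Ω → ℝ) (I : ℕ → Ω → ℕ) (n j : ℕ) (ω : Ω) :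
    splitWeight Ls Rs I (n + 2) j ω = splitStep (fun j => splitWeight Ls Rs I (n + 1) j ω)
      (I (n + 1) ω) (Ls (n + 1) ω, Rs (n + 1) ω) j := rfl

@[to_additive]
lemma prod_Icc_splitStep {M : Type*} [CommMonoid M] (G : ℕ → ℝ → M) (b : ℕ → ℝ) (z : ℝ × ℝ)
    {i n : ℕ} (hi : 1 ≤ i) (hin : i ≤ n) :
    ∏ j ∈ Finset.Icc 1 (n + 1), G j (splitStep b i z j) =
      ∏ j ∈ Finset.Icc 1 n, if j < i then G j (b j)
        else if j = i then G i (z.1 * b i) * G (i + 1) (z.2 * b i) else G (j + 1) (b j) := by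
  induction n, hin using Nat.le_induction with
  | base =>
    obtain ⟨k, rfl⟩ : ∃ k, i = k + 1 := ⟨i - 1, by omega⟩
    rw [Finset.prod_Icc_succ_top (by omega), Finset.prod_Icc_succ_top (by omega),
      Finset.prod_Icc_succ_top (by omega), mul_assoc]
    congr 1
    · refine Finset.prod_congr rfl fun j hj => ?_
      have : j < k + 1 := by have := (Finset.mem_Icc.1 hj).2; omega
      simp [splitStep, this]
    · simp [splitStep]
  | succ m hm ih =>
    rw [Finset.prod_Icc_succ_top (by omega), ih, Finset.prod_Icc_succ_top (by omega)]
    congr 1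
    have h1 : ¬ m + 1 + 1 < i := by omega
    have h2 : ¬ m + 1 + 1 = i := by omega
    have h3 : ¬ m + 1 = i := by omega
    have h4 : ¬ m + 1 < i := by omega
    simp [splitStep, h1, h2, h3, h4]

/-- The sum over a split sequence. -/
lemma sum_Icc_comp_splitStep (f : ℝ → ℝ) (b : ℕ → ℝ) (z : ℝ × ℝ)
    {i n : ℕ} (hi : 1 ≤ i) (hin : i ≤ n) :
    ∑ j ∈ Finset.Icc 1 (n + 1), f (splitStep b i z j) =
      ∑ j ∈ Finset.Icc 1 n, f (b j) + (f (z.1 * b i) + f (z.2 * b i) - f (b i)) := by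
  have hmem : i ∈ Finset.Icc 1 n := Finset.mem_Icc.2 ⟨hi, hin⟩
  rw [sum_Icc_splitStep (fun _ => f) b z hi hin, ← Finset.add_sum_erase _ _ hmem,
    ← Finset.add_sum_erase _ (fun j => f (b j)) hmem]
  have : ∑ j ∈ (Finset.Icc 1 n).erase i, (if j < i then f (b j)
      else if j = i then f (z.1 * b i) + f (z.2 * b i) else f (b j)) =
      ∑ j ∈ (Finset.Icc 1 n).erase i, f (b j) := by
    refine Finset.sum_congr rfl fun j hj => ?_
    rw [if_neg (Finset.ne_of_mem_erase hj), ite_self]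
  rw [this]
  simp only [lt_self_iff_false, if_false, if_true]
  ring

lemma measurable_splitStep (i j : ℕ) :
    Measurable (fun x : (ℕ → ℝ) × (ℝ × ℝ) => splitStep x.1 i x.2 j) := by
  unfold splitStep
  split_ifs <;> fun_prop

/-! ### Histories -/

/-- The coefficients and the indices used in the splitting procedure. -/
abbrev SplitHistory := (ℕ → ℝ × ℝ) × (ℕ → ℕ)

/-- The first `n` coefficients and indices. -/
def splitHistory {Ω : Type*} (Ls Rs : ℕ → Ω → ℝ) (I : ℕ → Ω → ℕ) (n : ℕ) (ω : Ω) : SplitHistory :=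
  (fun k => if k < n then (Ls (k + 1) ω, Rs (k + 1) ω) else 0,
    fun k => if k < n then I (k + 1) ω else 0)

/-- The weights, as functions of the history. -/
noncomputable def historyWeight (n j : ℕ) (x : SplitHistory) : ℝ :=
  splitWeight (fun k x => (x.1 (k - 1)).1) (fun k x => (x.1 (k - 1)).2)
    (fun k (x : SplitHistory) => x.2 (k - 1)) n j x

lemma splitWeight_eq_historyWeight {Ω : Type*} (Ls Rs : ℕ → Ω → ℝ) (I : ℕ → Ω → ℕ) {n m : ℕ}
    (hnm : n ≤ m) (j : ℕ) (ω : Ω) :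
    splitWeight Ls Rs I (n + 1) j ω = historyWeight (n + 1) j (splitHistory Ls Rs I m ω) := by
  induction n generalizing j with
  | zero => rfl
  | succ n ih =>
    have hn : n < m := hnm
    have ih' := fun j => ih (by omega) j
    unfold historyWeight at *
    rw [splitWeight_succ_succ, splitWeight_succ_succ]
    simp only [ih']
    simp [splitHistory, hn]

lemma measurable_splitWeight {Ω : Type*} [MeasurableSpace Ω] {Ls Rs : ℕ → Ω → ℝ} {I : ℕ → Ω → ℕ}
    (hL : ∀ n, 1 ≤ n → Measurable (Ls n)) (hR : ∀ n, 1 ≤ n → Measurable (Rs n))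
    (hI : ∀ n, 1 ≤ n → Measurable (I n)) (n j : ℕ) : Measurable (splitWeight Ls Rs I n j) := by
  rcases n with _ | n
  · exact measurable_const
  induction n generalizing j with
  | zero => exact measurable_const
  | succ n ih =>
    have h1 : Measurable (fun x : ((ℕ → ℝ) × (ℝ × ℝ)) × ℕ => splitStep x.1.1 x.2 x.1.2 j) :=
      measurable_from_prod_countable_left fun i => measurable_splitStep i j
    exact h1.comp (((measurable_pi_lambda _ ih).prodMk ((hL (n + 1) (by omega)).prodMk
      (hR (n + 1) (by omega)))).prodMk (hI (n + 1) (by omega)))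

lemma measurable_historyWeight (n j : ℕ) : Measurable (historyWeight n j) :=
  measurable_splitWeight (fun _ _ => by fun_prop) (fun _ _ => by fun_prop) (fun _ _ => by fun_prop)
    n j

lemma ProbabilityTheory.iIndepFun.indepFun_truncate {Ω E : Type*} [MeasurableSpace Ω]
    [MeasurableSpace E] {P : Measure Ω} {f : ℕ → Ω → E} (hf : iIndepFun f P)
    (hm : ∀ k, Measurable (f k)) (c : E) (n : ℕ) :
    IndepFun (fun ω k => if k < n then f k ω else c) (f n) P := by
  have h := hf.indepFun_finset (Finset.range n) {n} (by simp) hm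
  let φ : (Finset.range n → E) → ℕ → E :=
    fun x k => if hk : k < n then x ⟨k, Finset.mem_range.2 hk⟩ else c
  have hφ : Measurable φ := by
    refine measurable_pi_lambda _ fun k => ?_
    by_cases hk : k < n
    · simp only [φ, hk, dif_pos]; fun_prop
    · simp only [φ, hk, dif_neg, not_false_eq_true]; fun_prop
  have h2 := h.comp hφ (measurable_pi_apply (⟨n, by simp⟩ : ({n} : Finset ℕ)))
  have h3 : (fun ω k => if k < n then f k ω else c) =
      φ ∘ fun a (i : Finset.range n) => f i a := by
    ext ω k
    by_cases hk : k < n <;> simp [φ, hk]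
  rw [h3]
  exact h2

namespace IsCollisionSequence

variable {Ω : Type*} [MeasurableSpace Ω] {P : Measure Ω}
  {L R : Ω → ℝ} {Ls Rs : ℕ → Ω → ℝ} {I : ℕ → Ω → ℕ}

lemma measurable_coeff (h : IsCollisionSequence P L R Ls Rs I) (k : ℕ) :
    Measurable (fun ω => (Ls (k + 1) ω, Rs (k + 1) ω)) :=
  (h.measurable_left _ (by omega)).prodMk (h.measurable_right _ (by omega))

lemma measurable_splitHistory (h : IsCollisionSequence P L R Ls Rs I) (n : ℕ) :
    Measurable (splitHistory Ls Rs I n) := by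
  refine Measurable.prodMk (measurable_pi_lambda _ fun k => ?_) (measurable_pi_lambda _ fun k => ?_)
  · split_ifs
    · exact h.measurable_coeff k
    · exact measurable_const
  · split_ifs
    · exact h.measurable_index _ (by omega)
    · exact measurable_const

lemma map_coeff (h : IsCollisionSequence P L R Ls Rs I) (k : ℕ) :
    P.map (fun ω => (Ls (k + 1) ω, Rs (k + 1) ω)) = P.map (fun ω => (L ω, R ω)) :=
  (h.identDistrib _ (by omega)).map_eq

lemma ae_coeff_nonneg (h : IsCollisionSequence P L R Ls Rs I) (hLm : Measurable L)
    (hRm : Measurable R) (hL : 0 ≤ᵐ[P] L) (hR : 0 ≤ᵐ[P] R) :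
    ∀ᵐ ω ∂P, ∀ n, 1 ≤ n → 0 ≤ Ls n ω ∧ 0 ≤ Rs n ω := by
  refine ae_all_iff.2 fun n => ?_
  by_cases hn : 1 ≤ n
  · have hset : MeasurableSet {z : ℝ × ℝ | 0 ≤ z.1 ∧ 0 ≤ z.2} :=
      (measurableSet_le measurable_const measurable_fst).inter
        (measurableSet_le measurable_const measurable_snd)
    have h1 : ∀ᵐ z ∂(P.map fun ω => (L ω, R ω)), 0 ≤ z.1 ∧ 0 ≤ z.2 :=
      (ae_map_iff (hLm.prodMk hRm).aemeasurable hset).2 (hL.and hR)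
    rw [← (h.identDistrib n hn).map_eq] at h1
    filter_upwards [(ae_map_iff (h.identDistrib n hn).aemeasurable_fst hset).1 h1] with ω hω _
    exact hω
  · exact Eventually.of_forall fun ω h' => absurd h' hn

lemma ae_splitWeight_nonneg (h : IsCollisionSequence P L R Ls Rs I) (hLm : Measurable L)
    (hRm : Measurable R) (hL : 0 ≤ᵐ[P] L) (hR : 0 ≤ᵐ[P] R) :
    ∀ᵐ ω ∂P, ∀ n j, 0 ≤ splitWeight Ls Rs I n j ω := by
  filter_upwards [h.ae_coeff_nonneg hLm hRm hL hR] with ω hω n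
  rcases n with _ | n
  · exact fun j => le_rfl
  induction n with
  | zero => intro j; simp only [splitWeight]; split_ifs <;> norm_num
  | succ n ih =>
    intro j
    obtain ⟨h1, h2⟩ := hω (n + 1) (by omega)
    rw [splitWeight_succ_succ]
    unfold splitStep
    split_ifs
    · exact ih _
    · exact mul_nonneg h1 (ih _)
    · exact mul_nonneg h2 (ih _)
    · exact ih _

variable [IsProbabilityMeasure P]

lemma ae_index_mem (h : IsCollisionSequence P L R Ls Rs I) {n : ℕ} (hn : 1 ≤ n) :
    ∀ᵐ ω ∂P, I n ω ∈ Finset.Icc 1 n := by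
  have hm := h.measurable_index n hn
  have hset : {ω | I n ω ∈ Finset.Icc 1 n} = ⋃ j ∈ Finset.Icc 1 n, {ω | I n ω = j} := by
    ext ω; simp
  have hmeas : ∀ j, MeasurableSet {ω | I n ω = j} := fun j => hm (measurableSet_singleton j)
  have h1 : P {ω | I n ω ∈ Finset.Icc 1 n} = 1 := by
    rw [hset, measure_biUnion_finset (fun i _ j _ hij => Set.disjoint_left.2 fun ω hi hj =>
      hij (hi.symm.trans hj)) (fun j _ => hmeas j), Finset.sum_congr rfl (h.index_uniform n hn)]
    simp only [Finset.sum_const, Nat.card_Icc, Nat.add_sub_cancel, nsmul_eq_mul]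
    exact ENNReal.mul_inv_cancel (by exact_mod_cast (by omega : n ≠ 0)) (by simp)
  exact (prob_compl_eq_zero_iff (hm (Finset.Icc 1 n).measurableSet)).2 h1

lemma lintegral_index (h : IsCollisionSequence P L R Ls Rs I) {n : ℕ} (hn : 1 ≤ n)
    (f : ℕ → ℝ≥0∞) :
    ∫⁻ i, f i ∂(P.map (I n)) = (n : ℝ≥0∞)⁻¹ * ∑ i ∈ Finset.Icc 1 n, f i := by
  have hm := h.measurable_index n hn
  rw [lintegral_countable', tsum_eq_sum (s := Finset.Icc 1 n), Finset.mul_sum]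
  · refine Finset.sum_congr rfl fun i hi => ?_
    rw [Measure.map_apply hm (measurableSet_singleton i), mul_comm]
    congr 1
    exact h.index_uniform n hn i hi
  · intro i hi
    rw [Measure.map_apply hm (measurableSet_singleton i)]
    have : P (I n ⁻¹' {i}) = 0 := by
      refine measure_mono_null ?_ (h.ae_index_mem hn)
      intro ω hω
      change ¬ I n ω ∈ Finset.Icc 1 n
      rwa [show I n ω = i from hω]
    rw [this, mul_zero]

/-- The history, the next index and the next coefficients are independent. -/
lemma lintegral_history_succ (h : IsCollisionSequence P L R Ls Rs I) (n : ℕ)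
    {Φ : SplitHistory → ℕ → ℝ × ℝ → ℝ≥0∞}
    (hΦ : ∀ i, Measurable (fun x : SplitHistory × (ℝ × ℝ) => Φ x.1 i x.2)) :
    ∫⁻ ω, Φ (splitHistory Ls Rs I n ω) (I (n + 1) ω) (Ls (n + 1) ω, Rs (n + 1) ω) ∂P =
      ∫⁻ ω, ((n + 1 : ℕ) : ℝ≥0∞)⁻¹ * ∑ i ∈ Finset.Icc 1 (n + 1),
        ∫⁻ z, Φ (splitHistory Ls Rs I n ω) i z ∂(P.map fun ω => (L ω, R ω)) ∂P := by
  set a : Ω → ℕ → ℝ × ℝ := fun ω k => if k < n then (Ls (k + 1) ω, Rs (k + 1) ω) else 0 with ha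
  set c : Ω → ℕ → ℕ := fun ω k => if k < n then I (k + 1) ω else 0 with hc
  set b : Ω → ℝ × ℝ := fun ω => (Ls (n + 1) ω, Rs (n + 1) ω) with hb
  have hIm : ∀ k, Measurable (I (k + 1)) := fun k => h.measurable_index _ (by omega)
  have ham : Measurable a := measurable_fst.comp (h.measurable_splitHistory n)
  have hcm : Measurable c := measurable_snd.comp (h.measurable_splitHistory n)
  have hbm : Measurable b := h.measurable_coeff n
  have hab : IndepFun a b P := h.indep_coeff.indepFun_truncate h.measurable_coeff 0 n
  have hcd : IndepFun c (I (n + 1)) P := h.indep_index.indepFun_truncate hIm 0 n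
  have htr : ∀ {E : Type} [MeasurableSpace E] (e : E),
      Measurable (fun (x : ℕ → E) (k : ℕ) => if k < n then x k else e) := fun e =>
    measurable_pi_lambda _ fun k => by split_ifs <;> fun_prop
  have hpair : IndepFun (fun ω => (a ω, b ω)) (fun ω => (c ω, I (n + 1) ω)) P :=
    h.indep_coeff_index.comp
      (φ := fun x : ℕ → ℝ × ℝ => ((fun k => if k < n then x k else 0 : ℕ → ℝ × ℝ), x n))
      (ψ := fun x : ℕ → ℕ => ((fun k => if k < n then x k else 0 : ℕ → ℕ), x n))
      ((htr 0).prodMk (measurable_pi_apply n)) ((htr 0).prodMk (measurable_pi_apply n))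
  have hac : IndepFun a c P := hpair.comp measurable_fst measurable_fst
  have hmap : P.map (fun ω => ((a ω, b ω), (c ω, I (n + 1) ω))) =
      ((P.map a).prod (P.map b)).prod ((P.map c).prod (P.map (I (n + 1)))) := by
    rw [(indepFun_iff_map_prod_eq_prod_map_map (ham.prodMk hbm).aemeasurable
      (hcm.prodMk (hIm n)).aemeasurable).1 hpair,
      (indepFun_iff_map_prod_eq_prod_map_map ham.aemeasurable hbm.aemeasurable).1 hab,
      (indepFun_iff_map_prod_eq_prod_map_map hcm.aemeasurable (hIm n).aemeasurable).1 hcd]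
  have hmap2 : P.map (fun ω => (a ω, c ω)) = (P.map a).prod (P.map c) :=
    (indepFun_iff_map_prod_eq_prod_map_map ham.aemeasurable hcm.aemeasurable).1 hac
  have hb' : P.map b = P.map (fun ω => (L ω, R ω)) := h.map_coeff n
  have pa := Measure.isProbabilityMeasure_map (μ := P) ham.aemeasurable
  have pb := Measure.isProbabilityMeasure_map (μ := P) hbm.aemeasurable
  have pc := Measure.isProbabilityMeasure_map (μ := P) hcm.aemeasurable
  have pd := Measure.isProbabilityMeasure_map (μ := P) (hIm n).aemeasurable
  have hΦ' : Measurable (fun x : (SplitHistory × (ℝ × ℝ)) × ℕ => Φ x.1.1 x.2 x.1.2) :=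
    measurable_from_prod_countable_left hΦ
  have hΨ : Measurable (fun x : ((ℕ → ℝ × ℝ) × (ℝ × ℝ)) × ((ℕ → ℕ) × ℕ) =>
      Φ (x.1.1, x.2.1) x.2.2 x.1.2) := hΦ'.comp (by fun_prop :
        Measurable fun x : ((ℕ → ℝ × ℝ) × (ℝ × ℝ)) × ((ℕ → ℕ) × ℕ) =>
          (((x.1.1, x.2.1), x.1.2), x.2.2))
  have hG : Measurable (fun x : SplitHistory => ∫⁻ i, ∫⁻ z, Φ x i z ∂(P.map b)
      ∂(P.map (I (n + 1)))) := by
    refine Measurable.lintegral_prod_right' (f := fun y : SplitHistory × ℕ =>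
      ∫⁻ z, Φ y.1 y.2 z ∂(P.map b)) ?_
    exact Measurable.lintegral_prod_right' (f := fun y : (SplitHistory × ℕ) × (ℝ × ℝ) =>
      Φ y.1.1 y.1.2 y.2) (hΦ'.comp (by fun_prop : Measurable
        fun y : (SplitHistory × ℕ) × (ℝ × ℝ) => ((y.1.1, y.2), y.1.2)))
  calc ∫⁻ ω, Φ (splitHistory Ls Rs I n ω) (I (n + 1) ω) (Ls (n + 1) ω, Rs (n + 1) ω) ∂P
      = ∫⁻ x, Φ (x.1.1, x.2.1) x.2.2 x.1.2
          ∂(P.map (fun ω => ((a ω, b ω), (c ω, I (n + 1) ω)))) := by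
        rw [lintegral_map hΨ ((ham.prodMk hbm).prodMk (hcm.prodMk (hIm n)))]
        rfl
    _ = ∫⁻ x, ∫⁻ z, ∫⁻ y, Φ (x, y.1) y.2 z ∂((P.map c).prod (P.map (I (n + 1)))) ∂(P.map b)
          ∂(P.map a) := by
        rw [hmap, lintegral_prod _ hΨ.aemeasurable, lintegral_prod]
        exact (Measurable.lintegral_prod_right' hΨ).aemeasurable
    _ = ∫⁻ x, ∫⁻ y, ∫⁻ z, Φ (x, y.1) y.2 z ∂(P.map b) ∂((P.map c).prod (P.map (I (n + 1))))
          ∂(P.map a) := by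
        refine lintegral_congr fun x => ?_
        refine lintegral_lintegral_swap (Measurable.aemeasurable ?_)
        exact hΨ.comp (by fun_prop : Measurable
          fun y : (ℝ × ℝ) × ((ℕ → ℕ) × ℕ) => ((x, y.1), y.2))
    _ = ∫⁻ x, ∫⁻ y, ∫⁻ i, ∫⁻ z, Φ (x, y) i z ∂(P.map b) ∂(P.map (I (n + 1))) ∂(P.map c)
          ∂(P.map a) := by
        refine lintegral_congr fun x => ?_
        refine lintegral_prod _ (Measurable.aemeasurable ?_)
        exact Measurable.lintegral_prod_right' (f := fun y : ((ℕ → ℕ) × ℕ) × (ℝ × ℝ) =>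
          Φ (x, y.1.1) y.1.2 y.2) (hΨ.comp (by fun_prop : Measurable
          fun y : ((ℕ → ℕ) × ℕ) × (ℝ × ℝ) => ((x, y.2), y.1)))
    _ = ∫⁻ ω, ∫⁻ i, ∫⁻ z, Φ (splitHistory Ls Rs I n ω) i z ∂(P.map b) ∂(P.map (I (n + 1))) ∂P := by
        rw [← lintegral_map hG (h.measurable_splitHistory n)]
        change _ = ∫⁻ x, _ ∂(P.map (fun ω => (a ω, c ω)))
        rw [hmap2, lintegral_prod _ hG.aemeasurable]
    _ = _ := by
        refine lintegral_congr fun ω => ?_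
        rw [h.lintegral_index (by omega), hb']

/-- The transition from generation `n + 1` to generation `n + 2`, jointly with the history. -/
lemma lintegral_splitWeight_succ (h : IsCollisionSequence P L R Ls Rs I) (n : ℕ)
    {F : SplitHistory → (ℕ → ℝ) → ℝ≥0∞}
    (hF : Measurable (fun x : SplitHistory × (ℕ → ℝ) => F x.1 x.2)) :
    ∫⁻ ω, F (splitHistory Ls Rs I n ω) (fun j => splitWeight Ls Rs I (n + 2) j ω) ∂P =
      ∫⁻ ω, ((n + 1 : ℕ) : ℝ≥0∞)⁻¹ * ∑ i ∈ Finset.Icc 1 (n + 1),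
        ∫⁻ z, F (splitHistory Ls Rs I n ω)
          (splitStep (fun j => splitWeight Ls Rs I (n + 1) j ω) i z)
          ∂(P.map fun ω => (L ω, R ω)) ∂P := by
  have := h.lintegral_history_succ n
    (Φ := fun x i z => F x (splitStep (fun j => historyWeight (n + 1) j x) i z)) (fun i => by
      refine hF.comp (measurable_fst.prodMk (measurable_pi_lambda _ fun j => ?_))
      exact (measurable_splitStep i j).comp ((measurable_pi_lambda _ fun j =>
        (measurable_historyWeight (n + 1) j).comp measurable_fst).prodMk measurable_snd))
  simp_rw [← splitWeight_eq_historyWeight Ls Rs I le_rfl] at this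
  exact this

end IsCollisionSequence

lemma ENNReal.inv_natCast_mul_sum_ofReal {n : ℕ} (hn : 1 ≤ n) {g : ℕ → ℝ}
    (hg : ∀ i ∈ Finset.Icc 1 n, 0 ≤ g i) :
    (n : ℝ≥0∞)⁻¹ * ∑ i ∈ Finset.Icc 1 n, ENNReal.ofReal (g i) =
      ENNReal.ofReal ((∑ i ∈ Finset.Icc 1 n, g i) / n) := by
  have hn' : (0 : ℝ) < n := by exact_mod_cast hn
  rw [← ENNReal.ofReal_sum_of_nonneg hg, ENNReal.ofReal_div_of_pos hn', ENNReal.ofReal_natCast,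
    ENNReal.div_eq_inv_mul]

lemma ae_map_nonneg {Ω : Type*} [MeasurableSpace Ω] {P : Measure Ω} {L R : Ω → ℝ}
    (hLm : Measurable L) (hRm : Measurable R) (hL : 0 ≤ᵐ[P] L) (hR : 0 ≤ᵐ[P] R) :
    ∀ᵐ z ∂(P.map fun ω => (L ω, R ω)), 0 ≤ z.1 ∧ 0 ≤ z.2 :=
  (ae_map_iff (hLm.prodMk hRm).aemeasurable ((measurableSet_le measurable_const measurable_fst).inter
    (measurableSet_le measurable_const measurable_snd))).2 (hL.and hR)

section Step

variable {κ : Measure (ℝ × ℝ)} {α p S S' : ℝ}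

lemma lintegral_splitStep_rpow_sum [IsProbabilityMeasure κ] (hκ : ∀ᵐ z ∂κ, 0 ≤ z.1 ∧ 0 ≤ z.2)
    (hS : -1 < S)
    (hmom : ∫⁻ z, ENNReal.ofReal (z.1 ^ α + z.2 ^ α) ∂κ = ENNReal.ofReal (S + 1))
    {b : ℕ → ℝ} (hb : ∀ j, 0 ≤ b j) {i n : ℕ} (hi : 1 ≤ i) (hin : i ≤ n) :
    ∫⁻ z, ENNReal.ofReal (∑ j ∈ Finset.Icc 1 (n + 1), splitStep b i z j ^ α) ∂κ =
      ENNReal.ofReal (∑ j ∈ Finset.Icc 1 n, b j ^ α + S * b i ^ α) := by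
  have hle : b i ^ α ≤ ∑ j ∈ Finset.Icc 1 n, b j ^ α :=
    Finset.single_le_sum (f := fun j => b j ^ α) (fun j _ => Real.rpow_nonneg (hb j) _)
      (Finset.mem_Icc.2 ⟨hi, hin⟩)
  have hbi : 0 ≤ b i ^ α := Real.rpow_nonneg (hb i) _
  calc ∫⁻ z, ENNReal.ofReal (∑ j ∈ Finset.Icc 1 (n + 1), splitStep b i z j ^ α) ∂κ
      = ∫⁻ z, (ENNReal.ofReal (∑ j ∈ Finset.Icc 1 n, b j ^ α - b i ^ α) +
          ENNReal.ofReal (b i ^ α) * ENNReal.ofReal (z.1 ^ α + z.2 ^ α)) ∂κ := by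
        refine lintegral_congr_ae ?_
        filter_upwards [hκ] with z hz
        have h1 := Real.rpow_nonneg hz.1 α
        have h2 := Real.rpow_nonneg hz.2 α
        rw [sum_Icc_comp_splitStep (fun x => x ^ α) b z hi hin, Real.mul_rpow hz.1 (hb i),
          Real.mul_rpow hz.2 (hb i), ← ENNReal.ofReal_mul hbi,
          ← ENNReal.ofReal_add (by linarith) (by positivity)]
        congr 1
        ring
    _ = _ := by
        rw [lintegral_add_left measurable_const, lintegral_const, measure_univ, mul_one,
          lintegral_const_mul _ (by fun_prop), hmom, ← ENNReal.ofReal_mul hbi,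
          ← ENNReal.ofReal_add (by linarith) (mul_nonneg hbi (by linarith))]
        congr 1
        ring

lemma integrable_rpow_add_rpow (hκ : ∀ᵐ z ∂κ, 0 ≤ z.1 ∧ 0 ≤ z.2)
    (hmom : ∫⁻ z, ENNReal.ofReal (z.1 ^ α + z.2 ^ α) ∂κ = ENNReal.ofReal (S + 1)) :
    Integrable (fun z : ℝ × ℝ => z.1 ^ α + z.2 ^ α) κ := by
  refine (lintegral_ofReal_ne_top_iff_integrable (by fun_prop) ?_).1 (by rw [hmom]; simp)
  filter_upwards [hκ] with z hz
  exact add_nonneg (Real.rpow_nonneg hz.1 _) (Real.rpow_nonneg hz.2 _)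

lemma integral_rpow_add_rpow (hκ : ∀ᵐ z ∂κ, 0 ≤ z.1 ∧ 0 ≤ z.2) (hS : -1 < S)
    (hmom : ∫⁻ z, ENNReal.ofReal (z.1 ^ α + z.2 ^ α) ∂κ = ENNReal.ofReal (S + 1)) :
    ∫ z, (z.1 ^ α + z.2 ^ α) ∂κ = S + 1 := by
  rw [integral_eq_lintegral_of_nonneg_ae _ (by fun_prop), hmom, ENNReal.toReal_ofReal (by linarith)]
  filter_upwards [hκ] with z hz
  exact add_nonneg (Real.rpow_nonneg hz.1 _) (Real.rpow_nonneg hz.2 _)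

lemma integrable_abs_rpow_add_rpow_sub_one [IsProbabilityMeasure κ]
    (hκ : ∀ᵐ z ∂κ, 0 ≤ z.1 ∧ 0 ≤ z.2) (hp : 1 < p)
    (hmom' : ∫⁻ z, ENNReal.ofReal (z.1 ^ (α * p) + z.2 ^ (α * p)) ∂κ = ENNReal.ofReal (S' + 1)) :
    Integrable (fun z : ℝ × ℝ => |z.1 ^ α + z.2 ^ α - 1| ^ p) κ := by
  have hi := ((integrable_const (1 : ℝ)).add (integrable_rpow_add_rpow hκ hmom')).const_mul
    ((3 : ℝ) ^ p)
  refine hi.mono' (Measurable.aestronglyMeasurable (by fun_prop)) ?_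
  filter_upwards [hκ] with z hz
  have h1 := Real.rpow_nonneg hz.1 α
  have h2 := Real.rpow_nonneg hz.2 α
  set x := z.1 ^ α
  set y := z.2 ^ α
  have hx : z.1 ^ (α * p) = x ^ p := Real.rpow_mul hz.1 _ _
  have hy : z.2 ^ (α * p) = y ^ p := Real.rpow_mul hz.2 _ _
  have h3 : |x + y - 1| ≤ 3 * max 1 (max x y) := by
    have h4 := le_max_left (1 : ℝ) (max x y)
    have h5 := (le_max_left x y).trans (le_max_right (1 : ℝ) (max x y))
    have h6 := (le_max_right x y).trans (le_max_right (1 : ℝ) (max x y))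
    rw [abs_le]; constructor <;> linarith
  have h7 : (max 1 (max x y)) ^ p ≤ 1 + (x ^ p + y ^ p) := by
    have hxp := Real.rpow_nonneg h1 p
    have hyp := Real.rpow_nonneg h2 p
    rcases max_choice 1 (max x y) with h | h
    · rw [h, Real.one_rpow]; linarith
    · rw [h]
      rcases max_choice x y with h' | h' <;> rw [h'] <;> linarith
  rw [Real.norm_eq_abs, abs_of_nonneg (by positivity)]
  calc |x + y - 1| ^ p ≤ (3 * max 1 (max x y)) ^ p :=
        Real.rpow_le_rpow (abs_nonneg _) h3 (by linarith)
    _ = 3 ^ p * (max 1 (max x y)) ^ p := Real.mul_rpow (by norm_num) (by positivity)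
    _ ≤ 3 ^ p * (1 + (x ^ p + y ^ p)) := by gcongr
    _ = _ := by simp only [Pi.add_apply, hx, hy]

lemma exists_lintegral_add_mul_rpow_le [IsProbabilityMeasure κ]
    (hκ : ∀ᵐ z ∂κ, 0 ≤ z.1 ∧ 0 ≤ z.2) (hp : 1 < p) (hS : -1 < S)
    (hmom : ∫⁻ z, ENNReal.ofReal (z.1 ^ α + z.2 ^ α) ∂κ = ENNReal.ofReal (S + 1))
    (hmom' : ∫⁻ z, ENNReal.ofReal (z.1 ^ (α * p) + z.2 ^ (α * p)) ∂κ = ENNReal.ofReal (S' + 1)) :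
    ∃ D K : ℝ, 0 ≤ D ∧ 0 ≤ K ∧ ∀ M b η : ℝ, 0 ≤ b → b ≤ M → 0 < η →
      0 ≤ M ^ p + p * (M ^ (p - 1) * b) * S + D * (η * (M ^ (p - 1) * b) + η ^ (-K) * b ^ p) ∧
      ∫⁻ z, ENNReal.ofReal ((M + b * (z.1 ^ α + z.2 ^ α - 1)) ^ p) ∂κ ≤ ENNReal.ofReal
        (M ^ p + p * (M ^ (p - 1) * b) * S + D * (η * (M ^ (p - 1) * b) + η ^ (-K) * b ^ p)) := by
  obtain ⟨C, K, hC, hK, hineq⟩ := Real.exists_add_mul_rpow_le hp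
  have hi1 := integrable_rpow_add_rpow hκ hmom
  have hi2 := integrable_abs_rpow_add_rpow_sub_one hκ hp hmom'
  have hi1' : Integrable (fun z : ℝ × ℝ => z.1 ^ α + z.2 ^ α - 1) κ := hi1.sub (integrable_const 1)
  set A := ∫ z, |z.1 ^ α + z.2 ^ α - 1| ^ p ∂κ with hA
  have hA0 : 0 ≤ A := integral_nonneg fun z => by positivity
  refine ⟨C * (1 + A), K, by positivity, hK, fun M b η hb hbM hη => ?_⟩
  set e := η * (M ^ (p - 1) * b) + η ^ (-K) * b ^ p with he
  have hint : Integrable (fun z : ℝ × ℝ => M ^ p + p * (M ^ (p - 1) * b) * (z.1 ^ α + z.2 ^ α - 1)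
      + C * (1 + |z.1 ^ α + z.2 ^ α - 1| ^ p) * e) κ :=
    ((integrable_const _).add (hi1'.const_mul _)).add
      ((((integrable_const (1 : ℝ)).add hi2).const_mul C).mul_const e)
  have hval : ∫ z, (M ^ p + p * (M ^ (p - 1) * b) * (z.1 ^ α + z.2 ^ α - 1)
      + C * (1 + |z.1 ^ α + z.2 ^ α - 1| ^ p) * e) ∂κ =
      M ^ p + p * (M ^ (p - 1) * b) * S + C * (1 + A) * e := by
    have j1 : Integrable (fun z : ℝ × ℝ =>
        p * (M ^ (p - 1) * b) * (z.1 ^ α + z.2 ^ α - 1)) κ := hi1'.const_mul _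
    have j2 : Integrable (fun z : ℝ × ℝ =>
        M ^ p + p * (M ^ (p - 1) * b) * (z.1 ^ α + z.2 ^ α - 1)) κ := (integrable_const _).add j1
    have j3 : Integrable (fun z : ℝ × ℝ => C * (1 + |z.1 ^ α + z.2 ^ α - 1| ^ p) * e) κ :=
      (((integrable_const (1 : ℝ)).add hi2).const_mul C).mul_const e
    rw [integral_add j2 j3, integral_add (integrable_const _) j1, integral_const_mul,
      integral_sub hi1 (integrable_const 1), integral_rpow_add_rpow hκ hS hmom,
      integral_mul_const, integral_const_mul, integral_add (integrable_const _) hi2, ← hA]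
    simp
  have hle : ∀ᵐ z ∂κ, (M + b * (z.1 ^ α + z.2 ^ α - 1)) ^ p ≤
      M ^ p + p * (M ^ (p - 1) * b) * (z.1 ^ α + z.2 ^ α - 1)
      + C * (1 + |z.1 ^ α + z.2 ^ α - 1| ^ p) * e ∧
      0 ≤ (M + b * (z.1 ^ α + z.2 ^ α - 1)) ^ p := by
    filter_upwards [hκ] with z hz
    have h1 := Real.rpow_nonneg hz.1 α
    have h2 := Real.rpow_nonneg hz.2 α
    refine ⟨hineq M b _ η hb hbM (by linarith) hη, Real.rpow_nonneg ?_ _⟩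
    nlinarith
  constructor
  · rw [← hval]
    refine integral_nonneg_of_ae ?_
    filter_upwards [hle] with z hz
    exact hz.2.trans hz.1
  · rw [← hval, ofReal_integral_eq_lintegral_ofReal hint]
    · refine lintegral_mono_ae ?_
      filter_upwards [hle] with z hz
      exact ENNReal.ofReal_le_ofReal hz.1
    · filter_upwards [hle] with z hz
      exact hz.2.trans hz.1

end Step

namespace IsCollisionSequence

variable {Ω : Type*} [MeasurableSpace Ω] {P : Measure Ω}
  {L R : Ω → ℝ} {Ls Rs : ℕ → Ω → ℝ} {I : ℕ → Ω → ℕ}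

lemma measurable_weight (h : IsCollisionSequence P L R Ls Rs I) (n j : ℕ) :
    Measurable (splitWeight Ls Rs I n j) :=
  measurable_splitWeight h.measurable_left h.measurable_right h.measurable_index n j

lemma measurable_weightSum (h : IsCollisionSequence P L R Ls Rs I) (s : ℝ) (n : ℕ) :
    Measurable (weightSum (splitWeight Ls Rs I) s n) :=
  Finset.measurable_fun_sum _ fun j _ => (h.measurable_weight n j).pow_const s

lemma ae_weightSum_nonneg (h : IsCollisionSequence P L R Ls Rs I) (hLm : Measurable L)
    (hRm : Measurable R) (hL : 0 ≤ᵐ[P] L) (hR : 0 ≤ᵐ[P] R) (s : ℝ) :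
    ∀ᵐ ω ∂P, ∀ n, 0 ≤ weightSum (splitWeight Ls Rs I) s n ω := by
  filter_upwards [h.ae_splitWeight_nonneg hLm hRm hL hR] with ω hω n
  exact Finset.sum_nonneg fun j _ => Real.rpow_nonneg (hω n j) _

/-- The filtration generated by the coefficients and the indices. -/
def filtration (h : IsCollisionSequence P L R Ls Rs I) : Filtration ℕ ‹MeasurableSpace Ω› where
  seq n := MeasurableSpace.comap (splitHistory Ls Rs I n) inferInstance
  mono' n m hnm := by
    let φ : SplitHistory → SplitHistory := fun x =>
      (fun k => if k < n then x.1 k else 0, fun k => if k < n then x.2 k else 0)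
    have hφ : Measurable φ := by
      refine Measurable.prodMk (measurable_pi_lambda _ fun k => ?_)
        (measurable_pi_lambda _ fun k => ?_)
      · split_ifs <;> fun_prop
      · split_ifs <;> fun_prop
    have : splitHistory Ls Rs I n = φ ∘ splitHistory Ls Rs I m := by
      ext ω k
      · by_cases hk : k < n
        · simp [φ, splitHistory, hk, hk.trans_le hnm]
        · simp [φ, splitHistory, hk]
      · by_cases hk : k < n
        · simp [φ, splitHistory, hk, hk.trans_le hnm]
        · simp [φ, splitHistory, hk]
      · by_cases hk : k < n
        · simp [φ, splitHistory, hk, hk.trans_le hnm]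
        · simp [φ, splitHistory, hk]
    dsimp only
    rw [this, ← MeasurableSpace.comap_comp]
    exact MeasurableSpace.comap_mono hφ.comap_le
  le' n := (h.measurable_splitHistory n).comap_le

lemma measurable_normalizedLimit (h : IsCollisionSequence P L R Ls Rs I) (α S : ℝ) :
    Measurable (normalizedLimit (splitWeight Ls Rs I) α S) :=
  (StronglyMeasurable.limUnder fun n =>
    ((h.measurable_weightSum α n).div_const _).stronglyMeasurable).measurable

variable [IsProbabilityMeasure P] {s S : ℝ}

lemma setLIntegral_weightSum_succ (h : IsCollisionSequence P L R Ls Rs I) (hLm : Measurable L)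
    (hRm : Measurable R) (hL : 0 ≤ᵐ[P] L) (hR : 0 ≤ᵐ[P] R) (hS : -1 < S)
    (hmom : ∫⁻ z, ENNReal.ofReal (z.1 ^ s + z.2 ^ s) ∂(P.map fun ω => (L ω, R ω)) =
      ENNReal.ofReal (S + 1)) (n : ℕ) {B : Set SplitHistory} (hB : MeasurableSet B) :
    ∫⁻ ω in splitHistory Ls Rs I n ⁻¹' B,
        ENNReal.ofReal (weightSum (splitWeight Ls Rs I) s (n + 2) ω) ∂P =
      ENNReal.ofReal (1 + S / (n + 1 : ℕ)) * ∫⁻ ω in splitHistory Ls Rs I n ⁻¹' B,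
        ENNReal.ofReal (weightSum (splitWeight Ls Rs I) s (n + 1) ω) ∂P := by
  have hA : MeasurableSet (splitHistory Ls Rs I n ⁻¹' B) := h.measurable_splitHistory n hB
  have hκ := ae_map_nonneg hLm hRm hL hR
  have := Measure.isProbabilityMeasure_map (μ := P) (hLm.prodMk hRm).aemeasurable
  have hstep := h.lintegral_splitWeight_succ n (F := fun x v => B.indicator
    (fun _ => ENNReal.ofReal (∑ j ∈ Finset.Icc 1 (n + 2), v j ^ s)) x) (by
      have : Measurable fun x : SplitHistory × (ℕ → ℝ) =>
          ENNReal.ofReal (∑ j ∈ Finset.Icc 1 (n + 2), x.2 j ^ s) := by fun_prop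
      exact this.indicator (measurable_fst hB))
  rw [← lintegral_indicator hA, ← lintegral_indicator hA,
    ← lintegral_const_mul _ ((h.measurable_weightSum s (n + 1)).ennreal_ofReal.indicator hA)]
  refine Eq.trans ?_ (hstep.trans ?_)
  · rfl
  · refine lintegral_congr_ae ?_
    filter_upwards [h.ae_splitWeight_nonneg hLm hRm hL hR] with ω hω
    by_cases hωB : splitHistory Ls Rs I n ω ∈ B
    · have hn : (0 : ℝ) < (n + 1 : ℕ) := by positivity
      have hn1 : (1 : ℝ) ≤ (n + 1 : ℕ) := by push_cast; linarith [n.cast_nonneg (α := ℝ)]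
      have hSn : 0 ≤ 1 + S / (n + 1 : ℕ) := by
        have : -1 ≤ S / (n + 1 : ℕ) := by rw [le_div_iff₀ hn]; linarith
        linarith
      simp only [Set.indicator_of_mem hωB]
      rw [Set.indicator_of_mem (show ω ∈ splitHistory Ls Rs I n ⁻¹' B from hωB),
        ← ENNReal.ofReal_mul hSn]
      have hbs : ∀ j, 0 ≤ splitWeight Ls Rs I (n + 1) j ω ^ s := fun j =>
        Real.rpow_nonneg (hω _ _) _
      have hsum : ∀ i ∈ Finset.Icc 1 (n + 1), splitWeight Ls Rs I (n + 1) i ω ^ s ≤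
          ∑ j ∈ Finset.Icc 1 (n + 1), splitWeight Ls Rs I (n + 1) j ω ^ s := fun i hi =>
        Finset.single_le_sum (f := fun j => splitWeight Ls Rs I (n + 1) j ω ^ s)
          (fun j _ => hbs j) hi
      rw [Finset.sum_congr rfl fun i hi => lintegral_splitStep_rpow_sum hκ hS hmom
        (fun j => hω (n + 1) j) (Finset.mem_Icc.1 hi).1 (Finset.mem_Icc.1 hi).2,
        ENNReal.inv_natCast_mul_sum_ofReal (by omega)]
      · congr 1
        rw [Finset.sum_add_distrib, ← Finset.mul_sum, Finset.sum_const, Nat.card_Icc]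
        unfold weightSum
        rw [Nat.add_sub_cancel, nsmul_eq_mul]
        field_simp
      · intro i hi
        nlinarith [hbs i, hsum i hi]
    · simp only [Set.indicator_of_notMem hωB, lintegral_zero, Finset.sum_const_zero, mul_zero]
      rw [Set.indicator_of_notMem (show ω ∉ splitHistory Ls Rs I n ⁻¹' B from hωB), mul_zero]

lemma lintegral_weightSum (h : IsCollisionSequence P L R Ls Rs I) (hLm : Measurable L)
    (hRm : Measurable R) (hL : 0 ≤ᵐ[P] L) (hR : 0 ≤ᵐ[P] R) (hS : -1 < S)
    (hmom : ∫⁻ z, ENNReal.ofReal (z.1 ^ s + z.2 ^ s) ∂(P.map fun ω => (L ω, R ω)) =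
      ENNReal.ofReal (S + 1)) (n : ℕ) :
    ∫⁻ ω, ENNReal.ofReal (weightSum (splitWeight Ls Rs I) s (n + 1) ω) ∂P =
      ENNReal.ofReal (gammaRatio S (n + 1)) := by
  induction n with
  | zero => simp [weightSum, splitWeight, gammaRatio_one hS]
  | succ n ih =>
    have := h.setLIntegral_weightSum_succ hLm hRm hL hR hS hmom n MeasurableSet.univ
    rw [Set.preimage_univ, Measure.restrict_univ, ih] at this
    rw [this, gammaRatio_succ hS (n := n + 1) (by omega), mul_comm (gammaRatio _ _), ENNReal.ofReal_mul]
    have hn1 : (1 : ℝ) ≤ (n + 1 : ℕ) := by push_cast; linarith [n.cast_nonneg (α := ℝ)]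
    have : -1 ≤ S / (n + 1 : ℕ) := by rw [le_div_iff₀ (by linarith)]; linarith
    linarith

lemma integrable_weightSum (h : IsCollisionSequence P L R Ls Rs I) (hLm : Measurable L)
    (hRm : Measurable R) (hL : 0 ≤ᵐ[P] L) (hR : 0 ≤ᵐ[P] R) (hS : -1 < S)
    (hmom : ∫⁻ z, ENNReal.ofReal (z.1 ^ s + z.2 ^ s) ∂(P.map fun ω => (L ω, R ω)) =
      ENNReal.ofReal (S + 1)) (n : ℕ) :
    Integrable (weightSum (splitWeight Ls Rs I) s (n + 1)) P := by
  refine (lintegral_ofReal_ne_top_iff_integrable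
    (h.measurable_weightSum s (n + 1)).aestronglyMeasurable ?_).1 ?_
  · filter_upwards [h.ae_weightSum_nonneg hLm hRm hL hR s] with ω hω using hω _
  · rw [h.lintegral_weightSum hLm hRm hL hR hS hmom]
    simp

lemma martingale_weightSum (h : IsCollisionSequence P L R Ls Rs I) (hLm : Measurable L)
    (hRm : Measurable R) (hL : 0 ≤ᵐ[P] L) (hR : 0 ≤ᵐ[P] R) (hS : -1 < S)
    (hmom : ∫⁻ z, ENNReal.ofReal (z.1 ^ s + z.2 ^ s) ∂(P.map fun ω => (L ω, R ω)) =
      ENNReal.ofReal (S + 1)) :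
    Martingale (fun n ω => weightSum (splitWeight Ls Rs I) s (n + 1) ω / gammaRatio S (n + 1))
      h.filtration P := by
  refine martingale_of_setIntegral_eq_succ (fun n => ?_)
    (fun n => (h.integrable_weightSum hLm hRm hL hR hS hmom n).div_const _) fun n A hA => ?_
  · refine Measurable.stronglyMeasurable ?_
    have h1 : Measurable[h.filtration n] (splitHistory Ls Rs I n) := comap_measurable _
    have h2 : (fun ω => weightSum (splitWeight Ls Rs I) s (n + 1) ω / gammaRatio S (n + 1)) =
        (fun x : SplitHistory => (∑ j ∈ Finset.Icc 1 (n + 1), historyWeight (n + 1) j x ^ s) /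
          gammaRatio S (n + 1)) ∘ splitHistory Ls Rs I n := by
      ext ω
      simp [weightSum, splitWeight_eq_historyWeight Ls Rs I (le_refl n)]
    rw [h2]
    have h3 := fun j => measurable_historyWeight (n + 1) j
    exact (by fun_prop : Measurable (fun x : SplitHistory =>
      (∑ j ∈ Finset.Icc 1 (n + 1), historyWeight (n + 1) j x ^ s) /
          gammaRatio S (n + 1))).comp h1
  · obtain ⟨B, hB, rfl⟩ := hA
    have hn1 : (1 : ℝ) ≤ (n + 1 : ℕ) := by push_cast; linarith [n.cast_nonneg (α := ℝ)]
    have hSn : 0 < 1 + S / (n + 1 : ℕ) := by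
      have : -1 < S / (n + 1 : ℕ) := by rw [lt_div_iff₀ (by linarith)]; linarith
      linarith
    have hm := gammaRatio_pos hS (n := n + 1) (by omega)
    rw [integral_div, integral_div]
    have hnn : ∀ m, 0 ≤ᵐ[P.restrict (splitHistory Ls Rs I n ⁻¹' B)]
        weightSum (splitWeight Ls Rs I) s m := fun m => by
      refine ae_restrict_of_ae ?_
      filter_upwards [h.ae_weightSum_nonneg hLm hRm hL hR s] with ω hω using hω _
    rw [integral_eq_lintegral_of_nonneg_ae (hnn _)
        (h.measurable_weightSum s _).aestronglyMeasurable,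
      integral_eq_lintegral_of_nonneg_ae (hnn _)
        (h.measurable_weightSum s _).aestronglyMeasurable,
      h.setLIntegral_weightSum_succ hLm hRm hL hR hS hmom n hB, ENNReal.toReal_mul,
      ENNReal.toReal_ofReal hSn.le, gammaRatio_succ hS (n := n + 1) (by omega)]
    have hne : ((n + 1 : ℕ) : ℝ) + S ≠ 0 := by linarith
    field_simp

lemma ae_exists_tendsto_weightSum (h : IsCollisionSequence P L R Ls Rs I) (hLm : Measurable L)
    (hRm : Measurable R) (hL : 0 ≤ᵐ[P] L) (hR : 0 ≤ᵐ[P] R) (hS : -1 < S)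
    (hmom : ∫⁻ z, ENNReal.ofReal (z.1 ^ s + z.2 ^ s) ∂(P.map fun ω => (L ω, R ω)) =
      ENNReal.ofReal (S + 1)) :
    ∀ᵐ ω ∂P, Tendsto (fun n => weightSum (splitWeight Ls Rs I) s n ω / gammaRatio S n) atTop
      (𝓝 (normalizedLimit (splitWeight Ls Rs I) s S ω)) := by
  have hmart := h.martingale_weightSum hLm hRm hL hR hS hmom
  have hb : ∀ n, eLpNorm (fun ω => weightSum (splitWeight Ls Rs I) s (n + 1) ω /
      gammaRatio S (n + 1)) 1 P ≤ ((1 : ℝ≥0) : ℝ≥0∞) := by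
    intro n
    have hm := gammaRatio_pos hS (n := n + 1) (by omega)
    rw [eLpNorm_one_eq_lintegral_enorm]
    have : ∫⁻ ω, ‖weightSum (splitWeight Ls Rs I) s (n + 1) ω / gammaRatio S (n + 1)‖ₑ ∂P =
        ∫⁻ ω, ENNReal.ofReal (weightSum (splitWeight Ls Rs I) s (n + 1) ω) *
          ENNReal.ofReal (gammaRatio S (n + 1))⁻¹ ∂P := by
      refine lintegral_congr_ae ?_
      filter_upwards [h.ae_weightSum_nonneg hLm hRm hL hR s] with ω hω
      rw [Real.enorm_of_nonneg (div_nonneg (hω _) hm.le), div_eq_mul_inv,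
        ENNReal.ofReal_mul (hω _)]
    rw [this, lintegral_mul_const _ (h.measurable_weightSum s _).ennreal_ofReal,
      h.lintegral_weightSum hLm hRm hL hR hS hmom, ← ENNReal.ofReal_mul hm.le,
      mul_inv_cancel₀ hm.ne']
    simp
  filter_upwards [hmart.submartingale.exists_ae_tendsto_of_bdd hb] with ω ⟨c, hc⟩
  exact tendsto_nhds_limUnder ⟨c, (tendsto_add_atTop_iff_nat 1).1 hc⟩

end IsCollisionSequence

/-- Almost sure limits of sequences that are bounded in `L ^ p`, for some `p > 1`. -/
lemma lintegral_limit_of_rpow_bounded {Ω : Type*} [MeasurableSpace Ω] {P : Measure Ω}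
    [IsProbabilityMeasure P] {X : ℕ → Ω → ℝ} {W : Ω → ℝ} {p : ℝ} {C : ℝ≥0}
    (hX : ∀ n, Measurable (X n)) (h0 : ∀ n, 0 ≤ᵐ[P] X n)
    (hlim : ∀ᵐ ω ∂P, Tendsto (fun n => X n ω) atTop (𝓝 (W ω)))
    (h1 : ∀ n, ∫⁻ ω, ENNReal.ofReal (X n ω) ∂P = 1) (hp : 1 < p)
    (hC : ∀ n, ∫⁻ ω, ENNReal.ofReal (X n ω ^ p) ∂P ≤ C) :
    ∫⁻ ω, ENNReal.ofReal (W ω) ∂P = 1 ∧ ∫⁻ ω, ENNReal.ofReal (W ω ^ p) ∂P ≤ C := by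
  have hp0 : 0 < p := by linarith
  constructor
  · refine le_antisymm ?_ ?_
    · calc ∫⁻ ω, ENNReal.ofReal (W ω) ∂P
          = ∫⁻ ω, liminf (fun n => ENNReal.ofReal (X n ω)) atTop ∂P := by
            refine lintegral_congr_ae ?_
            filter_upwards [hlim] with ω hω
            exact (ENNReal.tendsto_ofReal hω).liminf_eq.symm
        _ ≤ liminf (fun n => ∫⁻ ω, ENNReal.ofReal (X n ω) ∂P) atTop :=
            lintegral_liminf_le fun n => (hX n).ennreal_ofReal
        _ = 1 := by simp [h1]
    · have key : ∀ K : ℝ, 0 < K →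
          1 ≤ ∫⁻ ω, ENNReal.ofReal (W ω) ∂P + ENNReal.ofReal (K ^ (-(p - 1))) * C := by
        intro K hK
        have hdct : Tendsto (fun n => ∫⁻ ω, ENNReal.ofReal (min (X n ω) K) ∂P) atTop
            (𝓝 (∫⁻ ω, ENNReal.ofReal (min (W ω) K) ∂P)) := by
          refine tendsto_lintegral_of_dominated_convergence (fun _ => ENNReal.ofReal K)
            (fun n => by have := hX n; fun_prop) (fun n => Eventually.of_forall fun ω =>
              ENNReal.ofReal_le_ofReal (min_le_right _ _)) (by simp) ?_
          filter_upwards [hlim] with ω hω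
          exact ENNReal.tendsto_ofReal (hω.min tendsto_const_nhds)
        have hle : ∀ n, 1 ≤ ∫⁻ ω, ENNReal.ofReal (min (X n ω) K) ∂P +
            ENNReal.ofReal (K ^ (-(p - 1))) * C := by
          intro n
          have hXn := hX n
          rw [← h1 n]
          calc ∫⁻ ω, ENNReal.ofReal (X n ω) ∂P
              ≤ ∫⁻ ω, (ENNReal.ofReal (min (X n ω) K) +
                  ENNReal.ofReal (K ^ (-(p - 1))) * ENNReal.ofReal (X n ω ^ p)) ∂P := by
                refine lintegral_mono_ae ?_
                filter_upwards [h0 n] with ω hω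
                have hω' : 0 ≤ X n ω := hω
                rw [← ENNReal.ofReal_mul (by positivity),
                  ← ENNReal.ofReal_add (by positivity) (by positivity)]
                apply ENNReal.ofReal_le_ofReal
                rcases le_or_gt (X n ω) K with h | h
                · rw [min_eq_left h]
                  have : 0 ≤ K ^ (-(p - 1)) * X n ω ^ p := by positivity
                  linarith
                · rw [min_eq_right h.le]
                  have hx : 0 < X n ω := hK.trans h
                  have h3 : K ^ (p - 1) ≤ X n ω ^ (p - 1) :=
                    Real.rpow_le_rpow hK.le h.le (by linarith)
                  have h4 : X n ω ≤ K ^ (-(p - 1)) * X n ω ^ p := by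
                    rw [Real.rpow_neg hK.le, inv_mul_eq_div, le_div_iff₀ (by positivity)]
                    calc X n ω * K ^ (p - 1) ≤ X n ω * X n ω ^ (p - 1) := by gcongr
                      _ = X n ω ^ p := by rw [Real.rpow_sub_one hx.ne']; field_simp
                  linarith
            _ = ∫⁻ ω, ENNReal.ofReal (min (X n ω) K) ∂P +
                  ENNReal.ofReal (K ^ (-(p - 1))) * ∫⁻ ω, ENNReal.ofReal (X n ω ^ p) ∂P := by
                rw [lintegral_add_left (by fun_prop), lintegral_const_mul _ (by fun_prop)]
            _ ≤ _ := by gcongr; exact hC n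
        refine (ge_of_tendsto' (hdct.add_const _) hle).trans ?_
        gcongr
        exact min_le_left _ _
      have hzero : Tendsto (fun K : ℝ => ENNReal.ofReal (K ^ (-(p - 1))) * C) atTop (𝓝 0) := by
        have := ENNReal.tendsto_ofReal (tendsto_rpow_neg_atTop (by linarith : 0 < p - 1))
        rw [ENNReal.ofReal_zero] at this
        have h2 := ENNReal.Tendsto.mul_const (b := (C : ℝ≥0∞)) this (Or.inr ENNReal.coe_ne_top)
        rwa [zero_mul] at h2
      have hfin := hzero.const_add (∫⁻ ω, ENNReal.ofReal (W ω) ∂P)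
      rw [add_zero] at hfin
      refine ge_of_tendsto hfin ?_
      filter_upwards [eventually_gt_atTop 0] with K hK using key K hK
  · calc ∫⁻ ω, ENNReal.ofReal (W ω ^ p) ∂P
        = ∫⁻ ω, liminf (fun n => ENNReal.ofReal (X n ω ^ p)) atTop ∂P := by
          refine lintegral_congr_ae ?_
          filter_upwards [hlim] with ω hω
          exact (ENNReal.tendsto_ofReal (hω.rpow_const (Or.inr hp0.le))).liminf_eq.symm
      _ ≤ liminf (fun n => ∫⁻ ω, ENNReal.ofReal (X n ω ^ p) ∂P) atTop :=
          lintegral_liminf_le fun n => ((hX n).pow_const p).ennreal_ofReal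
      _ ≤ C := by
          refine liminf_le_of_le (by isBoundedDefault) fun b hb => ?_
          obtain ⟨n, hn⟩ := hb.exists
          exact hn.trans (hC n)

namespace IsCollisionSequence

variable {Ω : Type*} [MeasurableSpace Ω] {P : Measure Ω} [IsProbabilityMeasure P]
  {L R : Ω → ℝ} {Ls Rs : ℕ → Ω → ℝ} {I : ℕ → Ω → ℕ} {α p S S' : ℝ}

lemma exists_lintegral_weightSum_rpow_succ_le (h : IsCollisionSequence P L R Ls Rs I)
    (hLm : Measurable L) (hRm : Measurable R) (hL : 0 ≤ᵐ[P] L) (hR : 0 ≤ᵐ[P] R)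
    (hp : 1 < p) (hS : -1 < S) (hS' : -1 < S')
    (hmom : ∫⁻ z, ENNReal.ofReal (z.1 ^ α + z.2 ^ α) ∂(P.map fun ω => (L ω, R ω)) =
      ENNReal.ofReal (S + 1))
    (hmom' : ∫⁻ z, ENNReal.ofReal (z.1 ^ (α * p) + z.2 ^ (α * p)) ∂(P.map fun ω => (L ω, R ω)) =
      ENNReal.ofReal (S' + 1)) :
    ∃ D K : ℝ, 0 ≤ D ∧ 0 ≤ K ∧ ∀ (n : ℕ) (η : ℝ), 0 < η →
      ∫⁻ ω, ENNReal.ofReal (weightSum (splitWeight Ls Rs I) α (n + 2) ω ^ p) ∂P ≤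
        (∫⁻ ω, ENNReal.ofReal (weightSum (splitWeight Ls Rs I) α (n + 1) ω ^ p) ∂P) *
          ENNReal.ofReal ((1 + S / (n + 1 : ℕ)) ^ p + D * η / (n + 1 : ℕ)) +
        ENNReal.ofReal (D * η ^ (-K) / (n + 1 : ℕ) * gammaRatio S' (n + 1)) := by
  have hκ := ae_map_nonneg hLm hRm hL hR
  have := Measure.isProbabilityMeasure_map (μ := P) (hLm.prodMk hRm).aemeasurable
  obtain ⟨D, K, hD, hK, hstep⟩ := exists_lintegral_add_mul_rpow_le hκ hp hS hmom hmom'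
  refine ⟨D, K, hD, hK, fun n η hη => ?_⟩
  have hn : (0 : ℝ) < (n + 1 : ℕ) := by positivity
  have hn1 : (1 : ℝ) ≤ (n + 1 : ℕ) := by push_cast; linarith [n.cast_nonneg (α := ℝ)]
  have hSn : -1 ≤ S / (n + 1 : ℕ) := by rw [le_div_iff₀ hn]; linarith
  have hSn' : 0 ≤ 1 + S / (n + 1 : ℕ) := by linarith
  have hF := h.lintegral_splitWeight_succ n (F := fun _ v =>
    ENNReal.ofReal ((∑ j ∈ Finset.Icc 1 (n + 2), v j ^ α) ^ p)) (by
      exact ((by fun_prop : Measurable fun x : SplitHistory × (ℕ → ℝ) =>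
        ∑ j ∈ Finset.Icc 1 (n + 2), x.2 j ^ α).pow_const p).ennreal_ofReal)
  change ∫⁻ ω, ENNReal.ofReal ((∑ j ∈ Finset.Icc 1 (n + 2),
    splitWeight Ls Rs I (n + 2) j ω ^ α) ^ p) ∂P ≤ _
  rw [hF]
  have hM1 := (h.measurable_weightSum α (n + 1)).pow_const p
  have hM2 := h.measurable_weightSum (α * p) (n + 1)
  calc _ ≤ ∫⁻ ω, (ENNReal.ofReal (weightSum (splitWeight Ls Rs I) α (n + 1) ω ^ p) *
          ENNReal.ofReal ((1 + S / (n + 1 : ℕ)) ^ p + D * η / (n + 1 : ℕ)) +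
        ENNReal.ofReal (D * η ^ (-K) / (n + 1 : ℕ)) *
          ENNReal.ofReal (weightSum (splitWeight Ls Rs I) (α * p) (n + 1) ω)) ∂P := by
        refine lintegral_mono_ae ?_
        filter_upwards [h.ae_splitWeight_nonneg hLm hRm hL hR] with ω hω
        set b : ℕ → ℝ := fun j => splitWeight Ls Rs I (n + 1) j ω with hb
        set M := weightSum (splitWeight Ls Rs I) α (n + 1) ω with hM
        have hMb : M = ∑ j ∈ Finset.Icc 1 (n + 1), b j ^ α := rfl
        have hb0 : ∀ j, 0 ≤ b j := fun j => hω _ _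
        have hbα : ∀ j, 0 ≤ b j ^ α := fun j => Real.rpow_nonneg (hb0 j) _
        have hM0 : 0 ≤ M := Finset.sum_nonneg fun j _ => hbα j
        have hbM : ∀ i ∈ Finset.Icc 1 (n + 1), b i ^ α ≤ M := fun i hi =>
          Finset.single_le_sum (f := fun j => b j ^ α) (fun j _ => hbα j) hi
        have hle : ∀ i ∈ Finset.Icc 1 (n + 1),
            ∫⁻ z, ENNReal.ofReal ((∑ j ∈ Finset.Icc 1 (n + 2), splitStep b i z j ^ α) ^ p)
              ∂(P.map fun ω => (L ω, R ω)) ≤ ENNReal.ofReal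
            (M ^ p + p * (M ^ (p - 1) * b i ^ α) * S +
              D * (η * (M ^ (p - 1) * b i ^ α) + η ^ (-K) * (b i ^ α) ^ p)) := by
          intro i hi
          refine le_trans (le_of_eq ?_) (hstep M (b i ^ α) η (hbα i) (hbM i hi) hη).2
          refine lintegral_congr_ae ?_
          filter_upwards [hκ] with z hz
          rw [sum_Icc_comp_splitStep (fun x => x ^ α) b z (Finset.mem_Icc.1 hi).1
            (Finset.mem_Icc.1 hi).2, Real.mul_rpow hz.1 (hb0 i), Real.mul_rpow hz.2 (hb0 i), hMb]
          congr 2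
          ring
        refine (mul_le_mul_right (Finset.sum_le_sum hle) _).trans ?_
        rw [ENNReal.inv_natCast_mul_sum_ofReal (by omega) fun i hi =>
          (hstep M (b i ^ α) η (hbα i) (hbM i hi) hη).1]
        have hM2 : 0 ≤ weightSum (splitWeight Ls Rs I) (α * p) (n + 1) ω :=
          Finset.sum_nonneg fun j _ => Real.rpow_nonneg (hω _ _) _
        have hMp : M ^ (p - 1) * M = M ^ p := by
          rw [← Real.rpow_add_one' hM0 (by linarith), sub_add_cancel]
        have hsum : ∑ i ∈ Finset.Icc 1 (n + 1), (M ^ p + p * (M ^ (p - 1) * b i ^ α) * S +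
              D * (η * (M ^ (p - 1) * b i ^ α) + η ^ (-K) * (b i ^ α) ^ p)) =
            (n + 1 : ℕ) * M ^ p + (p * S + D * η) * M ^ p +
              D * η ^ (-K) * weightSum (splitWeight Ls Rs I) (α * p) (n + 1) ω := by
          have e1 : ∀ i, (M ^ p + p * (M ^ (p - 1) * b i ^ α) * S +
              D * (η * (M ^ (p - 1) * b i ^ α) + η ^ (-K) * (b i ^ α) ^ p)) =
              M ^ p + (p * S + D * η) * M ^ (p - 1) * b i ^ α +
                D * η ^ (-K) * b i ^ (α * p) := fun i => by
            rw [Real.rpow_mul (hb0 i)]; ring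
          simp_rw [e1]
          rw [Finset.sum_add_distrib, Finset.sum_add_distrib, Finset.sum_const, Nat.card_Icc,
            ← Finset.mul_sum, ← Finset.mul_sum, ← hMb, mul_assoc (p * S + D * η), hMp,
            Nat.add_sub_cancel, nsmul_eq_mul]
          rfl
        rw [hsum, ← ENNReal.ofReal_mul (by positivity), ← ENNReal.ofReal_mul (by positivity),
          ← ENNReal.ofReal_add (by positivity) (by positivity)]
        apply ENNReal.ofReal_le_ofReal
        have hbern : 1 + p * (S / (n + 1 : ℕ)) ≤ (1 + S / (n + 1 : ℕ)) ^ p :=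
          one_add_mul_self_le_rpow_one_add hSn hp.le
        have hMp0 : 0 ≤ M ^ p := Real.rpow_nonneg hM0 _
        have := mul_le_mul_of_nonneg_left hbern hMp0
        calc _ = M ^ p * (1 + p * (S / (n + 1 : ℕ))) + M ^ p * (D * η / (n + 1 : ℕ)) +
            D * η ^ (-K) / (n + 1 : ℕ) * weightSum (splitWeight Ls Rs I) (α * p) (n + 1) ω := by
              field_simp
              ring
          _ ≤ _ := by linarith
    _ = _ := by
        rw [lintegral_add_left (by fun_prop), lintegral_mul_const _ (by fun_prop),
          lintegral_const_mul _ (by fun_prop), h.lintegral_weightSum hLm hRm hL hR hS' hmom',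
          ← ENNReal.ofReal_mul (by positivity)]

/-- The normalized sums of weights are bounded in `L ^ p`. -/
lemma exists_lintegral_weightSum_rpow_le (h : IsCollisionSequence P L R Ls Rs I)
    (hLm : Measurable L) (hRm : Measurable R) (hL : 0 ≤ᵐ[P] L) (hR : 0 ≤ᵐ[P] R)
    (hp : 1 < p) (hS : -1 < S) (hS' : -1 < S') (hSS : S' < p * S)
    (hmom : ∫⁻ z, ENNReal.ofReal (z.1 ^ α + z.2 ^ α) ∂(P.map fun ω => (L ω, R ω)) =
      ENNReal.ofReal (S + 1))
    (hmom' : ∫⁻ z, ENNReal.ofReal (z.1 ^ (α * p) + z.2 ^ (α * p)) ∂(P.map fun ω => (L ω, R ω)) =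
      ENNReal.ofReal (S' + 1)) :
    ∃ C : ℝ≥0, ∀ n, ∫⁻ ω, ENNReal.ofReal ((weightSum (splitWeight Ls Rs I) α (n + 1) ω /
      gammaRatio S (n + 1)) ^ p) ∂P ≤ C := by
  obtain ⟨D, K, hD, hK, hrec⟩ :=
    h.exists_lintegral_weightSum_rpow_succ_le hLm hRm hL hR hp hS hS' hmom hmom'
  obtain ⟨c, _, hc, _, hbound⟩ := exists_gammaRatio_bounds hS
  obtain ⟨_, C', _, hC', hbound'⟩ := exists_gammaRatio_bounds hS'
  have hmpos : ∀ n : ℕ, 0 < gammaRatio S (n + 1) := fun n => gammaRatio_pos hS (by omega)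
  set a : ℕ → ℝ≥0∞ := fun n => ∫⁻ ω, ENNReal.ofReal ((weightSum (splitWeight Ls Rs I) α (n + 1) ω /
      gammaRatio S (n + 1)) ^ p) ∂P with ha
  have ha' : ∀ n, a n = (∫⁻ ω, ENNReal.ofReal (weightSum (splitWeight Ls Rs I) α (n + 1) ω ^ p) ∂P)
      * ENNReal.ofReal ((gammaRatio S (n + 1) ^ p)⁻¹) := by
    intro n
    have hM1 := (h.measurable_weightSum α (n + 1)).pow_const p
    rw [← lintegral_mul_const _ (by fun_prop)]
    refine lintegral_congr_ae ?_
    filter_upwards [h.ae_weightSum_nonneg hLm hRm hL hR α] with ω hω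
    rw [Real.div_rpow (hω _) (hmpos n).le, div_eq_mul_inv,
      ENNReal.ofReal_mul (Real.rpow_nonneg (hω _) _)]
  set c0 : ℝ := min 1 (1 + S) with hc0
  have hc0pos : 0 < c0 := lt_min one_pos (by linarith)
  have hratio : ∀ n : ℕ, c0 ≤ 1 + S / (n + 1 : ℕ) := by
    intro n
    have hn1 : (1 : ℝ) ≤ (n + 1 : ℕ) := by push_cast; linarith [n.cast_nonneg (α := ℝ)]
    rcases le_total 0 S with h0 | h0
    · exact (min_le_left _ _).trans (by have : 0 ≤ S / (n + 1 : ℕ) := by positivity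
                                        linarith)
    · refine (min_le_right _ _).trans ?_
      have : S ≤ S / (n + 1 : ℕ) := by
        rw [le_div_iff₀ (by linarith)]; nlinarith
      linarith
  set ε : ℝ := (p * S - S') / (2 * (K + 1)) with hε
  have hε0 : 0 < ε := div_pos (by linarith) (by linarith)
  have hεK : ε * K ≤ (p * S - S') / 2 := by
    have : ε * (K + 1) = (p * S - S') / 2 := by rw [hε]; field_simp
    nlinarith
  have hsummable : ∀ r A : ℝ, r < -1 → Summable fun n : ℕ => A * ((n + 1 : ℕ) : ℝ) ^ r :=
    fun r A hr => ((summable_nat_add_iff 1).2 (Real.summable_nat_rpow.2 hr)).mul_left A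
  refine ENNReal.exists_bound_of_le_mul_one_add (a := a)
    (u := fun n => D / c0 ^ p * ((n + 1 : ℕ) : ℝ) ^ (-1 - ε))
    (v := fun n => D * C' / (c0 * c) ^ p * ((n + 1 : ℕ) : ℝ) ^ (ε * K + S' - 1 - p * S)) ?_
    (hsummable _ _ (by linarith)) (hsummable _ _ (by linarith)) (fun n => by positivity)
    (fun n => by positivity) fun n => ?_
  · have h0 : a 0 = ∫⁻ _, 1 ∂P := by
      refine lintegral_congr fun ω => ?_
      simp [weightSum, splitWeight, gammaRatio_one hS]
    rw [h0]; simp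
  · have hn : (0 : ℝ) < (n + 1 : ℕ) := by positivity
    have hm1 := hmpos n
    have hm2 := hmpos (n + 1)
    have hg' := gammaRatio_pos hS' (n := n + 1) (by omega)
    have hr := hratio n
    have hr0 : 0 < 1 + S / (n + 1 : ℕ) := hc0pos.trans_le hr
    have hsucc : gammaRatio S (n + 2) = gammaRatio S (n + 1) * (1 + S / (n + 1 : ℕ)) :=
      gammaRatio_succ hS (by omega)
    have hη : 0 < ((n + 1 : ℕ) : ℝ) ^ (-ε) := by positivity
    have h1 := hrec n _ hη
    rw [ha' (n + 1), ha' n]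
    refine (mul_le_mul_left h1 _).trans ?_
    rw [add_mul, mul_assoc, mul_assoc, ← ENNReal.ofReal_mul
        (add_nonneg (Real.rpow_nonneg hr0.le p) (by positivity)),
      ← ENNReal.ofReal_mul (by positivity), ← ENNReal.ofReal_mul (by positivity)]
    refine add_le_add (mul_le_mul_right (ENNReal.ofReal_le_ofReal ?_) _)
      (ENNReal.ofReal_le_ofReal ?_)
    · rw [show n + 1 + 1 = n + 2 from rfl, hsucc, Real.mul_rpow hm1.le hr0.le]
      have hcp : c0 ^ p ≤ (1 + S / (n + 1 : ℕ)) ^ p :=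
        Real.rpow_le_rpow hc0pos.le hr (by linarith)
      have e1 : ((1 + S / (n + 1 : ℕ)) ^ p + D * ((n + 1 : ℕ) : ℝ) ^ (-ε) / (n + 1 : ℕ)) *
          (gammaRatio S (n + 1) ^ p * (1 + S / (n + 1 : ℕ)) ^ p)⁻¹ =
          (gammaRatio S (n + 1) ^ p)⁻¹ * (1 + D * ((n + 1 : ℕ) : ℝ) ^ (-1 - ε) /
            (1 + S / (n + 1 : ℕ)) ^ p) := by
        rw [show -1 - ε = -ε - 1 by ring, Real.rpow_sub_one hn.ne']
        have : (1 + S / (n + 1 : ℕ)) ^ p ≠ 0 := by positivity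
        have : gammaRatio S (n + 1) ^ p ≠ 0 := by positivity
        generalize (1 + S / (n + 1 : ℕ)) ^ p = y at *
        field_simp
      rw [e1]
      gcongr
      rw [div_mul_eq_mul_div]
      gcongr
    · have hlow : c0 * c * ((n + 1 : ℕ) : ℝ) ^ S ≤ gammaRatio S (n + 2) := by
        rw [hsucc, mul_comm (gammaRatio _ _), mul_assoc]
        have := (hbound (n + 1) (by omega)).1
        gcongr
      have hup := (hbound' (n + 1) (by omega)).2
      have hpow : (c0 * c) ^ p * ((n + 1 : ℕ) : ℝ) ^ (p * S) ≤ gammaRatio S (n + 2) ^ p := by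
        rw [mul_comm p S, Real.rpow_mul hn.le, ← Real.mul_rpow (by positivity) (by positivity)]
        exact Real.rpow_le_rpow (by positivity) hlow (by linarith)
      calc D * (((n + 1 : ℕ) : ℝ) ^ (-ε)) ^ (-K) / (n + 1 : ℕ) * gammaRatio S' (n + 1) *
            (gammaRatio S (n + 1 + 1) ^ p)⁻¹
          ≤ D * (((n + 1 : ℕ) : ℝ) ^ (-ε)) ^ (-K) / (n + 1 : ℕ) *
            (C' * ((n + 1 : ℕ) : ℝ) ^ S') * ((c0 * c) ^ p * ((n + 1 : ℕ) : ℝ) ^ (p * S))⁻¹ := by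
            gcongr
        _ = D * C' / (c0 * c) ^ p * ((n + 1 : ℕ) : ℝ) ^ (ε * K + S' - 1 - p * S) := by
            rw [Real.rpow_sub hn, Real.rpow_sub_one hn.ne', Real.rpow_add hn, ← Real.rpow_mul hn.le,
              neg_mul_neg]
            field_simp

lemma ae_normalizedLimit_nonneg (h : IsCollisionSequence P L R Ls Rs I) (hLm : Measurable L)
    (hRm : Measurable R) (hL : 0 ≤ᵐ[P] L) (hR : 0 ≤ᵐ[P] R) (hS : -1 < S)
    (hmom : ∫⁻ z, ENNReal.ofReal (z.1 ^ α + z.2 ^ α) ∂(P.map fun ω => (L ω, R ω)) =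
      ENNReal.ofReal (S + 1)) :
    ∀ᵐ ω ∂P, 0 ≤ normalizedLimit (splitWeight Ls Rs I) α S ω := by
  filter_upwards [h.ae_exists_tendsto_weightSum hLm hRm hL hR hS hmom,
    h.ae_weightSum_nonneg hLm hRm hL hR α] with ω hω h0
  refine ge_of_tendsto hω ?_
  filter_upwards [eventually_ge_atTop 1] with n hn
  exact div_nonneg (h0 n) (gammaRatio_pos hS hn).le

lemma lintegral_normalizedLimit (h : IsCollisionSequence P L R Ls Rs I)
    (hLm : Measurable L) (hRm : Measurable R) (hL : 0 ≤ᵐ[P] L) (hR : 0 ≤ᵐ[P] R)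
    (hp : 1 < p) (hS : -1 < S) (hS' : -1 < S') (hSS : S' < p * S)
    (hmom : ∫⁻ z, ENNReal.ofReal (z.1 ^ α + z.2 ^ α) ∂(P.map fun ω => (L ω, R ω)) =
      ENNReal.ofReal (S + 1))
    (hmom' : ∫⁻ z, ENNReal.ofReal (z.1 ^ (α * p) + z.2 ^ (α * p)) ∂(P.map fun ω => (L ω, R ω)) =
      ENNReal.ofReal (S' + 1)) :
    ∫⁻ ω, ENNReal.ofReal (normalizedLimit (splitWeight Ls Rs I) α S ω) ∂P = 1 ∧
      ∫⁻ ω, ENNReal.ofReal (normalizedLimit (splitWeight Ls Rs I) α S ω ^ p) ∂P ≠ ∞ := by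
  obtain ⟨C, hC⟩ :=
    h.exists_lintegral_weightSum_rpow_le hLm hRm hL hR hp hS hS' hSS hmom hmom'
  have hmpos : ∀ n : ℕ, 0 < gammaRatio S (n + 1) := fun n => gammaRatio_pos hS (by omega)
  have hnn := h.ae_weightSum_nonneg hLm hRm hL hR α
  have := lintegral_limit_of_rpow_bounded
    (X := fun n ω => weightSum (splitWeight Ls Rs I) α (n + 1) ω / gammaRatio S (n + 1))
    (fun n => (h.measurable_weightSum α (n + 1)).div_const _)
    (fun n => by filter_upwards [hnn] with ω hω using div_nonneg (hω _) (hmpos n).le)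
    (by
      filter_upwards [h.ae_exists_tendsto_weightSum hLm hRm hL hR hS hmom] with ω hω
      exact hω.comp (tendsto_add_atTop_nat 1)) (fun n => ?_) hp hC
  · exact ⟨this.1, ne_top_of_le_ne_top ENNReal.coe_ne_top this.2⟩
  · have e : ∀ᵐ ω ∂P, ENNReal.ofReal (weightSum (splitWeight Ls Rs I) α (n + 1) ω /
        gammaRatio S (n + 1)) = ENNReal.ofReal (weightSum (splitWeight Ls Rs I) α (n + 1) ω) *
          ENNReal.ofReal (gammaRatio S (n + 1))⁻¹ := by
      filter_upwards [hnn] with ω hω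
      rw [div_eq_mul_inv, ENNReal.ofReal_mul (hω _)]
    rw [lintegral_congr_ae e, lintegral_mul_const _ (h.measurable_weightSum α _).ennreal_ofReal,
      h.lintegral_weightSum hLm hRm hL hR hS hmom, ← ENNReal.ofReal_mul (hmpos n).le,
      mul_inv_cancel₀ (hmpos n).ne', ENNReal.ofReal_one]

end IsCollisionSequence

/-! ### Forward and backward equations for products over the weights -/

section Wild

variable (κ : Measure (ℝ × ℝ))

/-- Integrate out a split of the `i`-th entry: the functions `G i`, `G (i + 1)` of the two parts
are replaced by a function of the entry. -/
noncomputable def mergeAt (i : ℕ) (G : ℕ → ℝ → ℝ≥0∞) (j : ℕ) : ℝ → ℝ≥0∞ :=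
  if j < i then G j
  else if j = i then fun x => ∫⁻ z, G i (z.1 * x) * G (i + 1) (z.2 * x) ∂κ
  else G (j + 1)

/-- The mean of `G 1 (β₁) ⋯ G (n + 1) (βₙ₊₁)` over the weights of generation `n + 1`. -/
noncomputable def splitMean : ℕ → (ℕ → ℝ → ℝ≥0∞) → ℝ≥0∞
  | 0, G => G 1 1
  | n + 1, G => ((n + 1 : ℕ) : ℝ≥0∞)⁻¹ *
      ∑ i ∈ Finset.Icc 1 (n + 1), splitMean n (mergeAt κ i G)

variable {κ}

lemma mergeAt_scale (i : ℕ) (G : ℕ → ℝ → ℝ≥0∞) (c : ℝ) :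
    mergeAt κ i (fun k x => G k (c * x)) = fun k x => mergeAt κ i G k (c * x) := by
  ext j x
  unfold mergeAt
  split_ifs
  · rfl
  · simp only [mul_left_comm c]
  · rfl

lemma mergeAt_shift (i m : ℕ) (G : ℕ → ℝ → ℝ≥0∞) :
    mergeAt κ i (fun k => G (k + m)) = fun k => mergeAt κ (i + m) G (k + m) := by
  ext j x
  unfold mergeAt
  rcases lt_trichotomy j i with h | h | h
  · rw [if_pos h, if_pos (by omega)]
  · subst h
    simp [add_right_comm]
  · rw [if_neg (by omega), if_neg (by omega), if_neg (by omega), if_neg (by omega),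
      add_right_comm]

lemma splitMean_congr {n : ℕ} {G H : ℕ → ℝ → ℝ≥0∞}
    (h : ∀ k, 1 ≤ k → k ≤ n + 1 → G k = H k) : splitMean κ n G = splitMean κ n H := by
  induction n generalizing G H with
  | zero => simp only [splitMean]; rw [h 1 le_rfl le_rfl]
  | succ n ih =>
    simp only [splitMean]
    congr 1
    refine Finset.sum_congr rfl fun i hi => ih fun k hk hkn => ?_
    obtain ⟨hi1, hi2⟩ := Finset.mem_Icc.1 hi
    unfold mergeAt
    split_ifs
    · exact h k hk (by omega)
    · rw [h i hi1 (by omega), h (i + 1) (by omega) (by omega)]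
    · exact h (k + 1) (by omega) (by omega)

variable [SFinite κ]

lemma measurable_mergeAt {Y : Type*} [MeasurableSpace Y] {G : Y → ℕ → ℝ → ℝ≥0∞}
    (hG : ∀ k, Measurable fun q : Y × ℝ => G q.1 k q.2) (i k : ℕ) :
    Measurable fun q : Y × ℝ => mergeAt κ i (G q.1) k q.2 := by
  unfold mergeAt
  split_ifs
  · exact hG k
  · refine Measurable.lintegral_prod_right' (f := fun q : (Y × ℝ) × (ℝ × ℝ) =>
      G q.1.1 i (q.2.1 * q.1.2) * G q.1.1 (i + 1) (q.2.2 * q.1.2)) ?_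
    exact ((hG i).comp (by fun_prop : Measurable fun q : (Y × ℝ) × (ℝ × ℝ) =>
      (q.1.1, q.2.1 * q.1.2))).mul ((hG (i + 1)).comp (by fun_prop : Measurable
      fun q : (Y × ℝ) × (ℝ × ℝ) => (q.1.1, q.2.2 * q.1.2)))
  · exact hG (k + 1)

lemma measurable_splitMean {Y : Type*} [MeasurableSpace Y] {G : Y → ℕ → ℝ → ℝ≥0∞}
    (hG : ∀ k, Measurable fun q : Y × ℝ => G q.1 k q.2) (n : ℕ) :
    Measurable fun y => splitMean κ n (G y) := by
  induction n generalizing G with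
  | zero => exact (hG 1).comp (by fun_prop : Measurable fun y : Y => (y, (1 : ℝ)))
  | succ n ih =>
    refine Measurable.const_mul (Finset.measurable_fun_sum _ fun i _ => ?_) _
    exact ih fun k => measurable_mergeAt hG i k

lemma measurable_mergeAt' {G : ℕ → ℝ → ℝ≥0∞} (hG : ∀ k, Measurable (G k)) (i k : ℕ) :
    Measurable (mergeAt κ i G k) :=
  (measurable_mergeAt (Y := Unit) (G := fun _ => G) (fun k => (hG k).comp measurable_snd) i k).comp
    (by fun_prop : Measurable fun x : ℝ => ((), x))

/-- The decomposition at the first split. -/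
lemma splitMean_backward {G : ℕ → ℝ → ℝ≥0∞} (hG : ∀ k, Measurable (G k)) (n : ℕ) :
    ((n + 1 : ℕ) : ℝ≥0∞) * splitMean κ (n + 1) G = ∑ j ∈ Finset.range (n + 1),
      ∫⁻ z, splitMean κ j (fun k x => G k (z.1 * x)) *
        splitMean κ (n - j) (fun k x => G (k + (j + 1)) (z.2 * x)) ∂κ := by
  have hsucc : ∀ (m : ℕ) (H : ℕ → ℝ → ℝ≥0∞), ((m + 1 : ℕ) : ℝ≥0∞) * splitMean κ (m + 1) H =
      ∑ i ∈ Finset.Icc 1 (m + 1), splitMean κ m (mergeAt κ i H) := by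
    intro m H
    rw [splitMean, ← mul_assoc, ENNReal.mul_inv_cancel (by simp) (by simp), one_mul]
  have hmeasL : ∀ (H : ℕ → ℝ → ℝ≥0∞), (∀ k, Measurable (H k)) → ∀ m,
      Measurable fun z : ℝ × ℝ => splitMean κ m (fun k x => H k (z.1 * x)) := fun H hH m =>
    measurable_splitMean (G := fun (z : ℝ × ℝ) k x => H k (z.1 * x)) (fun k => (hH k).comp
      (by fun_prop : Measurable fun q : (ℝ × ℝ) × ℝ => q.1.1 * q.2)) m
  have hmeasR : ∀ (H : ℕ → ℝ → ℝ≥0∞), (∀ k, Measurable (H k)) → ∀ m,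
      Measurable fun z : ℝ × ℝ => splitMean κ m (fun k x => H k (z.2 * x)) := fun H hH m =>
    measurable_splitMean (G := fun (z : ℝ × ℝ) k x => H k (z.2 * x)) (fun k => (hH k).comp
      (by fun_prop : Measurable fun q : (ℝ × ℝ) × ℝ => q.1.2 * q.2)) m
  induction n generalizing G with
  | zero =>
    rw [hsucc]
    simp [splitMean, mergeAt]
  | succ n ih =>
    set T : ℕ → ℝ≥0∞ := fun j => ∫⁻ z, splitMean κ j (fun k x => G k (z.1 * x)) *
        splitMean κ (n + 1 - j) (fun k x => G (k + (j + 1)) (z.2 * x)) ∂κ with hT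
    have hG' : ∀ m k, Measurable (G (k + m)) := fun m k => hG _
    have hterm : ∀ j ∈ Finset.range (n + 1), ∑ i ∈ Finset.Icc 1 (n + 2),
        ∫⁻ z, splitMean κ j (fun k x => mergeAt κ i G k (z.1 * x)) *
          splitMean κ (n - j) (fun k x => mergeAt κ i G (k + (j + 1)) (z.2 * x)) ∂κ =
        ((j + 1 : ℕ) : ℝ≥0∞) * T (j + 1) + ((n + 1 - j : ℕ) : ℝ≥0∞) * T j := by
      intro j hj
      have hjn : j ≤ n := by have := Finset.mem_range.1 hj; omega
      have hsplit : Finset.Icc 1 (n + 2) = Finset.Icc 1 (j + 1) ∪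
          (Finset.Icc 1 (n - j + 1)).map (addRightEmbedding (j + 1)) := by
        ext i
        simp only [Finset.mem_Icc, Finset.mem_union, Finset.mem_map, addRightEmbedding_apply]
        constructor
        · rintro ⟨h1, h2⟩
          by_cases h : i ≤ j + 1
          · exact Or.inl ⟨h1, h⟩
          · exact Or.inr ⟨i - (j + 1), ⟨by omega, by omega⟩, by omega⟩
        · rintro (⟨h1, h2⟩ | ⟨i', ⟨h1, h2⟩, rfl⟩) <;> constructor <;> omega
      have hdisj : Disjoint (Finset.Icc 1 (j + 1))
          ((Finset.Icc 1 (n - j + 1)).map (addRightEmbedding (j + 1))) := by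
        rw [Finset.disjoint_left]
        intro i hi hi'
        obtain ⟨i', h1, rfl⟩ := Finset.mem_map.1 hi'
        have := (Finset.mem_Icc.1 hi).2
        have := (Finset.mem_Icc.1 h1).1
        simp only [addRightEmbedding_apply] at *
        omega
      rw [hsplit, Finset.sum_union hdisj, Finset.sum_map]
      congr 1
      · have e : ∀ i ∈ Finset.Icc 1 (j + 1),
            ∫⁻ z, splitMean κ j (fun k x => mergeAt κ i G k (z.1 * x)) *
              splitMean κ (n - j) (fun k x => mergeAt κ i G (k + (j + 1)) (z.2 * x)) ∂κ =
            ∫⁻ z, splitMean κ j (mergeAt κ i fun k x => G k (z.1 * x)) *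
              splitMean κ (n - j) (fun k x => G (k + (j + 2)) (z.2 * x)) ∂κ := by
          intro i hi
          refine lintegral_congr fun z => ?_
          rw [mergeAt_scale]
          congr 1
          refine splitMean_congr fun k hk _ => ?_
          have := (Finset.mem_Icc.1 hi).2
          ext x
          rw [mergeAt, if_neg (by omega), if_neg (by omega)]
          rfl
        rw [Finset.sum_congr rfl e, ← lintegral_finsetSum]
        · have e2 : ∀ z : ℝ × ℝ, ∑ i ∈ Finset.Icc 1 (j + 1),
              splitMean κ j (mergeAt κ i fun k x => G k (z.1 * x)) *
                splitMean κ (n - j) (fun k x => G (k + (j + 2)) (z.2 * x)) =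
              ((j + 1 : ℕ) : ℝ≥0∞) * (splitMean κ (j + 1) (fun k x => G k (z.1 * x)) *
                splitMean κ (n - j) (fun k x => G (k + (j + 2)) (z.2 * x))) := by
            intro z
            rw [← Finset.sum_mul, ← hsucc, mul_assoc]
          simp_rw [e2]
          rw [lintegral_const_mul]
          · simp only [hT]
            rw [show n + 1 - (j + 1) = n - j by omega]
          · exact (hmeasL G hG _).mul (hmeasR (fun k => G (k + (j + 2))) (hG' _) _)
        · intro i _
          simp_rw [mergeAt_scale]
          exact (hmeasL _ (measurable_mergeAt' hG i) _).mul
            (hmeasR (fun k => G (k + (j + 2))) (hG' _) _)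
      · have e : ∀ i ∈ Finset.Icc 1 (n - j + 1),
            ∫⁻ z, splitMean κ j (fun k x =>
                mergeAt κ (addRightEmbedding (j + 1) i) G k (z.1 * x)) *
              splitMean κ (n - j) (fun k x =>
                mergeAt κ (addRightEmbedding (j + 1) i) G (k + (j + 1)) (z.2 * x)) ∂κ =
            ∫⁻ z, splitMean κ j (fun k x => G k (z.1 * x)) *
              splitMean κ (n - j) (mergeAt κ i fun k x => G (k + (j + 1)) (z.2 * x)) ∂κ := by
          intro i hi
          have hi1 := (Finset.mem_Icc.1 hi).1
          refine lintegral_congr fun z => ?_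
          congr 1
          · refine splitMean_congr fun k _ hk => ?_
            ext x
            rw [mergeAt, addRightEmbedding_apply, if_pos (by omega)]
          · rw [mergeAt_scale i (fun k => G (k + (j + 1))), mergeAt_shift]
            rfl
        rw [Finset.sum_congr rfl e, ← lintegral_finsetSum]
        · have e2 : ∀ z : ℝ × ℝ, ∑ i ∈ Finset.Icc 1 (n - j + 1),
              splitMean κ j (fun k x => G k (z.1 * x)) *
                splitMean κ (n - j) (mergeAt κ i fun k x => G (k + (j + 1)) (z.2 * x)) =
              ((n - j + 1 : ℕ) : ℝ≥0∞) * (splitMean κ j (fun k x => G k (z.1 * x)) *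
                splitMean κ (n - j + 1) (fun k x => G (k + (j + 1)) (z.2 * x))) := by
            intro z
            rw [← Finset.mul_sum, ← hsucc, mul_left_comm]
          simp_rw [e2]
          rw [lintegral_const_mul]
          · simp only [hT]
            rw [show n - j + 1 = n + 1 - j by omega]
          · exact (hmeasL G hG _).mul (hmeasR (fun k => G (k + (j + 1))) (hG' _) _)
        · intro i _
          simp_rw [mergeAt_scale i (fun k => G (k + (j + 1)))]
          exact (hmeasL _ hG _).mul
            (hmeasR _ (measurable_mergeAt' (G := fun k => G (k + (j + 1))) (hG' _) i) _)
    have hmain : ((n + 1 : ℕ) : ℝ≥0∞) * (((n + 1 + 1 : ℕ) : ℝ≥0∞) * splitMean κ (n + 1 + 1) G) =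
        ((n + 1 : ℕ) : ℝ≥0∞) * ∑ j ∈ Finset.range (n + 2), T j := by
      rw [hsucc, Finset.mul_sum, Finset.sum_congr rfl fun i _ =>
        ih (G := mergeAt κ i G) (measurable_mergeAt' hG i), Finset.sum_comm,
        Finset.sum_congr rfl hterm, Finset.sum_add_distrib]
      have s1 : ∑ j ∈ Finset.range (n + 1), ((j + 1 : ℕ) : ℝ≥0∞) * T (j + 1) =
          ∑ j ∈ Finset.range (n + 2), (j : ℝ≥0∞) * T j := by
        rw [Finset.sum_range_succ' (fun j : ℕ => (j : ℝ≥0∞) * T j) (n + 1)]; simp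
      have s2 : ∑ j ∈ Finset.range (n + 1), ((n + 1 - j : ℕ) : ℝ≥0∞) * T j =
          ∑ j ∈ Finset.range (n + 2), ((n + 1 - j : ℕ) : ℝ≥0∞) * T j := by
        rw [Finset.sum_range_succ _ (n + 1)]; simp
      rw [s1, s2, ← Finset.sum_add_distrib, Finset.mul_sum]
      refine Finset.sum_congr rfl fun j hj => ?_
      have := Finset.mem_range.1 hj
      rw [← add_mul, ← Nat.cast_add, show j + (n + 1 - j) = n + 1 by omega]
    exact (ENNReal.mul_right_inj (by simp) (by simp)).1 hmain

end Wild

namespace IsCollisionSequence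

variable {Ω : Type*} [MeasurableSpace Ω] {P : Measure Ω} [IsProbabilityMeasure P]
  {L R : Ω → ℝ} {Ls Rs : ℕ → Ω → ℝ} {I : ℕ → Ω → ℕ}

lemma lintegral_prod_weight (h : IsCollisionSequence P L R Ls Rs I) (hLm : Measurable L)
    (hRm : Measurable R) (n : ℕ) {G : ℕ → ℝ → ℝ≥0∞} (hG : ∀ k, Measurable (G k)) :
    ∫⁻ ω, ∏ j ∈ Finset.Icc 1 (n + 1), G j (splitWeight Ls Rs I (n + 1) j ω) ∂P =
      splitMean (P.map fun ω => (L ω, R ω)) n G := by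
  have := Measure.isProbabilityMeasure_map (μ := P) (hLm.prodMk hRm).aemeasurable
  induction n generalizing G with
  | zero => simp [splitWeight, splitMean]
  | succ n ih =>
    have hstep := h.lintegral_splitWeight_succ n
      (F := fun _ v => ∏ j ∈ Finset.Icc 1 (n + 2), G j (v j)) (by fun_prop)
    rw [hstep, splitMean]
    have hin : ∀ ω, ∀ i ∈ Finset.Icc 1 (n + 1), ∫⁻ z, ∏ j ∈ Finset.Icc 1 (n + 2),
        G j (splitStep (fun j => splitWeight Ls Rs I (n + 1) j ω) i z j)
          ∂(P.map fun ω => (L ω, R ω)) = ∏ j ∈ Finset.Icc 1 (n + 1),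
        mergeAt (P.map fun ω => (L ω, R ω)) i G j (splitWeight Ls Rs I (n + 1) j ω) := by
      intro ω i hi
      obtain ⟨h1, h2⟩ := Finset.mem_Icc.1 hi
      simp_rw [prod_Icc_splitStep G (fun j => splitWeight Ls Rs I (n + 1) j ω) _ h1 h2]
      simp_rw [← Finset.mul_prod_erase _ _ hi]
      simp only [lt_self_iff_false, if_false, if_true]
      have e : ∀ z : ℝ × ℝ, ∏ j ∈ (Finset.Icc 1 (n + 1)).erase i,
          (if j < i then G j (splitWeight Ls Rs I (n + 1) j ω) else if j = i then
            G i (z.1 * splitWeight Ls Rs I (n + 1) i ω) *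
              G (i + 1) (z.2 * splitWeight Ls Rs I (n + 1) i ω)
            else G (j + 1) (splitWeight Ls Rs I (n + 1) j ω)) =
          ∏ j ∈ (Finset.Icc 1 (n + 1)).erase i,
            mergeAt (P.map fun ω => (L ω, R ω)) i G j (splitWeight Ls Rs I (n + 1) j ω) := by
        intro z
        refine Finset.prod_congr rfl fun j hj => ?_
        have hji := Finset.ne_of_mem_erase hj
        unfold mergeAt
        split_ifs <;> rfl
      simp_rw [e]
      rw [lintegral_mul_const _ (by
        have h3 := hG i
        have h4 := hG (i + 1)
        fun_prop)]
      congr 1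
      simp [mergeAt]
    simp_rw [fun ω => Finset.sum_congr rfl (hin ω)]
    have hm : ∀ i, Measurable fun ω => ∏ j ∈ Finset.Icc 1 (n + 1),
        mergeAt (P.map fun ω => (L ω, R ω)) i G j (splitWeight Ls Rs I (n + 1) j ω) := fun i =>
      Finset.measurable_fun_prod _ fun j _ =>
        (measurable_mergeAt' hG i j).comp (h.measurable_weight (n + 1) j)
    rw [lintegral_const_mul _ (Finset.measurable_fun_sum _ fun i _ => hm i),
      lintegral_finsetSum _ fun i _ => hm i]
    congr 1
    exact Finset.sum_congr rfl fun i _ => ih fun k => measurable_mergeAt' hG i k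

end IsCollisionSequence

/-- The Laplace transform of `M_{n + 1}(α)`. -/
noncomputable def weightSumLaplace {Ω : Type*} [MeasurableSpace Ω] (P : Measure Ω)
    (β : ℕ → ℕ → Ω → ℝ) (α : ℝ) (n : ℕ) (l : ℝ) : ℝ≥0∞ :=
  ∫⁻ ω, ENNReal.ofReal (Real.exp (-(l * weightSum β α (n + 1) ω))) ∂P

namespace IsCollisionSequence

variable {Ω : Type*} [MeasurableSpace Ω] {P : Measure Ω} [IsProbabilityMeasure P]
  {L R : Ω → ℝ} {Ls Rs : ℕ → Ω → ℝ} {I : ℕ → Ω → ℕ} {α : ℝ}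

lemma measurable_weightSumLaplace (h : IsCollisionSequence P L R Ls Rs I) (n : ℕ) :
    Measurable (weightSumLaplace P (splitWeight Ls Rs I) α n) := by
  have := h.measurable_weightSum α (n + 1)
  exact Measurable.lintegral_prod_right' (f := fun q : ℝ × Ω => ENNReal.ofReal
    (Real.exp (-(q.1 * weightSum (splitWeight Ls Rs I) α (n + 1) q.2)))) (by fun_prop)

lemma weightSumLaplace_mul_rpow (h : IsCollisionSequence P L R Ls Rs I) (hLm : Measurable L)
    (hRm : Measurable R) (hL : 0 ≤ᵐ[P] L) (hR : 0 ≤ᵐ[P] R) (n : ℕ) (l : ℝ) {c : ℝ} (hc : 0 ≤ c) :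
    weightSumLaplace P (splitWeight Ls Rs I) α n (l * c ^ α) =
      splitMean (P.map fun ω => (L ω, R ω)) n
        (fun _ x => ENNReal.ofReal (Real.exp (-(l * (c * x) ^ α)))) := by
  rw [← h.lintegral_prod_weight hLm hRm n fun k => by fun_prop]
  refine lintegral_congr_ae ?_
  filter_upwards [h.ae_splitWeight_nonneg hLm hRm hL hR] with ω hω
  rw [← ENNReal.ofReal_prod_of_nonneg fun j _ => (Real.exp_pos _).le, ← Real.exp_sum]
  congr 2
  rw [Finset.sum_neg_distrib, neg_inj, weightSum, Finset.mul_sum]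
  refine Finset.sum_congr rfl fun j _ => ?_
  rw [Real.mul_rpow hc (hω _ _), mul_assoc]

/-- Wild's recursion for the Laplace transforms of the sums of weights. -/
lemma weightSumLaplace_succ (h : IsCollisionSequence P L R Ls Rs I) (hLm : Measurable L)
    (hRm : Measurable R) (hL : 0 ≤ᵐ[P] L) (hR : 0 ≤ᵐ[P] R) (n : ℕ) (l : ℝ) :
    ((n + 1 : ℕ) : ℝ≥0∞) * weightSumLaplace P (splitWeight Ls Rs I) α (n + 1) l =
      ∫⁻ z, ∑ q ∈ Finset.HasAntidiagonal.antidiagonal n,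
        weightSumLaplace P (splitWeight Ls Rs I) α q.1 (l * z.1 ^ α) *
          weightSumLaplace P (splitWeight Ls Rs I) α q.2 (l * z.2 ^ α)
          ∂(P.map fun ω => (L ω, R ω)) := by
  have := Measure.isProbabilityMeasure_map (μ := P) (hLm.prodMk hRm).aemeasurable
  have h1 := h.weightSumLaplace_mul_rpow hLm hRm hL hR (α := α) (n + 1) l zero_le_one
  rw [Real.one_rpow, mul_one] at h1
  simp only [one_mul] at h1
  have hm := fun k => h.measurable_weightSumLaplace (α := α) k
  rw [h1, splitMean_backward (fun k => by fun_prop), lintegral_finsetSum _ fun q _ => by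
    have := hm q.1
    have := hm q.2
    fun_prop, Finset.Nat.sum_antidiagonal_eq_sum_range_succ_mk]
  refine Finset.sum_congr rfl fun j _ => lintegral_congr_ae ?_
  filter_upwards [ae_map_nonneg hLm hRm hL hR] with z hz
  rw [h.weightSumLaplace_mul_rpow hLm hRm hL hR _ _ hz.1,
    h.weightSumLaplace_mul_rpow hLm hRm hL hR _ _ hz.2]

end IsCollisionSequence

/-! ### Geometric mixtures and the fixed point equation -/

lemma ENNReal.tsum_mul_tsum_eq_tsum_sum_antidiagonal (a b : ℕ → ℝ≥0∞) :
    (∑' n, a n) * ∑' n, b n =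
      ∑' n, ∑ q ∈ Finset.HasAntidiagonal.antidiagonal n, a q.1 * b q.2 := by
  rw [← ENNReal.tsum_mul_right]
  simp_rw [← ENNReal.tsum_mul_left]
  rw [← ENNReal.tsum_prod (f := fun i j => a i * b j),
    ← Finset.HasAntidiagonal.sigmaAntidiagonalEquivProd.tsum_eq, ENNReal.tsum_sigma']
  refine tsum_congr fun n => ?_
  rw [tsum_fintype]
  exact Finset.sum_coe_sort (Finset.HasAntidiagonal.antidiagonal n) fun q => a q.1 * b q.2

/-- The mixture of `f 0, f 1, …` with respect to the geometric distribution of parameter `y`. -/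
noncomputable def geometricMix (f : ℕ → ℝ → ℝ≥0∞) (y l : ℝ) : ℝ≥0∞ :=
  ∑' n, ENNReal.ofReal (y * (1 - y) ^ n) * f n l

lemma measurable_geometricMix {f : ℕ → ℝ → ℝ≥0∞} (hf : ∀ n, Measurable (f n)) :
    Measurable fun q : ℝ × ℝ => geometricMix f q.1 q.2 :=
  Measurable.tsum fun n => by
    have := hf n
    fun_prop

lemma tsum_geometric_ofReal {y : ℝ} (hy : 0 < y) (hy1 : y ≤ 1) :
    ∑' n : ℕ, ENNReal.ofReal (y * (1 - y) ^ n) = 1 := by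
  have h := tsum_geometric_mul_gammaRatio (S := 0) (by norm_num) hy hy1
  have hg : ∀ n : ℕ, gammaRatio 0 (n + 1) = 1 := fun n => by
    rw [gammaRatio_eq_prod (by norm_num), ← Finset.prod_range_add_one_eq_factorial,
      Nat.cast_prod, div_eq_one_iff_eq (by positivity)]
    exact Finset.prod_congr rfl fun j _ => by push_cast; ring
  simpa [hg] using h

lemma geometricMix_le_one {f : ℕ → ℝ → ℝ≥0∞} {y l : ℝ} (hy : 0 < y) (hy1 : y ≤ 1)
    (hf : ∀ n, f n l ≤ 1) : geometricMix f y l ≤ 1 := by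
  rw [← tsum_geometric_ofReal hy hy1]
  exact ENNReal.tsum_le_tsum fun n => mul_le_of_le_one_right bot_le (hf n)

/-- The integral form of Kac's equation. -/
lemma geometricMix_eq {κ : Measure (ℝ × ℝ)} [SFinite κ] {f : ℕ → ℝ → ℝ≥0∞} {α : ℝ}
    (hf : ∀ n, Measurable (f n))
    (hrec : ∀ n l, ((n + 1 : ℕ) : ℝ≥0∞) * f (n + 1) l = ∫⁻ z,
      ∑ q ∈ Finset.HasAntidiagonal.antidiagonal n, f q.1 (l * z.1 ^ α) * f q.2 (l * z.2 ^ α) ∂κ)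
    {y : ℝ} (hy : 0 < y) (hy1 : y ≤ 1) (l : ℝ) :
    geometricMix f y l = ENNReal.ofReal y * f 0 l + ∫⁻ θ in Set.Ioo y 1,
      ∫⁻ z, geometricMix f (y / θ) (l * z.1 ^ α) * geometricMix f (y / θ) (l * z.2 ^ α) ∂κ := by
  have hterm : ∀ θ ∈ Set.Ioo y 1,
      ∫⁻ z, geometricMix f (y / θ) (l * z.1 ^ α) * geometricMix f (y / θ) (l * z.2 ^ α) ∂κ =
      ∑' n : ℕ, ENNReal.ofReal ((y / θ) ^ 2 * ((n + 1) * (1 - y / θ) ^ n)) * f (n + 1) l := by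
    intro θ hθ
    have hθ0 : 0 < θ := hy.trans hθ.1
    set x := y / θ with hx
    have hx0 : 0 < x := div_pos hy hθ0
    have hx1 : 0 ≤ 1 - x := by rw [sub_nonneg, hx, div_le_one hθ0]; exact hθ.1.le
    have e1 : ∀ z : ℝ × ℝ, geometricMix f x (l * z.1 ^ α) * geometricMix f x (l * z.2 ^ α) =
        ∑' n : ℕ, ENNReal.ofReal (x ^ 2 * (1 - x) ^ n) *
          ∑ q ∈ Finset.HasAntidiagonal.antidiagonal n,
            f q.1 (l * z.1 ^ α) * f q.2 (l * z.2 ^ α) := by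
      intro z
      unfold geometricMix
      rw [ENNReal.tsum_mul_tsum_eq_tsum_sum_antidiagonal]
      refine tsum_congr fun n => ?_
      rw [Finset.mul_sum]
      refine Finset.sum_congr rfl fun q hq => ?_
      rw [mul_mul_mul_comm, ← ENNReal.ofReal_mul (by positivity),
        ← (Finset.HasAntidiagonal.mem_antidiagonal.1 hq : q.1 + q.2 = n), pow_add]
      congr 2
      ring
    simp_rw [e1]
    have hm : ∀ n, Measurable fun z : ℝ × ℝ => ∑ q ∈ Finset.HasAntidiagonal.antidiagonal n,
        f q.1 (l * z.1 ^ α) * f q.2 (l * z.2 ^ α) := fun n =>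
      Finset.measurable_fun_sum _ fun q _ => by
        have := hf q.1
        have := hf q.2
        fun_prop
    rw [lintegral_tsum fun n => ((hm n).const_mul _).aemeasurable]
    refine tsum_congr fun n => ?_
    rw [lintegral_const_mul _ (hm n), ← hrec, ← mul_assoc, ← ENNReal.ofReal_natCast,
      ← ENNReal.ofReal_mul (by positivity)]
    congr 2
    push_cast
    ring
  rw [setLIntegral_congr_fun measurableSet_Ioo hterm, lintegral_tsum fun n => by fun_prop]
  unfold geometricMix
  rw [tsum_eq_zero_add' ENNReal.summable]
  congr 1
  · simp
  · refine tsum_congr fun n => ?_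
    rw [lintegral_mul_const _ (by fun_prop), lintegral_Ioo_geometric hy hy1]

lemma solvesFixedPoint_of_tendsto {κ : Measure (ℝ × ℝ)} [IsProbabilityMeasure κ]
    (hκ : ∀ᵐ z ∂κ, 0 ≤ z.1 ∧ 0 ≤ z.2) {f : ℕ → ℝ → ℝ≥0∞} {α S : ℝ}
    (hf : ∀ n, Measurable (f n)) (hf1 : ∀ n l, 0 ≤ l → f n l ≤ 1)
    (hrec : ∀ n l, ((n + 1 : ℕ) : ℝ≥0∞) * f (n + 1) l = ∫⁻ z,
      ∑ q ∈ Finset.HasAntidiagonal.antidiagonal n, f q.1 (l * z.1 ^ α) * f q.2 (l * z.2 ^ α) ∂κ)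
    {ζ : Measure ℝ} [IsProbabilityMeasure ζ] (hζ : ∀ᵐ x ∂ζ, 0 ≤ x)
    (hlim : ∀ l, 0 ≤ l → Tendsto (fun y => geometricMix f y (l * y ^ S)) (𝓝[>] 0)
      (𝓝 (∫⁻ x, ENNReal.ofReal (Real.exp (-(l * x))) ∂ζ))) :
    SolvesFixedPoint κ α S ζ := by
  set φ : ℝ → ℝ≥0∞ := fun l => ∫⁻ x, ENNReal.ofReal (Real.exp (-(l * x))) ∂ζ with hφ
  set ρ : Measure ℝ := volume.restrict (Set.Ioo (0 : ℝ) 1) with hρ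
  have hρp : IsProbabilityMeasure ρ := ⟨by simp [hρ]⟩
  have hUm := measurable_geometricMix hf
  have hae : ∀ᵐ x ∂(ρ.prod κ), (x.1 ∈ Set.Ioo (0 : ℝ) 1) ∧ 0 ≤ x.2.1 ∧ 0 ≤ x.2.2 :=
    (Measure.quasiMeasurePreserving_fst.ae (self_mem_ae_restrict measurableSet_Ioo)).and
      (Measure.quasiMeasurePreserving_snd.ae hκ)
  have hφeq : ∀ l, 0 ≤ l → φ l = ∫⁻ x, φ (l * x.1 ^ S * x.2.1 ^ α) * φ (l * x.1 ^ S * x.2.2 ^ α)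
      ∂(ρ.prod κ) := by
    intro l hl
    set F : ℝ → ℝ × (ℝ × ℝ) → ℝ≥0∞ := fun y x => (Set.Ioi y ×ˢ (Set.univ : Set (ℝ × ℝ))).indicator
      (fun x => geometricMix f (y / x.1) (l * y ^ S * x.2.1 ^ α) *
        geometricMix f (y / x.1) (l * y ^ S * x.2.2 ^ α)) x with hF
    have hFm : ∀ y, Measurable (F y) := fun y => by
      refine Measurable.indicator ?_ (measurableSet_Ioi.prod MeasurableSet.univ)
      exact (hUm.comp (by fun_prop : Measurable fun x : ℝ × (ℝ × ℝ) =>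
        (y / x.1, l * y ^ S * x.2.1 ^ α))).mul (hUm.comp (by fun_prop : Measurable
          fun x : ℝ × (ℝ × ℝ) => (y / x.1, l * y ^ S * x.2.2 ^ α)))
    have hright : Tendsto (fun y => ∫⁻ x, F y x ∂(ρ.prod κ)) (𝓝[>] 0)
        (𝓝 (∫⁻ x, φ (l * x.1 ^ S * x.2.1 ^ α) * φ (l * x.1 ^ S * x.2.2 ^ α) ∂(ρ.prod κ))) := by
      refine tendsto_lintegral_filter_of_dominated_convergence (fun _ => 1)
        (Eventually.of_forall fun y => hFm y) ?_ (by simp) ?_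
      · filter_upwards [self_mem_nhdsWithin] with y hy
        have hy0 : 0 < y := hy
        filter_upwards [hae] with x hx
        by_cases hyx : y < x.1
        · simp only [hF]
          rw [Set.indicator_of_mem (by simp [hyx])]
          have h1 : 0 < y / x.1 := div_pos hy0 hx.1.1
          have h2 : y / x.1 ≤ 1 := (div_le_one hx.1.1).2 hyx.le
          have hz1 := Real.rpow_nonneg hx.2.1 α
          have hz2 := Real.rpow_nonneg hx.2.2 α
          exact mul_le_one' (geometricMix_le_one h1 h2 fun n => hf1 n _ (by positivity))
            (geometricMix_le_one h1 h2 fun n => hf1 n _ (by positivity))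
        · simp only [hF]
          rw [Set.indicator_of_notMem (by simpa using hyx)]
          exact bot_le
      · filter_upwards [hae] with x hx
        have hx0 : 0 < x.1 := hx.1.1
        have hdiv : Tendsto (fun y : ℝ => y / x.1) (𝓝[>] 0) (𝓝[>] 0) := by
          refine tendsto_nhdsWithin_iff.2 ⟨?_, ?_⟩
          · have : Tendsto (fun y : ℝ => y / x.1) (𝓝 0) (𝓝 (0 / x.1)) :=
              tendsto_id.div_const _
            rw [zero_div] at this
            exact this.mono_left nhdsWithin_le_nhds
          · filter_upwards [self_mem_nhdsWithin] with y hy using div_pos hy hx0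
        have hone : ∀ w : ℝ, 0 ≤ w → Tendsto (fun y => geometricMix f (y / x.1)
            (l * y ^ S * w ^ α)) (𝓝[>] 0) (𝓝 (φ (l * x.1 ^ S * w ^ α))) := by
          intro w hw
          have hwα := Real.rpow_nonneg hw α
          have h1 := (hlim (l * x.1 ^ S * w ^ α) (by positivity)).comp hdiv
          refine h1.congr' ?_
          filter_upwards [self_mem_nhdsWithin] with y hy
          have hy0 : (0 : ℝ) < y := hy
          simp only [Function.comp_apply]
          congr 1
          rw [Real.div_rpow hy0.le hx0.le]
          have : 0 < x.1 ^ S := by positivity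
          field_simp
        have hφfin : ∀ l' : ℝ, 0 ≤ l' → φ l' ≠ ∞ := by
          intro l' hl'
          refine ne_top_of_le_ne_top ENNReal.one_ne_top ?_
          calc φ l' ≤ ∫⁻ _, 1 ∂ζ := by
                refine lintegral_mono_ae ?_
                filter_upwards [hζ] with x hx
                rw [← ENNReal.ofReal_one]
                refine ENNReal.ofReal_le_ofReal (Real.exp_le_one_iff.2 ?_)
                have := mul_nonneg hl' hx
                linarith
            _ = 1 := by simp
        have hz1 := Real.rpow_nonneg hx.2.1 α
        have hz2 := Real.rpow_nonneg hx.2.2 α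
        refine (ENNReal.Tendsto.mul (hone _ hx.2.1) (Or.inr (hφfin _ (by positivity)))
          (hone _ hx.2.2) (Or.inr (hφfin _ (by positivity)))).congr' ?_
        have hlt : ∀ᶠ y in 𝓝[>] (0 : ℝ), y < x.1 :=
          nhdsWithin_le_nhds (Iio_mem_nhds hx0)
        filter_upwards [hlt] with y hy
        simp only [hF]
        rw [Set.indicator_of_mem (by simp [hy])]
    have hsmall : Tendsto (fun y : ℝ => ENNReal.ofReal y * f 0 (l * y ^ S)) (𝓝[>] 0) (𝓝 0) := by
      have h0 : Tendsto (fun y : ℝ => ENNReal.ofReal y) (𝓝[>] 0) (𝓝 0) := by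
        have := (ENNReal.continuous_ofReal.tendsto 0).mono_left
          (nhdsWithin_le_nhds (s := Set.Ioi (0 : ℝ)))
        rwa [ENNReal.ofReal_zero] at this
      refine tendsto_of_tendsto_of_tendsto_of_le_of_le' tendsto_const_nhds h0
        (Eventually.of_forall fun _ => bot_le) ?_
      filter_upwards [self_mem_nhdsWithin] with y hy
      have hy0 : (0 : ℝ) < y := hy
      exact mul_le_of_le_one_right bot_le (hf1 _ _ (by positivity))
    have hsum := hsmall.add hright
    rw [zero_add] at hsum
    refine tendsto_nhds_unique ((hlim l hl).congr' ?_) hsum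
    have hlt : ∀ᶠ y in 𝓝[>] (0 : ℝ), y < 1 := nhdsWithin_le_nhds (Iio_mem_nhds one_pos)
    filter_upwards [self_mem_nhdsWithin, hlt] with y hy hy1
    have hy0 : (0 : ℝ) < y := hy
    rw [geometricMix_eq hf hrec hy0 hy1.le, lintegral_prod _ (hFm y).aemeasurable]
    congr 1
    rw [← lintegral_indicator measurableSet_Ioo, hρ, ← lintegral_indicator measurableSet_Ioo]
    refine lintegral_congr fun θ => ?_
    by_cases hθ : θ ∈ Set.Ioo y 1
    · rw [Set.indicator_of_mem hθ, Set.indicator_of_mem (by exact ⟨hy0.trans hθ.1, hθ.2⟩)]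
      refine lintegral_congr fun z => ?_
      simp only [hF]
      rw [Set.indicator_of_mem (by simp [hθ.1])]
    · rw [Set.indicator_of_notMem hθ]
      by_cases hθ' : θ ∈ Set.Ioo (0 : ℝ) 1
      · rw [Set.indicator_of_mem hθ']
        have hyθ : ¬ y < θ := fun h' => hθ ⟨h', hθ'.2⟩
        symm
        refine (lintegral_congr fun z => ?_).trans lintegral_zero
        simp only [hF]
        rw [Set.indicator_of_notMem (by simpa using hyθ)]
      · rw [Set.indicator_of_notMem hθ']
  refine ⟨inferInstance, ?_, ?_⟩
  · have := ae_iff.1 hζ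
    simpa [Set.Iio, not_le] using this
  · have hTm : Measurable (fun x : ℝ × (ℝ × ℝ) × (ℝ × ℝ) =>
        x.1 ^ S * (x.2.1.1 ^ α * x.2.2.1 + x.2.1.2 ^ α * x.2.2.2)) := by fun_prop
    have := Measure.isProbabilityMeasure_map (μ := ρ.prod (κ.prod (ζ.prod ζ))) hTm.aemeasurable
    refine Measure.ext_of_laplace hζ ?_ fun l hl => ?_
    · refine (ae_map_iff hTm.aemeasurable measurableSet_Ici).2 ?_
      have h1 : ∀ᵐ x ∂(ρ.prod (κ.prod (ζ.prod ζ))), x.1 ∈ Set.Ioo (0 : ℝ) 1 :=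
        Measure.quasiMeasurePreserving_fst.ae (self_mem_ae_restrict measurableSet_Ioo)
      have h2 : ∀ᵐ x ∂(ρ.prod (κ.prod (ζ.prod ζ))), 0 ≤ x.2.1.1 ∧ 0 ≤ x.2.1.2 :=
        Measure.quasiMeasurePreserving_snd.ae (Measure.quasiMeasurePreserving_fst.ae hκ)
      have h3 : ∀ᵐ x ∂(ρ.prod (κ.prod (ζ.prod ζ))), 0 ≤ x.2.2.1 :=
        Measure.quasiMeasurePreserving_snd.ae (Measure.quasiMeasurePreserving_snd.ae
          (Measure.quasiMeasurePreserving_fst.ae hζ))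
      have h4 : ∀ᵐ x ∂(ρ.prod (κ.prod (ζ.prod ζ))), 0 ≤ x.2.2.2 :=
        Measure.quasiMeasurePreserving_snd.ae (Measure.quasiMeasurePreserving_snd.ae
          (Measure.quasiMeasurePreserving_snd.ae hζ))
      filter_upwards [h1, h2, h3, h4] with x h1 h2 h3 h4
      have ha := Real.rpow_nonneg h2.1 α
      have hb := Real.rpow_nonneg h2.2 α
      have hc := Real.rpow_nonneg h1.1.le S
      positivity
    · rw [lintegral_map (by fun_prop) hTm]
      have hm1 : Measurable (fun x : ℝ × (ℝ × ℝ) × (ℝ × ℝ) => ENNReal.ofReal (Real.exp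
          (-(l * (x.1 ^ S * (x.2.1.1 ^ α * x.2.2.1 + x.2.1.2 ^ α * x.2.2.2)))))) := by fun_prop
      rw [lintegral_prod _ hm1.aemeasurable]
      have hφm : Measurable φ := Measurable.lintegral_prod_right' (f := fun q : ℝ × ℝ =>
        ENNReal.ofReal (Real.exp (-(q.1 * q.2)))) (by fun_prop)
      have := hφeq l hl
      rw [lintegral_prod _ (Measurable.aemeasurable (by fun_prop))] at this
      refine this.trans (lintegral_congr fun θ => ?_)
      rw [lintegral_prod _ (Measurable.aemeasurable (by fun_prop))]
      refine lintegral_congr fun z => ?_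
      have e : ∀ w : ℝ × ℝ, ENNReal.ofReal (Real.exp (-(l * (θ ^ S *
          (z.1 ^ α * w.1 + z.2 ^ α * w.2))))) =
          ENNReal.ofReal (Real.exp (-(l * θ ^ S * z.1 ^ α * w.1))) *
            ENNReal.ofReal (Real.exp (-(l * θ ^ S * z.2 ^ α * w.2))) := by
        intro w
        rw [← ENNReal.ofReal_mul (Real.exp_pos _).le, ← Real.exp_add]
        congr 2
        ring
      simp only [e]
      rw [lintegral_prod_mul (f := fun x => ENNReal.ofReal (Real.exp (-(l * θ ^ S * z.1 ^ α * x))))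
        (g := fun x => ENNReal.ofReal (Real.exp (-(l * θ ^ S * z.2 ^ α * x))))
        (Measurable.aemeasurable (by fun_prop)) (Measurable.aemeasurable (by fun_prop))]

/-! ### General convergence lemmas -/

/-- Scheffé's lemma for non-negative functions. -/
lemma tendsto_eLpNorm_one_sub_of_tendsto_ae {Ω ι : Type*} [MeasurableSpace Ω] {P : Measure Ω}
    {l : Filter ι} [l.IsCountablyGenerated] {f : ι → Ω → ℝ} {g : Ω → ℝ}
    (hf : ∀ i, Measurable (f i)) (hg : Measurable g) (hf0 : ∀ i, 0 ≤ᵐ[P] f i) (hg0 : 0 ≤ᵐ[P] g)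
    (hfg : ∀ i, ∫⁻ ω, ENNReal.ofReal (f i ω) ∂P = ∫⁻ ω, ENNReal.ofReal (g ω) ∂P)
    (hfin : ∫⁻ ω, ENNReal.ofReal (g ω) ∂P ≠ ∞)
    (hlim : ∀ᵐ ω ∂P, Tendsto (fun i => f i ω) l (𝓝 (g ω))) :
    Tendsto (fun i => eLpNorm (fun ω => f i ω - g ω) 1 P) l (𝓝 0) := by
  have hB : Tendsto (fun i => ∫⁻ ω, ENNReal.ofReal (g ω - f i ω) ∂P) l (𝓝 (∫⁻ _, 0 ∂P)) := by
    refine tendsto_lintegral_filter_of_dominated_convergence (fun ω => ENNReal.ofReal (g ω))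
      (Eventually.of_forall fun i => (hg.sub (hf i)).ennreal_ofReal)
      (Eventually.of_forall fun i => ?_) hfin ?_
    · filter_upwards [hf0 i] with ω hω
      exact ENNReal.ofReal_le_ofReal (sub_le_self _ hω)
    · filter_upwards [hlim] with ω hω
      have h := (tendsto_const_nhds (x := g ω)).sub hω
      rw [sub_self] at h
      simpa using ENNReal.tendsto_ofReal h
  have hA : ∀ i, eLpNorm (fun ω => f i ω - g ω) 1 P =
      2 * ∫⁻ ω, ENNReal.ofReal (g ω - f i ω) ∂P := by
    intro i
    have hid : ∀ᵐ ω ∂P, ‖f i ω - g ω‖ₑ + ENNReal.ofReal (g ω) =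
        2 * ENNReal.ofReal (g ω - f i ω) + ENNReal.ofReal (f i ω) := by
      filter_upwards [hf0 i, hg0] with ω h1 h2
      rw [Real.enorm_eq_ofReal_abs, ← ENNReal.ofReal_add (abs_nonneg _) h2]
      rcases le_total (f i ω) (g ω) with h | h
      · rw [abs_of_nonpos (by linarith), show (2 : ℝ≥0∞) = ENNReal.ofReal 2 by simp,
          ← ENNReal.ofReal_mul (by norm_num), ← ENNReal.ofReal_add (by linarith) h1]
        congr 1
        ring
      · rw [abs_of_nonneg (by linarith), ENNReal.ofReal_of_nonpos (p := g ω - f i ω) (by linarith)]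
        simp
    have := lintegral_congr_ae hid
    rw [lintegral_add_right _ hg.ennreal_ofReal, lintegral_add_right _ (hf i).ennreal_ofReal,
      hfg i, lintegral_const_mul 2 (f := fun ω => ENNReal.ofReal (g ω - f i ω))
        (hg.sub (hf i)).ennreal_ofReal] at this
    rw [eLpNorm_one_eq_lintegral_enorm]
    exact (ENNReal.add_left_inj hfin).1 this
  simp_rw [hA]
  have := ENNReal.Tendsto.const_mul hB (Or.inr (by simp : (2 : ℝ≥0∞) ≠ ∞))
  simpa using this

/-- Convergence to `0` in measure from a moment bound. -/
lemma tendstoInMeasure_zero_of_rpow_le {Ω ι : Type*} [MeasurableSpace Ω] {P : Measure Ω}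
    {l : Filter ι} {f g : ι → Ω → ℝ} {s : ℝ} (hs : 0 < s) (hg : ∀ i, Measurable (g i))
    (hfg : ∀ i, ∀ᵐ ω ∂P, 0 ≤ f i ω ∧ f i ω ^ s ≤ g i ω)
    (hlim : Tendsto (fun i => ∫⁻ ω, ENNReal.ofReal (g i ω) ∂P) l (𝓝 0)) :
    TendstoInMeasure P f l fun _ => 0 := by
  rw [tendstoInMeasure_iff_norm]
  intro ε hε
  have hεs : 0 < ε ^ s := Real.rpow_pos_of_pos hε s
  have h := ENNReal.Tendsto.div_const hlim (b := ENNReal.ofReal (ε ^ s))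
    (Or.inr (by simpa using hεs))
  rw [ENNReal.zero_div] at h
  refine tendsto_of_tendsto_of_tendsto_of_le_of_le tendsto_const_nhds h (fun _ => bot_le) fun i => ?_
  refine le_trans (measure_mono_ae ?_) (meas_ge_le_lintegral_div (hg i).ennreal_ofReal.aemeasurable
    (by simpa using hεs) ENNReal.ofReal_ne_top)
  filter_upwards [hfg i] with ω hω hε'
  have hε'' : ε ≤ ‖f i ω - 0‖ := hε'
  rw [sub_zero, Real.norm_of_nonneg hω.1] at hε''
  exact ENNReal.ofReal_le_ofReal ((Real.rpow_le_rpow hε.le hε'' hs.le).trans hω.2)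

/-! ### The spectral function -/

section spectral
variable {Ω : Type*} [MeasurableSpace Ω] {P : Measure Ω} {L R : Ω → ℝ}

lemma exists_moment_of_spectralFn_lt_top {s : ℝ} (hs : 0 < s) (hLm : Measurable L)
    (hRm : Measurable R) (hL : 0 ≤ᵐ[P] L) (hR : 0 ≤ᵐ[P] R)
    (hLR : 1 < P {ω | 0 < L ω} + P {ω | 0 < R ω}) (h : spectralFn P L R s < ⊤) :
    ∃ S : ℝ, -1 < S ∧ collisionS P L R s = S ∧ spectralFn P L R s = ((S / s : ℝ) : EReal) ∧
      ∫⁻ z, ENNReal.ofReal (z.1 ^ s + z.2 ^ s) ∂(P.map fun ω => (L ω, R ω)) =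
        ENNReal.ofReal (S + 1) := by
  set m := ∫⁻ ω, ENNReal.ofReal (L ω ^ s + R ω ^ s) ∂P with hm
  have hmtop : m ≠ ∞ := by
    intro hmt
    refine h.ne ?_
    rw [spectralFn, collisionS, ← hm, hmt, EReal.coe_ennreal_top,
      show (1 : EReal) = ((1 : ℝ) : EReal) from rfl, EReal.top_sub_coe]
    exact EReal.top_div_of_pos_ne_top (by exact_mod_cast hs) (EReal.coe_ne_top s)
  have hm0 : m ≠ 0 := by
    intro hm0
    have hae := (lintegral_eq_zero_iff (by fun_prop)).1 hm0
    have hz : ∀ᵐ ω ∂P, ¬ 0 < L ω ∧ ¬ 0 < R ω := by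
      filter_upwards [hae, hL, hR] with ω h0 h1 h2
      have h0' : L ω ^ s + R ω ^ s ≤ 0 := by simpa using h0
      have h1' := Real.rpow_nonneg h1 s
      have h2' := Real.rpow_nonneg h2 s
      constructor <;> intro h3
      · have := Real.rpow_pos_of_pos h3 s
        simp only [Pi.zero_apply] at *
        linarith
      · have := Real.rpow_pos_of_pos h3 s
        simp only [Pi.zero_apply] at *
        linarith
    have e1 : P {ω | 0 < L ω} = 0 := by
      simpa using ae_iff.1 (hz.mono fun ω hω => hω.1)
    have e2 : P {ω | 0 < R ω} = 0 := by
      simpa using ae_iff.1 (hz.mono fun ω hω => hω.2)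
    simp [e1, e2] at hLR
  have hcoll : collisionS P L R s = ((m.toReal - 1 : ℝ) : EReal) := by
    rw [collisionS, ← hm, ← EReal.coe_ennreal_toReal hmtop]
    norm_cast
  refine ⟨m.toReal - 1, ?_, hcoll, ?_, ?_⟩
  · have := ENNReal.toReal_pos hm0 hmtop
    linarith
  · rw [spectralFn, hcoll]
    norm_cast
  · rw [lintegral_map (by fun_prop) (hLm.prodMk hRm), sub_add_cancel, ENNReal.ofReal_toReal hmtop]

end spectral

/-! ### Sampling along an independent Yule process -/

section yule
variable {Ω : Type*} [MeasurableSpace Ω] {P : Measure Ω} {ν : ℝ≥0 → Ω → ℕ}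

lemma measurable_comp_natCast_index {E : Type*} [MeasurableSpace E] {g : ℕ → Ω → E}
    (hg : ∀ n, Measurable (g n)) {N : Ω → ℕ} (hN : Measurable N) :
    Measurable fun ω => g (N ω) ω :=
  (measurable_from_prod_countable_right (f := fun q : ℕ × Ω => g q.1 q.2) hg).comp
    (hN.prodMk measurable_id)

lemma IsYuleProcess.lintegral_comp_of_indepFun [IsProbabilityMeasure P] (hν : IsYuleProcess P ν)
    {E : Type*} [MeasurableSpace E] {X : Ω → E} (hX : Measurable X)
    (h : IndepFun (fun (ω : Ω) (t : ℝ≥0) => ν t ω) X P) {g : ℕ → E → ℝ≥0∞}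
    (hg : ∀ n, Measurable (g n)) (t : ℝ≥0) :
    ∫⁻ ω, g (ν t ω) (X ω) ∂P = ∑' n : ℕ,
      ENNReal.ofReal (Real.exp (-t) * (1 - Real.exp (-t)) ^ n) * ∫⁻ ω, g (n + 1) (X ω) ∂P := by
  have hms : ∀ n : ℕ, MeasurableSet {ω | ν t ω = n + 1} := fun n =>
    hν.measurable t (measurableSet_singleton (n + 1))
  have hae : ∀ᵐ ω ∂P, g (ν t ω) (X ω) =
      ∑' n : ℕ, {ω | ν t ω = n + 1}.indicator 1 ω * g (n + 1) (X ω) := by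
    filter_upwards [hν.ae_exists_tendsto] with ω hω
    obtain ⟨k, hk⟩ : ∃ k, ν t ω = k + 1 := ⟨ν t ω - 1, by have := hω.1 t; omega⟩
    rw [tsum_eq_single k fun n hn => by
      rw [Set.indicator_of_notMem (fun h0 : ω ∈ {ω | ν t ω = n + 1} =>
        hn (by have h1 : ν t ω = n + 1 := h0; omega)), zero_mul]]
    rw [Set.indicator_of_mem (by exact hk), hk]
    simp
  have hgX : ∀ n, Measurable fun ω => g n (X ω) := fun n => (hg n).comp hX
  rw [lintegral_congr_ae hae, lintegral_tsum fun n =>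
    ((measurable_one.indicator (hms n)).fun_mul (hgX (n + 1))).aemeasurable]
  refine tsum_congr fun n => ?_
  have hi : IndepFun (fun ω => {ω | ν t ω = n + 1}.indicator (1 : Ω → ℝ≥0∞) ω)
      (fun ω => g (n + 1) (X ω)) P := by
    have hφ : Measurable (fun x : ℝ≥0 → ℕ => if x t = n + 1 then (1 : ℝ≥0∞) else 0) :=
      Measurable.ite (measurableSet_eq_fun (measurable_pi_apply t) measurable_const) measurable_const
        measurable_const
    refine (h.comp hφ (hg (n + 1))).congr (Eventually.of_forall fun ω => ?_) EventuallyEq.rfl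
    simp only [Function.comp_apply, Set.indicator_apply, Set.mem_ofPred_eq, Pi.one_apply]
  rw [lintegral_mul_eq_lintegral_mul_lintegral_of_indepFun''
    (measurable_one.indicator (hms n)).aemeasurable (hgX _).aemeasurable hi,
    lintegral_indicator_one (hms n), hν.measure_eq]

/-- The weight sum as a function of the triangular array of weights. -/
noncomputable def arraySum (s : ℝ) (n : ℕ) (x : {p : ℕ × ℕ // 1 ≤ p.2 ∧ p.2 ≤ p.1} → ℝ) : ℝ :=
  ∑ j ∈ (Finset.Icc 1 n).attach, x ⟨(n, j), Finset.mem_Icc.1 j.2⟩ ^ s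

lemma measurable_arraySum (s : ℝ) (n : ℕ) : Measurable (arraySum s n) :=
  Finset.measurable_fun_sum _ fun _ _ => (measurable_pi_apply _).pow_const _

lemma arraySum_apply {Ω : Type*} (β : ℕ → ℕ → Ω → ℝ) (s : ℝ) (n : ℕ) (ω : Ω) :
    arraySum s n (fun p => β p.1.1 p.1.2 ω) = weightSum β s n ω :=
  Finset.sum_attach (Finset.Icc 1 n) fun j => β n j ω ^ s

lemma indepFun_normalizedLimit {β : ℕ → ℕ → Ω → ℝ}
    (h : IndepFun (fun (ω : Ω) (t : ℝ≥0) => ν t ω)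
      (fun (ω : Ω) (p : {p : ℕ × ℕ // 1 ≤ p.2 ∧ p.2 ≤ p.1}) => β p.1.1 p.1.2 ω) P)
    {f : (ℝ≥0 → ℕ) → ℝ} (hf : Measurable f) (α S : ℝ) :
    IndepFun (fun ω => f fun t => ν t ω) (normalizedLimit β α S) P := by
  have hm : Measurable fun x => limUnder atTop fun n : ℕ => arraySum α n x / gammaRatio S n :=
    (StronglyMeasurable.limUnder fun n =>
      ((measurable_arraySum α n).div_const _).stronglyMeasurable).measurable
  have := h.comp hf hm
  refine this.congr EventuallyEq.rfl (Eventually.of_forall fun ω => ?_)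
  simp only [Function.comp_apply, normalizedLimit, arraySum_apply]

variable [IsProbabilityMeasure P] {L R : Ω → ℝ} {Ls Rs : ℕ → Ω → ℝ} {I : ℕ → Ω → ℕ}

lemma IsYuleProcess.lintegral_weightSum (hν : IsYuleProcess P ν)
    (h : IsCollisionSequence P L R Ls Rs I)
    (hνβ : IndepFun (fun (ω : Ω) (t : ℝ≥0) => ν t ω)
      (fun (ω : Ω) (p : {p : ℕ × ℕ // 1 ≤ p.2 ∧ p.2 ≤ p.1}) =>
        splitWeight Ls Rs I p.1.1 p.1.2 ω) P) (s : ℝ) {g : ℕ → ℝ → ℝ≥0∞}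
    (hg : ∀ n, Measurable (g n)) (t : ℝ≥0) :
    ∫⁻ ω, g (ν t ω) (weightSum (splitWeight Ls Rs I) s (ν t ω) ω) ∂P =
      ∑' n : ℕ, ENNReal.ofReal (Real.exp (-t) * (1 - Real.exp (-t)) ^ n) *
        ∫⁻ ω, g (n + 1) (weightSum (splitWeight Ls Rs I) s (n + 1) ω) ∂P := by
  have hX : Measurable fun (ω : Ω) (p : {p : ℕ × ℕ // 1 ≤ p.2 ∧ p.2 ≤ p.1}) =>
      splitWeight Ls Rs I p.1.1 p.1.2 ω := measurable_pi_lambda _ fun p => h.measurable_weight _ _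
  have := hν.lintegral_comp_of_indepFun hX hνβ (g := fun n x => g n (arraySum s n x))
    (fun n => (hg n).comp (measurable_arraySum s n)) t
  simpa only [arraySum_apply] using this

lemma IsYuleProcess.lintegral_ofReal_weightSum (hν : IsYuleProcess P ν)
    (h : IsCollisionSequence P L R Ls Rs I) (hLm : Measurable L)
    (hRm : Measurable R) (hL : 0 ≤ᵐ[P] L) (hR : 0 ≤ᵐ[P] R)
    (hνβ : IndepFun (fun (ω : Ω) (t : ℝ≥0) => ν t ω)
      (fun (ω : Ω) (p : {p : ℕ × ℕ // 1 ≤ p.2 ∧ p.2 ≤ p.1}) =>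
        splitWeight Ls Rs I p.1.1 p.1.2 ω) P) {s S : ℝ} (hS : -1 < S)
    (hmom : ∫⁻ z, ENNReal.ofReal (z.1 ^ s + z.2 ^ s) ∂(P.map fun ω => (L ω, R ω)) =
      ENNReal.ofReal (S + 1)) {c : ℝ} (hc : 0 ≤ c) (t : ℝ≥0) :
    ∫⁻ ω, ENNReal.ofReal (c * weightSum (splitWeight Ls Rs I) s (ν t ω) ω) ∂P =
      ENNReal.ofReal (c * Real.exp (S * t)) := by
  simp_rw [ENNReal.ofReal_mul hc]
  have hm := measurable_comp_natCast_index (fun n => h.measurable_weightSum s n) (hν.measurable t)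
  rw [lintegral_const_mul _ hm.ennreal_ofReal,
    hν.lintegral_weightSum h hνβ s (g := fun _ x => ENNReal.ofReal x) (fun n => by fun_prop) t]
  simp_rw [h.lintegral_weightSum hLm hRm hL hR hS hmom]
  rw [tsum_geometric_mul_gammaRatio hS (Real.exp_pos _) (by simp), ← Real.exp_mul]
  congr 3
  ring

lemma IsYuleProcess.lintegral_exp_weightSum (hν : IsYuleProcess P ν)
    (h : IsCollisionSequence P L R Ls Rs I)
    (hνβ : IndepFun (fun (ω : Ω) (t : ℝ≥0) => ν t ω)
      (fun (ω : Ω) (p : {p : ℕ × ℕ // 1 ≤ p.2 ∧ p.2 ≤ p.1}) =>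
        splitWeight Ls Rs I p.1.1 p.1.2 ω) P) (s l : ℝ) (t : ℝ≥0) :
    ∫⁻ ω, ENNReal.ofReal (Real.exp (-(l * weightSum (splitWeight Ls Rs I) s (ν t ω) ω))) ∂P =
      geometricMix (weightSumLaplace P (splitWeight Ls Rs I) s) (Real.exp (-t)) l :=
  hν.lintegral_weightSum h hνβ s (g := fun _ x => ENNReal.ofReal (Real.exp (-(l * x))))
    (fun n => by fun_prop) t

end yule

/-! ### Asymptotics along the Yule process -/

lemma tendsto_gammaRatio_mul_exp {S E : ℝ} (hS : -1 < S) (hE : 0 < E) {n : ℝ≥0 → ℕ}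
    (hn : Tendsto n atTop atTop)
    (hlim : Tendsto (fun t : ℝ≥0 => Real.exp (-t) * n t) atTop (𝓝 E)) :
    Tendsto (fun t : ℝ≥0 => gammaRatio S (n t) * Real.exp (-S * t)) atTop
      (𝓝 (E ^ S / Real.Gamma (S + 1))) := by
  have h1 := (tendsto_gammaRatio_div_rpow hS).comp hn
  have h2 := hlim.rpow_const (p := S) (Or.inl hE.ne')
  have h3 := h1.mul h2
  rw [one_div, inv_mul_eq_div] at h3
  refine h3.congr' ?_
  filter_upwards [hn.eventually_ge_atTop 1] with t ht
  have hn0 : (0 : ℝ) < n t := by exact_mod_cast ht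
  simp only [Function.comp_apply]
  rw [Real.mul_rpow (Real.exp_pos _).le hn0.le, ← Real.exp_mul]
  have : 0 < (n t : ℝ) ^ S := by positivity
  have e : -(t : ℝ) * S = -S * t := by ring
  rw [e]
  field_simp

lemma ProbabilityTheory.HasLaw.lintegral_rpow_exp {Ω : Type*} [MeasurableSpace Ω] {P : Measure Ω}
    {E : Ω → ℝ} (hE : HasLaw E (expMeasure 1) P) {s : ℝ} (hs : -1 < s) :
    ∫⁻ ω, ENNReal.ofReal (E ω ^ s) ∂P = ENNReal.ofReal (Real.Gamma (s + 1)) := by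
  have hm : Measurable fun x : ℝ => ENNReal.ofReal (x ^ s) := by fun_prop
  rw [← lintegral_map' (f := fun x => ENNReal.ofReal (x ^ s)) hm.aemeasurable hE.aemeasurable,
    hE.map_eq, lintegral_expMeasure 1 hm, setLIntegral_congr Ioi_ae_eq_Ici.symm]
  have := lintegral_rpow_mul_exp_neg_mul (a := s + 1) (r := 1) (by linarith) one_pos
  rw [div_one, Real.one_rpow, one_mul] at this
  rw [← this]
  refine setLIntegral_congr_fun measurableSet_Ioi fun x hx => ?_
  rw [← ENNReal.ofReal_mul (by positivity), add_sub_cancel_right]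
  congr 1
  ring

lemma ProbabilityTheory.HasLaw.ae_pos_of_exp {Ω : Type*} [MeasurableSpace Ω] {P : Measure Ω}
    {E : Ω → ℝ} (hE : HasLaw E (expMeasure 1) P) : ∀ᵐ ω ∂P, 0 < E ω := by
  refine (ae_map_iff hE.aemeasurable (measurableSet_Ioi (a := (0 : ℝ)))).1 ?_
  rw [hE.map_eq, ae_iff, ← lintegral_indicator_one (by measurability), lintegral_expMeasure 1
    (measurable_one.indicator (by measurability)), ← setLIntegral_congr Ioi_ae_eq_Ici]
  refine (setLIntegral_congr_fun measurableSet_Ioi fun x hx => ?_).trans lintegral_zero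
  rw [Set.indicator_of_notMem (by simpa using hx), mul_zero]

/-! ### The largest weight -/

lemma maxWeight_rpow_le {Ω : Type*} {β : ℕ → ℕ → Ω → ℝ} {n : ℕ} (hn : 1 ≤ n) {ω : Ω}
    (hβ : ∀ j, 0 ≤ β n j ω) (s : ℝ) :
    0 ≤ maxWeight β n ω ∧ maxWeight β n ω ^ s ≤ weightSum β s n ω := by
  have hne : ((fun j => β n j ω) '' Set.Icc 1 n).Nonempty := ⟨_, 1, ⟨le_rfl, hn⟩, rfl⟩
  obtain ⟨j, hj, hj'⟩ := hne.csSup_mem ((Set.finite_Icc 1 n).image _)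
  have e : maxWeight β n ω = β n j ω := hj'.symm
  rw [e]
  exact ⟨hβ j, Finset.single_le_sum (f := fun j => β n j ω ^ s)
    (fun k _ => Real.rpow_nonneg (hβ k) s) (Finset.mem_Icc.2 hj)⟩

lemma exists_gammaRatio_le_mul_gammaRatio {p S S' : ℝ} (hS : -1 < S) (hS' : -1 < S')
    (hSS : S' < p * S) (hp : 0 < p) :
    ∃ ε C : ℝ, 0 < ε ∧ ε < 1 ∧ 0 ≤ C ∧ ∀ n : ℕ, 1 ≤ n →
      gammaRatio S' n / gammaRatio S n ^ p ≤ C * gammaRatio (-ε) n := by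
  set ε := min (1 / 2) (p * S - S') with hε
  have hε0 : 0 < ε := lt_min (by norm_num) (by linarith)
  have hε1 : ε < 1 := (min_le_left _ _).trans_lt (by norm_num)
  obtain ⟨c, _, hc, _, h1⟩ := exists_gammaRatio_bounds hS
  obtain ⟨_, C', _, hC', h2⟩ := exists_gammaRatio_bounds hS'
  obtain ⟨c'', _, hc'', _, h3⟩ := exists_gammaRatio_bounds (S := -ε) (by linarith)
  refine ⟨ε, C' / c ^ p / c'', hε0, hε1, by positivity, fun n hn => ?_⟩
  have hn1 : (1 : ℝ) ≤ n := by exact_mod_cast hn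
  have hn0 : (0 : ℝ) < n := by linarith
  calc gammaRatio S' n / gammaRatio S n ^ p
      ≤ (C' * (n : ℝ) ^ S') / (c * (n : ℝ) ^ S) ^ p := by
        refine div_le_div₀ (by positivity) (h2 n hn).2 (by positivity) ?_
        exact Real.rpow_le_rpow (by positivity) (h1 n hn).1 hp.le
    _ = C' / c ^ p * (n : ℝ) ^ (S' - p * S) := by
        rw [Real.mul_rpow hc.le (by positivity), ← Real.rpow_mul hn0.le, Real.rpow_sub hn0,
          mul_comm S p]
        field_simp
    _ ≤ C' / c ^ p * (n : ℝ) ^ (-ε) := by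
        refine mul_le_mul_of_nonneg_left (Real.rpow_le_rpow_of_exponent_le hn1 ?_) (by positivity)
        linarith [min_le_right (1 / 2) (p * S - S')]
    _ = C' / c ^ p / c'' * (c'' * (n : ℝ) ^ (-ε)) := by field_simp
    _ ≤ _ := mul_le_mul_of_nonneg_left (h3 n hn).1 (by positivity)

lemma lintegral_rpow_mul_of_indepFun {Ω : Type*} [MeasurableSpace Ω] {P : Measure Ω}
    {E N : Ω → ℝ} (hEm : Measurable E) (hE : HasLaw E (expMeasure 1) P) (hNm : Measurable N)
    (hN : 0 ≤ᵐ[P] N) (hind : IndepFun E N P) {p S : ℝ} (hS : -1 < p * S) :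
    ∫⁻ ω, ENNReal.ofReal ((E ω ^ S * N ω) ^ p) ∂P =
      ENNReal.ofReal (Real.Gamma (p * S + 1)) * ∫⁻ ω, ENNReal.ofReal (N ω ^ p) ∂P := by
  have h1 : ∀ᵐ ω ∂P, ENNReal.ofReal ((E ω ^ S * N ω) ^ p) =
      ENNReal.ofReal (E ω ^ (p * S)) * ENNReal.ofReal (N ω ^ p) := by
    filter_upwards [hE.ae_pos_of_exp, hN] with ω hEω hNω
    rw [← ENNReal.ofReal_mul (by positivity), Real.mul_rpow (by positivity) hNω,
      ← Real.rpow_mul hEω.le, mul_comm S p]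
  rw [lintegral_congr_ae h1, lintegral_mul_eq_lintegral_mul_lintegral_of_indepFun''
    (f := fun ω => ENNReal.ofReal (E ω ^ (p * S))) (g := fun ω => ENNReal.ofReal (N ω ^ p))
    (by fun_prop) (by fun_prop), hE.lintegral_rpow_exp hS]
  exact hind.comp (φ := fun x => ENNReal.ofReal (x ^ (p * S)))
    (ψ := fun x => ENNReal.ofReal (x ^ p)) (by fun_prop) (by fun_prop)

section
variable {Ω : Type*} [MeasurableSpace Ω] {P : Measure Ω} [IsProbabilityMeasure P]
  {L R : Ω → ℝ} {Ls Rs : ℕ → Ω → ℝ} {I : ℕ → Ω → ℕ} {ν : ℝ≥0 → Ω → ℕ}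

lemma IsYuleProcess.solvesFixedPoint (hν : IsYuleProcess P ν)
    (h : IsCollisionSequence P L R Ls Rs I) (hLm : Measurable L)
    (hRm : Measurable R) (hL : 0 ≤ᵐ[P] L) (hR : 0 ≤ᵐ[P] R)
    (hνβ : IndepFun (fun (ω : Ω) (t : ℝ≥0) => ν t ω)
      (fun (ω : Ω) (p : {p : ℕ × ℕ // 1 ≤ p.2 ∧ p.2 ≤ p.1}) =>
        splitWeight Ls Rs I p.1.1 p.1.2 ω) P) {α S : ℝ} {Z : Ω → ℝ} (hZm : Measurable Z)
    (hZ : 0 ≤ᵐ[P] Z) (hlim : ∀ᵐ ω ∂P, Tendsto (fun t : ℝ≥0 =>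
      Real.exp (-S * t) * weightSum (splitWeight Ls Rs I) α (ν t ω) ω) atTop (𝓝 (Z ω))) :
    SolvesFixedPoint (P.map fun ω => (L ω, R ω)) α S (P.map Z) := by
  have := Measure.isProbabilityMeasure_map (μ := P) (hLm.prodMk hRm).aemeasurable
  have := Measure.isProbabilityMeasure_map (μ := P) hZm.aemeasurable
  have hnn := h.ae_weightSum_nonneg hLm hRm hL hR α
  refine solvesFixedPoint_of_tendsto (f := weightSumLaplace P (splitWeight Ls Rs I) α)
    (ae_map_nonneg hLm hRm hL hR) h.measurable_weightSumLaplace (fun n l hl => ?_)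
    (h.weightSumLaplace_succ hLm hRm hL hR)
    ((ae_map_iff hZm.aemeasurable measurableSet_Ici).2 hZ) fun l hl => ?_
  · calc ∫⁻ ω, ENNReal.ofReal (Real.exp (-(l * weightSum (splitWeight Ls Rs I) α (n + 1) ω))) ∂P
        ≤ ∫⁻ _, 1 ∂P := by
          refine lintegral_mono_ae ?_
          filter_upwards [hnn] with ω hω
          rw [← ENNReal.ofReal_one]
          refine ENNReal.ofReal_le_ofReal (Real.exp_le_one_iff.2 ?_)
          have := mul_nonneg hl (hω (n + 1))
          linarith
      _ = 1 := by simp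
  · rw [lintegral_map (by fun_prop) hZm]
    have hm := fun t => measurable_comp_natCast_index (fun n => h.measurable_weightSum α n)
      (hν.measurable t)
    have hT : Tendsto (fun t : ℝ≥0 => ∫⁻ ω, ENNReal.ofReal (Real.exp (-(l * Real.exp (-S * t) *
        weightSum (splitWeight Ls Rs I) α (ν t ω) ω))) ∂P) atTop
        (𝓝 (∫⁻ ω, ENNReal.ofReal (Real.exp (-(l * Z ω))) ∂P)) := by
      refine tendsto_lintegral_filter_of_dominated_convergence (fun _ => 1)
        (Eventually.of_forall fun t => ?_) (Eventually.of_forall fun t => ?_) (by simp) ?_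
      · have := hm t
        fun_prop
      · filter_upwards [hnn] with ω hω
        rw [← ENNReal.ofReal_one]
        refine ENNReal.ofReal_le_ofReal (Real.exp_le_one_iff.2 ?_)
        have := mul_nonneg (mul_nonneg hl (Real.exp_pos (-S * t)).le) (hω (ν t ω))
        linarith
      · filter_upwards [hlim] with ω hω
        refine ENNReal.tendsto_ofReal ((Real.continuous_exp.tendsto _).comp ?_)
        simpa only [mul_assoc] using (hω.const_mul l).neg
    have hlog : Tendsto (fun y : ℝ => (-Real.log y).toNNReal) (𝓝[>] 0) atTop :=
      tendsto_real_toNNReal_atTop.comp (tendsto_neg_atBot_atTop.comp Real.tendsto_log_nhdsGT_zero)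
    refine (hT.comp hlog).congr' ?_
    have hlt : ∀ᶠ y in 𝓝[>] (0 : ℝ), y < 1 := nhdsWithin_le_nhds (Iio_mem_nhds one_pos)
    filter_upwards [self_mem_nhdsWithin, hlt] with y hy hy1
    have hy0 : (0 : ℝ) < y := hy
    have hc : ((-Real.log y).toNNReal : ℝ) = -Real.log y :=
      Real.coe_toNNReal _ (by linarith [Real.log_neg hy0 hy1])
    simp only [Function.comp_apply]
    rw [hν.lintegral_exp_weightSum h hνβ, hc, neg_neg, neg_mul_neg, Real.exp_log hy0, mul_comm S,
      ← Real.rpow_def_of_pos hy0]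

lemma IsYuleProcess.tendstoInMeasure_maxWeight_mul_exp (hν : IsYuleProcess P ν)
    (h : IsCollisionSequence P L R Ls Rs I) (hLm : Measurable L)
    (hRm : Measurable R) (hL : 0 ≤ᵐ[P] L) (hR : 0 ≤ᵐ[P] R)
    (hνβ : IndepFun (fun (ω : Ω) (t : ℝ≥0) => ν t ω)
      (fun (ω : Ω) (p : {p : ℕ × ℕ // 1 ≤ p.2 ∧ p.2 ≤ p.1}) =>
        splitWeight Ls Rs I p.1.1 p.1.2 ω) P) {s S μ : ℝ} (hs : 0 < s) (hS : -1 < S)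
    (hμ : S < μ * s)
    (hmom : ∫⁻ z, ENNReal.ofReal (z.1 ^ s + z.2 ^ s) ∂(P.map fun ω => (L ω, R ω)) =
      ENNReal.ofReal (S + 1)) :
    TendstoInMeasure P (fun (t : ℝ≥0) ω =>
      maxWeight (splitWeight Ls Rs I) (ν t ω) ω * Real.exp (-μ * t)) atTop fun _ => 0 := by
  refine tendstoInMeasure_zero_of_rpow_le hs
    (g := fun t ω => Real.exp (-(μ * s) * t) * weightSum (splitWeight Ls Rs I) s (ν t ω) ω)
    (fun t => (measurable_comp_natCast_index (fun n => h.measurable_weightSum s n)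
      (hν.measurable t)).const_mul _) (fun t => ?_) ?_
  · filter_upwards [hν.ae_exists_tendsto, h.ae_splitWeight_nonneg hLm hRm hL hR] with ω h1 h2
    have h3 := maxWeight_rpow_le (h1.1 t) (h2 (ν t ω)) s
    refine ⟨mul_nonneg h3.1 (Real.exp_pos _).le, ?_⟩
    rw [Real.mul_rpow h3.1 (Real.exp_pos _).le, ← Real.exp_mul, mul_comm,
      show -μ * (t : ℝ) * s = -(μ * s) * t by ring]
    exact mul_le_mul_of_nonneg_left h3.2 (Real.exp_pos _).le
  · simp_rw [hν.lintegral_ofReal_weightSum h hLm hRm hL hR hνβ hS hmom (Real.exp_pos _).le,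
      ← Real.exp_add]
    rw [← ENNReal.ofReal_zero]
    refine ENNReal.tendsto_ofReal (Real.tendsto_exp_atBot.comp ?_)
    have ht : Tendsto (fun t : ℝ≥0 => (S - μ * s) * (t : ℝ)) atTop atBot :=
      (NNReal.tendsto_coe_atTop.2 tendsto_id).const_mul_atTop_of_neg (by linarith)
    refine ht.congr fun t => ?_
    ring

lemma IsYuleProcess.tendstoInMeasure_maxWeight_div (hν : IsYuleProcess P ν)
    (h : IsCollisionSequence P L R Ls Rs I) (hLm : Measurable L)
    (hRm : Measurable R) (hL : 0 ≤ᵐ[P] L) (hR : 0 ≤ᵐ[P] R)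
    (hνβ : IndepFun (fun (ω : Ω) (t : ℝ≥0) => ν t ω)
      (fun (ω : Ω) (p : {p : ℕ × ℕ // 1 ≤ p.2 ∧ p.2 ≤ p.1}) =>
        splitWeight Ls Rs I p.1.1 p.1.2 ω) P) {α δ S S' : ℝ} (hα : 0 < α) (hδ : 0 < δ)
    (hS : -1 < S) (hS' : -1 < S') (hSS : S' < δ / α * S)
    (hmom : ∫⁻ z, ENNReal.ofReal (z.1 ^ δ + z.2 ^ δ) ∂(P.map fun ω => (L ω, R ω)) =
      ENNReal.ofReal (S' + 1)) :
    TendstoInMeasure P (fun (t : ℝ≥0) ω =>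
      maxWeight (splitWeight Ls Rs I) (ν t ω) ω / gammaRatio S (ν t ω) ^ (1 / α)) atTop
      fun _ => 0 := by
  refine tendstoInMeasure_zero_of_rpow_le hδ
    (g := fun t ω => weightSum (splitWeight Ls Rs I) δ (ν t ω) ω / gammaRatio S (ν t ω) ^ (δ / α))
    (fun t => measurable_comp_natCast_index (g := fun n ω =>
      weightSum (splitWeight Ls Rs I) δ n ω / gammaRatio S n ^ (δ / α))
      (fun n => (h.measurable_weightSum δ n).div_const _) (hν.measurable t)) (fun t => ?_) ?_
  · filter_upwards [hν.ae_exists_tendsto, h.ae_splitWeight_nonneg hLm hRm hL hR] with ω h1 h2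
    have h3 := maxWeight_rpow_le (h1.1 t) (h2 (ν t ω)) δ
    have hm := gammaRatio_pos hS (h1.1 t)
    have hm' := Real.rpow_pos_of_pos hm (1 / α)
    refine ⟨div_nonneg h3.1 hm'.le, ?_⟩
    rw [Real.div_rpow h3.1 hm'.le, ← Real.rpow_mul hm.le, one_div_mul_eq_div]
    exact div_le_div_of_nonneg_right h3.2 (Real.rpow_pos_of_pos hm _).le
  · obtain ⟨ε, C, hε, hε1, hC, hle⟩ := exists_gammaRatio_le_mul_gammaRatio hS hS' hSS
      (div_pos hδ hα)
    have hbound : ∀ t : ℝ≥0, ∫⁻ ω, ENNReal.ofReal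
        (weightSum (splitWeight Ls Rs I) δ (ν t ω) ω / gammaRatio S (ν t ω) ^ (δ / α)) ∂P ≤
        ENNReal.ofReal (C * Real.exp (-ε * t)) := by
      intro t
      rw [hν.lintegral_weightSum h hνβ δ
        (g := fun n x => ENNReal.ofReal (x / gammaRatio S n ^ (δ / α))) (fun n => by fun_prop) t]
      have hterm : ∀ n : ℕ, ∫⁻ ω, ENNReal.ofReal (weightSum (splitWeight Ls Rs I) δ (n + 1) ω /
          gammaRatio S (n + 1) ^ (δ / α)) ∂P ≤
          ENNReal.ofReal C * ENNReal.ofReal (gammaRatio (-ε) (n + 1)) := by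
        intro n
        have hm := Real.rpow_pos_of_pos (gammaRatio_pos hS (n := n + 1) (by omega)) (δ / α)
        simp_rw [div_eq_inv_mul (weightSum _ _ _ _), ENNReal.ofReal_mul (inv_nonneg.2 hm.le)]
        rw [lintegral_const_mul _ (h.measurable_weightSum δ (n + 1)).ennreal_ofReal,
          h.lintegral_weightSum hLm hRm hL hR hS' hmom, ← ENNReal.ofReal_mul (inv_nonneg.2 hm.le),
          ← ENNReal.ofReal_mul hC, ← div_eq_inv_mul]
        exact ENNReal.ofReal_le_ofReal (hle (n + 1) (by omega))
      refine (ENNReal.tsum_le_tsum fun n => mul_le_mul_right (hterm n) _).trans_eq ?_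
      simp_rw [mul_left_comm _ (ENNReal.ofReal C)]
      rw [ENNReal.tsum_mul_left, tsum_geometric_mul_gammaRatio (by linarith) (Real.exp_pos _)
        (by simp), ← ENNReal.ofReal_mul hC, ← Real.exp_mul]
      congr 3
      ring
    refine tendsto_of_tendsto_of_tendsto_of_le_of_le tendsto_const_nhds ?_ (fun _ => bot_le) hbound
    rw [← ENNReal.ofReal_zero]
    refine ENNReal.tendsto_ofReal ?_
    have ht : Tendsto (fun t : ℝ≥0 => -ε * (t : ℝ)) atTop atBot :=
      (NNReal.tendsto_coe_atTop.2 tendsto_id).const_mul_atTop_of_neg (by linarith)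
    simpa using (Real.tendsto_exp_atBot.comp ht).const_mul C

end

theorem mainTheorem7 {Ω : Type*} [MeasurableSpace Ω] (P : Measure Ω) [IsProbabilityMeasure P]
    (L R : Ω → ℝ) (hLm : Measurable L) (hRm : Measurable R)
    (hL : 0 ≤ᵐ[P] L) (hR : 0 ≤ᵐ[P] R)
    (hLR : 1 < P {ω | 0 < L ω} + P {ω | 0 < R ω})
    (Ls Rs : ℕ → Ω → ℝ) (I : ℕ → Ω → ℕ) (hcoll : IsCollisionSequence P L R Ls Rs I)
    (β : ℕ → ℕ → Ω → ℝ) (hβ : β = splitWeight Ls Rs I)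
    (ν : ℝ≥0 → Ω → ℕ) (hν : IsYuleProcess P ν)
    (hνβ : IndepFun (fun (ω : Ω) (t : ℝ≥0) => ν t ω)
      (fun (ω : Ω) (p : {p : ℕ × ℕ // 1 ≤ p.2 ∧ p.2 ≤ p.1}) => β p.1.1 p.1.2 ω) P)
    (α δ : ℝ) (hα : 0 < α) (hδ : α < δ)
    (hδα : spectralFn P L R δ < spectralFn P L R α) (hα' : spectralFn P L R α < ⊤)
    (S μ : ℝ) (hS : S = (collisionS P L R α).toReal) (hμ : μ = (spectralFn P L R α).toReal) :
    (∀ᵐ ω ∂P, Tendsto (fun n : ℕ => weightSum β α n ω / gammaRatio S n) atTop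
      (𝓝 (normalizedLimit β α S ω))) ∧
    ∃ E Z : Ω → ℝ,
      Measurable E ∧ HasLaw E (expMeasure 1) P ∧
      IndepFun E (normalizedLimit β α S) P ∧
      (∀ ω, Z ω = E ω ^ S * normalizedLimit β α S ω / Real.Gamma (S + 1)) ∧
      (∀ᵐ ω ∂P, Tendsto (fun t : ℝ≥0 => gammaRatio S (ν t ω) * Real.exp (-S * t)) atTop
        (𝓝 (E ω ^ S / Real.Gamma (S + 1)))) ∧
      (∀ᵐ ω ∂P, Tendsto (fun t : ℝ≥0 => Real.exp (-S * t) * weightSum β α (ν t ω) ω) atTop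
        (𝓝 (Z ω))) ∧
      (∀ t : ℝ≥0, Integrable (fun ω => Real.exp (-S * t) * weightSum β α (ν t ω) ω) P) ∧
      Integrable Z P ∧
      Tendsto (fun t : ℝ≥0 =>
        eLpNorm (fun ω => Real.exp (-S * t) * weightSum β α (ν t ω) ω - Z ω) 1 P) atTop (𝓝 0) ∧
      (∀ t : ℝ≥0, ∫ ω, Real.exp (-S * t) * weightSum β α (ν t ω) ω ∂P = 1) ∧
      ∫ ω, Z ω ∂P = 1 ∧
      SolvesFixedPoint (P.map (fun ω => (L ω, R ω))) α S (P.map Z) ∧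
      Integrable (fun ω => Z ω ^ (δ / α)) P ∧
      TendstoInMeasure P
        (fun (t : ℝ≥0) ω => maxWeight β (ν t ω) ω / gammaRatio S (ν t ω) ^ (1 / α)) atTop
        (fun _ => 0) ∧
      TendstoInMeasure P
        (fun (t : ℝ≥0) ω => maxWeight β (ν t ω) ω * Real.exp (-μ * t)) atTop
        (fun _ => 0) := by

  subst hβ
  obtain ⟨S₀, hS1, hcS, hsS, hmom⟩ :=
    exists_moment_of_spectralFn_lt_top hα hLm hRm hL hR hLR hα'
  have hδ0 : 0 < δ := hα.trans hδ
  obtain ⟨S', hS', -, hsS', hmom'⟩ :=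
    exists_moment_of_spectralFn_lt_top hδ0 hLm hRm hL hR hLR (hδα.trans hα')
  obtain rfl : S = S₀ := by rw [hS, hcS, EReal.toReal_coe]
  have hμS : μ = S / α := by rw [hμ, hsS, EReal.toReal_coe]
  have hlt : S' / δ < S / α := by
    rw [hsS, hsS'] at hδα
    exact_mod_cast hδα
  have hp : 1 < δ / α := (one_lt_div hα).2 hδ
  have hSS : S' < δ / α * S := by
    rw [div_lt_iff₀ hδ0] at hlt
    calc S' < S / α * δ := hlt
      _ = δ / α * S := by ring
  have hαp : α * (δ / α) = δ := by field_simp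
  set N := normalizedLimit (splitWeight Ls Rs I) α S with hN
  have hNm : Measurable N := hcoll.measurable_normalizedLimit α S
  have hN0 : 0 ≤ᵐ[P] N := hcoll.ae_normalizedLimit_nonneg hLm hRm hL hR hS1 hmom
  have hNlim := hcoll.ae_exists_tendsto_weightSum hLm hRm hL hR hS1 hmom
  have hNmom := hcoll.lintegral_normalizedLimit hLm hRm hL hR hp hS1 hS' hSS hmom
    (by rw [hαp]; exact hmom')
  have hnn := hcoll.ae_weightSum_nonneg hLm hRm hL hR α
  have hΓ : 0 < Real.Gamma (S + 1) := Real.Gamma_pos_of_pos (by linarith)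
  obtain ⟨f, hf, hElaw, hElim⟩ := hν.exists_limit
  set E : Ω → ℝ := fun ω => f fun t => ν t ω with hE
  have hEm : Measurable E := hf.comp (measurable_pi_lambda _ hν.measurable)
  have hE0 := hElaw.ae_pos_of_exp
  have hind : IndepFun E N P := indepFun_normalizedLimit hνβ hf α S
  set Z : Ω → ℝ := fun ω => E ω ^ S * N ω / Real.Gamma (S + 1) with hZ
  have hZm : Measurable Z := ((hEm.pow_const S).mul hNm).div_const _
  have hZ0 : 0 ≤ᵐ[P] Z := by
    filter_upwards [hE0, hN0] with ω h1 h2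
    exact div_nonneg (mul_nonneg (Real.rpow_nonneg h1.le S) h2) hΓ.le
  have hYlim : ∀ᵐ ω ∂P, Tendsto (fun t : ℝ≥0 => gammaRatio S (ν t ω) * Real.exp (-S * t)) atTop
      (𝓝 (E ω ^ S / Real.Gamma (S + 1))) := by
    filter_upwards [hν.ae_exists_tendsto, hElim, hE0] with ω h1 h2 h3
    exact tendsto_gammaRatio_mul_exp hS1 h3 h1.2.1 h2
  have hZlim : ∀ᵐ ω ∂P, Tendsto (fun t : ℝ≥0 =>
      Real.exp (-S * t) * weightSum (splitWeight Ls Rs I) α (ν t ω) ω) atTop (𝓝 (Z ω)) := by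
    filter_upwards [hν.ae_exists_tendsto, hYlim, hNlim] with ω h1 h2 h3
    have h4 := h2.mul (h3.comp h1.2.1)
    rw [div_mul_eq_mul_div] at h4
    refine h4.congr fun t => ?_
    have := (gammaRatio_pos hS1 (h1.1 t)).ne'
    simp only [Function.comp_apply]
    field_simp
  have hMm : ∀ t : ℝ≥0, Measurable fun ω =>
      Real.exp (-S * t) * weightSum (splitWeight Ls Rs I) α (ν t ω) ω := fun t =>
    (measurable_comp_natCast_index (fun n => hcoll.measurable_weightSum α n)
      (hν.measurable t)).const_mul _
  have hM0 : ∀ t : ℝ≥0, 0 ≤ᵐ[P] fun ω =>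
      Real.exp (-S * t) * weightSum (splitWeight Ls Rs I) α (ν t ω) ω := fun t => by
    filter_upwards [hnn] with ω hω
    exact mul_nonneg (Real.exp_pos _).le (hω _)
  have hMint : ∀ t : ℝ≥0, ∫⁻ ω, ENNReal.ofReal
      (Real.exp (-S * t) * weightSum (splitWeight Ls Rs I) α (ν t ω) ω) ∂P = 1 := fun t => by
    rw [hν.lintegral_ofReal_weightSum hcoll hLm hRm hL hR hνβ hS1 hmom (Real.exp_pos _).le,
      ← Real.exp_add]
    simp
  have hZint : ∫⁻ ω, ENNReal.ofReal (Z ω) ∂P = 1 := by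
    have h1 := lintegral_rpow_mul_of_indepFun hEm hElaw hNm hN0 hind (p := 1) (S := S) (by linarith)
    simp only [Real.rpow_one, one_mul] at h1
    simp_rw [hZ, div_eq_inv_mul, ENNReal.ofReal_mul (inv_nonneg.2 hΓ.le)]
    rw [lintegral_const_mul _ (by fun_prop), h1, hNmom.1, mul_one,
      ← ENNReal.ofReal_mul (inv_nonneg.2 hΓ.le), inv_mul_cancel₀ hΓ.ne', ENNReal.ofReal_one]
  have hZp : ∫⁻ ω, ENNReal.ofReal (Z ω ^ (δ / α)) ∂P ≠ ∞ := by
    have h1 := lintegral_rpow_mul_of_indepFun hEm hElaw hNm hN0 hind (p := δ / α) (S := S)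
      (by linarith)
    have hc : 0 ≤ ((Real.Gamma (S + 1)) ^ (δ / α))⁻¹ := by positivity
    have h2 : ∀ᵐ ω ∂P, ENNReal.ofReal (Z ω ^ (δ / α)) =
        ENNReal.ofReal ((Real.Gamma (S + 1)) ^ (δ / α))⁻¹ *
          ENNReal.ofReal ((E ω ^ S * N ω) ^ (δ / α)) := by
      filter_upwards [hE0, hN0] with ω h1 h2
      rw [← ENNReal.ofReal_mul hc, hZ]
      simp only
      rw [Real.div_rpow (mul_nonneg (Real.rpow_nonneg h1.le S) h2) hΓ.le, div_eq_inv_mul]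
    rw [lintegral_congr_ae h2, lintegral_const_mul _ (by fun_prop), h1]
    exact ENNReal.mul_ne_top ENNReal.ofReal_ne_top
      (ENNReal.mul_ne_top ENNReal.ofReal_ne_top hNmom.2)
  have hinteg : ∀ {X : Ω → ℝ}, Measurable X → 0 ≤ᵐ[P] X → ∫⁻ ω, ENNReal.ofReal (X ω) ∂P ≠ ∞ →
      Integrable X P := fun hXm hX0 hX =>
    ⟨hXm.aestronglyMeasurable, (hasFiniteIntegral_iff_ofReal hX0).2 hX.lt_top⟩
  refine ⟨hNlim, E, Z, hEm, hElaw, hind, fun ω => rfl, hYlim, hZlim,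
    fun t => hinteg (hMm t) (hM0 t) (by rw [hMint t]; exact ENNReal.one_ne_top),
    hinteg hZm hZ0 (by rw [hZint]; exact ENNReal.one_ne_top),
    tendsto_eLpNorm_one_sub_of_tendsto_ae hMm hZm hM0 hZ0 (fun t => by rw [hMint, hZint])
      (by rw [hZint]; exact ENNReal.one_ne_top) hZlim, fun t => ?_, ?_,
    hν.solvesFixedPoint hcoll hLm hRm hL hR hνβ hZm hZ0 hZlim,
    hinteg (hZm.pow_const _) ?_ hZp,
    hν.tendstoInMeasure_maxWeight_div hcoll hLm hRm hL hR hνβ hα hδ0 hS1 hS' hSS hmom',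
    hν.tendstoInMeasure_maxWeight_mul_exp hcoll hLm hRm hL hR hνβ hδ0 hS' ?_ hmom'⟩
  · rw [integral_eq_lintegral_of_nonneg_ae (hM0 t) (hMm t).aestronglyMeasurable, hMint t,
      ENNReal.toReal_one]
  · rw [integral_eq_lintegral_of_nonneg_ae hZ0 hZm.aestronglyMeasurable, hZint, ENNReal.toReal_one]
  · filter_upwards [hZ0] with ω hω
    exact Real.rpow_nonneg hω _
  · rw [hμS]
    exact (div_lt_iff₀ hδ0).1 hlt
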